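/- Let $k$ be a field of characteristic zero, let $V=k^5$ with basis $e_1,\dots,e_5$, and let $\mathrm{G}(2,5)\subset\mathbb{P}^9_k=\mathbb{P}_k(\Lambda^2V^\vee)$ be the Grassmannian of $2$-dimensional subspaces of $V$ in its Plücker embedding, that is, the closed subscheme defined by the quadrics $w_{ij}w_{lm}-w_{il}w_{jm}+w_{im}w_{jl}$, $1\le i<j<l<m\le 5$, in the Plücker coordinates $w_{ij}=e_i^\vee\wedge e_j^\vee$. Let $L\subset\Lambda^2V^\vee$ be a linear subspace of dimension $c\le 2$, regarded both as a space of alternating bilinear forms on $V$ and as a space of linear forms on $\mathbb{P}^9_k$, and let $X_L=\mathrm{G}(2,5)\cap\{s=0 \text{ for all } s\in L\}$ be the section of $\mathrm{G}(2,5)$ by the corresponding linear subspace of codimension $c$. Assume that $X_L$ is smooth over $k$. Put $n=6-c$. A vector group structure on a $k$-scheme $X$ is an effective action of a vector group $\mathbb{G}_{a,k}^m$ on $X$ with a Zariski dense open orbit, where $X$ is required to be an integral $k$-scheme of finite type. Then the following hold. (1) $X_L$ admits a vector group structure. (2) There is a $3$-dimensional subspace $V_3\subset V$ on which all forms in $L$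 vanish; that is, $X_L$ contains the plane $\Xi=\sigma_{2,2}(V_3)$ of the $2$-dimensional subspaces of $V_3$. (3) Let $V_3$ be any $3$-dimensional subspace of $V$ on which all forms in $L$ vanish, and let $K^\vee\subset\Lambda^2V^\vee$ be the space of forms vanishing on $V_3$. There are $\zeta_0,\dots,\zeta_n\in K^\vee$ whose classes form a basis of $K^\vee/L$ and such that $\zeta_0$ spans the line $\Lambda^2(V/V_3)^\vee$. For every such choice, the projection from $\Xi$, $$\pi_\Xi: X_L\dashrightarrow\mathbb{P}^n_k,\qquad [w]\mapsto[\zeta_0(w):\dots:\zeta_n(w)],$$ is a morphism on $X_L\setminus\Xi=X_L\setminus\{\zeta_0=\dots=\zeta_n=0\}$ which restricts to an isomorphism $X_L\setminus\{\zeta_0=0\}\cong\mathbb{P}^n_k\setminus\{z_0=0\}$. Moreover there is an action of $\mathbb{G}_{a,k}^n$ on $X_L$ which is a vector group structure with dense open orbit $X_L\setminus\{\zeta_0=0\}$, which preserves $X_L\setminus\Xi$, and for which $\pi_\Xi|_{X_L\setminus\Xi}$ is equivariant with respect to the toric action $z_0\mapsto z_0$, $z_i\mapsto z_i+t_iz_0$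 ($1\le i\le n$) of $\mathbb{G}_{a,k}^n$ on $\mathbb{P}^n_k$. This action is the restriction to $X_L$ of the action on $\mathbb{P}_k(\Lambda^2V^\vee)$ induced by $\Lambda^2\rho$ for some unipotent representation $\rho:\mathbb{G}_{a,k}^n\to\mathrm{GL}_k(V^\vee)$. -/

import Mathlib

open AlgebraicGeometry CategoryTheory MonoidalCategory CartesianMonoidalCategory

universe u

namespace LinearSectionG25

/-! ### Projective space and homogeneous coordinates -/

/-- Polynomial rings are graded by the total degree. -/
noncomputable instance instPolyGraded (ι : Type) (k : Type u) [Field k] :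
    GradedAlgebra (MvPolynomial.homogeneousSubmodule ι k) :=
  MvPolynomial.gradedAlgebra

/-- The projective space over `k` with homogeneous coordinates indexed by `ι`. -/
noncomputable abbrev PSpace (ι : Type) (k : Type u) [Field k] : Scheme.{u} :=
  Proj (MvPolynomial.homogeneousSubmodule ι k)

/-- The ring homomorphism `k → Γ(T, 𝒪_T)` of a `k`-scheme `T`. -/
noncomputable def scalars {k : Type u} [Field k] (T : Over (Spec (.of k))) :
    k →+* Γ(T.left, ⊤) :=
  ((Scheme.ΓSpecIso (.of k)).inv ≫ T.hom.appTop).hom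

theorem irrelevant_map_eq_top {ι : Type} {k : Type u} [Field k] {B : Type u} [CommRing B]
    (a : k →+* B) (v : ι → B) (hv : Ideal.span (Set.range v) = ⊤) :
    (HomogeneousIdeal.irrelevant (MvPolynomial.homogeneousSubmodule ι k)).toIdeal.map
      (MvPolynomial.eval₂Hom a v) = ⊤ := by
  rw [eq_top_iff, ← hv, Ideal.span_le]
  rintro _ ⟨i, rfl⟩
  have h : MvPolynomial.X i ∈
      (HomogeneousIdeal.irrelevant (MvPolynomial.homogeneousSubmodule ι k)).toIdeal :=
    HomogeneousIdeal.mem_irrelevant_of_mem _ one_pos (MvPolynomial.isHomogeneous_X k i)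
  have := Ideal.mem_map_of_mem (MvPolynomial.eval₂Hom a v) h
  simpa using this

/-- The morphism `[v] : T → ℙ^ι_k` of `k`-schemes with homogeneous coordinates `v`, where `v` is a
family of functions on `T` generating the unit ideal. -/
noncomputable def homogPoint {ι : Type} {k : Type u} [Field k] (T : Over (Spec (.of k)))
    (v : ι → Γ(T.left, ⊤)) (hv : Ideal.span (Set.range v) = ⊤) : T.left ⟶ PSpace ι k :=
  Proj.fromOfGlobalSections (MvPolynomial.homogeneousSubmodule ι k)
    (MvPolynomial.eval₂Hom (scalars T) v) (irrelevant_map_eq_top _ v hv)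

/-! ### Closed subschemes of projective space -/

/-- The grading of `k[x] / I` by total degree. -/
noncomputable def quotGrading {ι : Type} {k : Type u} [Field k]
    (I : HomogeneousIdeal (MvPolynomial.homogeneousSubmodule ι k)) :
    ℕ → Submodule k (MvPolynomial ι k ⧸ I.toIdeal) := fun d ↦
  (MvPolynomial.homogeneousSubmodule ι k d).map (Ideal.Quotient.mkₐ k I.toIdeal).toLinearMap

instance instQuotGradedMonoid {ι : Type} {k : Type u} [Field k]
    (I : HomogeneousIdeal (MvPolynomial.homogeneousSubmodule ι k)) :
    SetLike.GradedMonoid (quotGrading I) where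
  one_mem := ⟨1, MvPolynomial.isHomogeneous_one ι k, map_one (Ideal.Quotient.mkₐ k _)⟩
  mul_mem := by
    rintro i j _ _ ⟨p, hp, rfl⟩ ⟨q, hq, rfl⟩
    exact ⟨p * q, MvPolynomial.IsHomogeneous.mul hp hq, map_mul (Ideal.Quotient.mkₐ k _) p q⟩

/-- The degree `d` part of the quotient map `k[x] → k[x] / I`. -/
noncomputable def quotMap {ι : Type} {k : Type u} [Field k]
    (I : HomogeneousIdeal (MvPolynomial.homogeneousSubmodule ι k)) (d : ℕ) :
    MvPolynomial.homogeneousSubmodule ι k d →ₗ[k] quotGrading I d :=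
  (Ideal.Quotient.mkₐ k I.toIdeal).toLinearMap.submoduleMap
    (MvPolynomial.homogeneousSubmodule ι k d)

/-- The linear map sending `p` to the family of the classes of its homogeneous components. -/
noncomputable def quotDecomposeAux {ι : Type} {k : Type u} [Field k]
    (I : HomogeneousIdeal (MvPolynomial.homogeneousSubmodule ι k)) :
    MvPolynomial ι k →ₗ[k] DirectSum ℕ fun d ↦ quotGrading I d :=
  DirectSum.lmap (quotMap I) ∘ₗ
    (DirectSum.decomposeLinearEquiv (MvPolynomial.homogeneousSubmodule ι k)).toLinearMap

theorem coeLinearMap_quotDecomposeAux {ι : Type} {k : Type u} [Field k]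
    (I : HomogeneousIdeal (MvPolynomial.homogeneousSubmodule ι k)) (p : MvPolynomial ι k) :
    DirectSum.coeLinearMap (quotGrading I) (quotDecomposeAux I p) =
      Ideal.Quotient.mk I.toIdeal p := by
  induction p using DirectSum.Decomposition.inductionOn
    (MvPolynomial.homogeneousSubmodule ι k) with
  | zero => simp
  | homogeneous m =>
    simp only [quotDecomposeAux, LinearMap.comp_apply, LinearEquiv.coe_coe,
      DirectSum.decomposeLinearEquiv_apply, DirectSum.decompose_coe, DirectSum.lmap_of,
      DirectSum.coeLinearMap_of]
    rfl
  | add p q hp hq => simp only [map_add, hp, hq]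

theorem quotDecomposeAux_of_mem {ι : Type} {k : Type u} [Field k]
    (I : HomogeneousIdeal (MvPolynomial.homogeneousSubmodule ι k)) (p : MvPolynomial ι k)
    (hp : p ∈ I.toIdeal) : quotDecomposeAux I p = 0 := by
  refine DFinsupp.ext fun d ↦ Subtype.ext ?_
  have h : ((DirectSum.decompose (MvPolynomial.homogeneousSubmodule ι k) p d :
      MvPolynomial ι k)) ∈ I.toIdeal := I.isHomogeneous d hp
  exact Ideal.Quotient.eq_zero_iff_mem.mpr h

/-- The decomposition of a class in `k[x] / I` into its homogeneous components. -/
noncomputable def quotDecompose {ι : Type} {k : Type u} [Field k]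
    (I : HomogeneousIdeal (MvPolynomial.homogeneousSubmodule ι k)) :
    (MvPolynomial ι k ⧸ I.toIdeal) →+ DirectSum ℕ fun d ↦ quotGrading I d :=
  QuotientAddGroup.lift _ (quotDecomposeAux I).toAddMonoidHom fun p hp ↦
    quotDecomposeAux_of_mem I p hp

/-- `k[x] / I` is a graded `k`-algebra if `I` is homogeneous. -/
noncomputable instance instQuotGraded {ι : Type} {k : Type u} [Field k]
    (I : HomogeneousIdeal (MvPolynomial.homogeneousSubmodule ι k)) :
    GradedAlgebra (quotGrading I) where
  decompose' := quotDecompose I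
  left_inv x := by
    obtain ⟨p, rfl⟩ := Ideal.Quotient.mk_surjective x
    exact coeLinearMap_quotDecomposeAux I p
  right_inv x := by
    induction x using DirectSum.induction_on with
    | zero => simp
    | of d x =>
      obtain ⟨_, p, hp, rfl⟩ := x
      rw [DirectSum.coeAddMonoidHom_of]
      change quotDecomposeAux I p = _
      simp only [quotDecomposeAux, LinearMap.comp_apply, LinearEquiv.coe_coe,
        DirectSum.decomposeLinearEquiv_apply, DirectSum.decompose_of_mem _ hp, DirectSum.lmap_of]
      rfl
    | add x y hx hy => simp only [map_add, hx, hy]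

/-- The quotient map `k[x] → k[x] / I` as a homomorphism of graded rings. -/
noncomputable def quotGradedHom {ι : Type} {k : Type u} [Field k]
    (I : HomogeneousIdeal (MvPolynomial.homogeneousSubmodule ι k)) :
    MvPolynomial.homogeneousSubmodule ι k →+*ᵍ quotGrading I where
  toRingHom := Ideal.Quotient.mk I.toIdeal
  map_mem hp := ⟨_, hp, rfl⟩

theorem irrelevant_le_map_quotGradedHom {ι : Type} {k : Type u} [Field k]
    (I : HomogeneousIdeal (MvPolynomial.homogeneousSubmodule ι k)) :
    HomogeneousIdeal.irrelevant (quotGrading I) ≤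
      (HomogeneousIdeal.irrelevant (MvPolynomial.homogeneousSubmodule ι k)).map
        (quotGradedHom I) := by
  rw [HomogeneousIdeal.irrelevant_le]
  rintro d hd _ ⟨p, hp, rfl⟩
  exact Ideal.mem_map_of_mem (quotGradedHom I)
    (HomogeneousIdeal.mem_irrelevant_of_mem _ hd hp)

/-- The closed subscheme `Proj (k[x] / I)` of projective space defined by the homogeneous
ideal `I`, as a `k`-scheme. -/
noncomputable def projSubscheme {ι : Type} {k : Type u} [Field k]
    (I : HomogeneousIdeal (MvPolynomial.homogeneousSubmodule ι k)) : Over (Spec (.of k)) :=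
  Over.mk (Y := Proj (quotGrading I)) (Proj.toSpecZero (quotGrading I) ≫
    Spec.map (CommRingCat.ofHom (algebraMap k (quotGrading I 0))))

/-- The closed immersion `Proj (k[x] / I) → ℙ^ι_k`. -/
noncomputable def projSubschemeEmb {ι : Type} {k : Type u} [Field k]
    (I : HomogeneousIdeal (MvPolynomial.homogeneousSubmodule ι k)) :
    (projSubscheme I).left ⟶ PSpace ι k :=
  Proj.map (quotGradedHom I) (irrelevant_le_map_quotGradedHom I)

/-- The open subscheme of `Proj (k[x] / I)` where the polynomial `f` does not vanish. -/
noncomputable def projSubschemeBasicOpen {ι : Type} {k : Type u} [Field k]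
    (I : HomogeneousIdeal (MvPolynomial.homogeneousSubmodule ι k)) (f : MvPolynomial ι k) :
    (projSubscheme I).left.Opens :=
  Proj.basicOpen (quotGrading I) (Ideal.Quotient.mk I.toIdeal f)

/-! ### Linear sections of the Grassmannian `G(2,5) ⊂ ℙ⁹` -/

/-- The index set `{(i, j) | i < j}` of the Plücker coordinates `w_ij` of `ℙ⁹`. -/
abbrev Pairs : Type := {p : Fin 5 × Fin 5 // p.1 < p.2}

/-- The Plücker quadric `w_ij w_lm - w_il w_jm + w_im w_jl`, for `i < j < l < m`. -/
noncomputable def pluckerQuadric (k : Type u) [Field k] (i j l m : Fin 5) (hij : i < j)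
    (hjl : j < l) (hlm : l < m) : MvPolynomial Pairs k :=
  .X ⟨(i, j), hij⟩ * .X ⟨(l, m), hlm⟩
    - .X ⟨(i, l), hij.trans hjl⟩ * .X ⟨(j, m), hjl.trans hlm⟩
    + .X ⟨(i, m), (hij.trans hjl).trans hlm⟩ * .X ⟨(j, l), hjl⟩

/-- The linear form `∑ s_ij w_ij` on `ℙ⁹` of an element `s = ∑ s_ij e_i^∨ ∧ e_j^∨` of `Λ² V^∨`,
where `V = k⁵`. -/
noncomputable def linForm {k : Type u} [Field k] (s : Pairs → k) : MvPolynomial Pairs k :=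
  ∑ p, .C (s p) * .X p

/-- The equations of the section of `G(2,5)` by the linear subspace `{s = 0 for all s ∈ L}`. -/
def sectionEquations {k : Type u} [Field k] (L : Submodule k (Pairs → k)) :
    Set (MvPolynomial Pairs k) :=
  {f | ∃ (i j l m : Fin 5) (hij : i < j) (hjl : j < l) (hlm : l < m),
      f = pluckerQuadric k i j l m hij hjl hlm} ∪ {f | ∃ s ∈ L, f = linForm s}

theorem sectionEquations_homogeneous {k : Type u} [Field k] (L : Submodule k (Pairs → k)) :
    (Ideal.span (sectionEquations L)).IsHomogeneous
      (MvPolynomial.homogeneousSubmodule Pairs k) := by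
  refine Ideal.homogeneous_span _ _ ?_
  rintro f (⟨i, j, l, m, hij, hjl, hlm, rfl⟩ | ⟨s, -, rfl⟩)
  · have h : ∀ p q : Pairs, (MvPolynomial.X p * MvPolynomial.X q : MvPolynomial Pairs k) ∈
        MvPolynomial.homogeneousSubmodule Pairs k 2 := fun p q ↦
      (MvPolynomial.isHomogeneous_X k p).mul (MvPolynomial.isHomogeneous_X k q)
    exact ⟨2, add_mem (sub_mem (h _ _) (h _ _)) (h _ _)⟩
  · exact ⟨1, sum_mem fun p _ ↦ (MvPolynomial.isHomogeneous_X k p).C_mul (s p)⟩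

/-- The homogeneous ideal of the section of `G(2,5)` by `{s = 0 for all s ∈ L}`. -/
noncomputable def sectionIdeal {k : Type u} [Field k] (L : Submodule k (Pairs → k)) :
    HomogeneousIdeal (MvPolynomial.homogeneousSubmodule Pairs k) :=
  ⟨Ideal.span (sectionEquations L), sectionEquations_homogeneous L⟩

/-- The section `X_L` of `G(2,5) ⊂ ℙ⁹` by the linear subspace `{s = 0 for all s ∈ L}`, a linear
subspace of codimension `dim L`, as a `k`-scheme. -/
noncomputable def linearSection {k : Type u} [Field k] (L : Submodule k (Pairs → k)) :
    Over (Spec (.of k)) :=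
  projSubscheme (sectionIdeal L)

/-- The closed immersion `X_L → ℙ⁹`. -/
noncomputable def linearSectionEmb {k : Type u} [Field k] (L : Submodule k (Pairs → k)) :
    (linearSection L).left ⟶ PSpace Pairs k :=
  projSubschemeEmb (sectionIdeal L)

/-- The complement in `X_L` of the hyperplane section `{s = 0}`. -/
noncomputable def nonvanishing {k : Type u} [Field k] (L : Submodule k (Pairs → k))
    (s : Pairs → k) : (linearSection L).left.Opens :=
  projSubschemeBasicOpen (sectionIdeal L) (linForm s)

/-! ### Vector groups, their actions and representations -/

/-- The vector group `𝔾_a^n` over `k`: the underlying scheme is the affine space. -/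
noncomputable def vectorGroup (k : Type u) [Field k] (n : ℕ) : Over (Spec (.of k)) :=
  Over.mk (𝔸(ULift.{u} (Fin n); Spec (.of k)) ↘ Spec (.of k))

/-- The coordinates of a `T`-point of `𝔾_a^n`. -/
noncomputable def coords {k : Type u} [Field k] {n : ℕ} {T : Over (Spec (.of k))}
    (t : T ⟶ vectorGroup k n) : Fin n → Γ(T.left, ⊤) := fun i ↦
  t.left.appTop (AffineSpace.coord (Spec (.of k)) ⟨i⟩)

/-- A `T`-point of `𝔾_a^n` is the same as an `n`-tuple of functions on `T`. -/
noncomputable def coordsEquiv {k : Type u} [Field k] {n : ℕ} {T : Over (Spec (.of k))} :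
    (T ⟶ vectorGroup k n) ≃ Multiplicative (Fin n → Γ(T.left, ⊤)) where
  toFun t := .ofAdd (coords t)
  invFun v := Over.homMk (AffineSpace.homOfVector T.hom fun i ↦ v.toAdd i.down)
    (AffineSpace.homOfVector_over _ _)
  left_inv t := by
    ext1
    refine AffineSpace.hom_ext ?_ fun i ↦ ?_
    · exact (AffineSpace.homOfVector_over _ _).trans (Over.w t).symm
    · exact AffineSpace.homOfVector_appTop_coord _ _ _
  right_inv v := by
    refine Multiplicative.toAdd.injective (funext fun i ↦ ?_)
    exact AffineSpace.homOfVector_appTop_coord _ _ _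

/-- The pullback of `n`-tuples of functions along a morphism of `k`-schemes. -/
noncomputable def pullTuple {k : Type u} [Field k] (n : ℕ) {T T' : Over (Spec (.of k))}
    (f : T ⟶ T') : Multiplicative (Fin n → Γ(T'.left, ⊤)) →*
      Multiplicative (Fin n → Γ(T.left, ⊤)) :=
  AddMonoidHom.toMultiplicative (f.left.appTop.hom.toAddMonoidHom.compLeft (Fin n))

theorem pullTuple_id {k : Type u} [Field k] (n : ℕ) (T : Over (Spec (.of k))) :
    pullTuple n (𝟙 T) = MonoidHom.id _ := by
  refine MonoidHom.ext fun v ↦ Multiplicative.toAdd.injective (funext fun i ↦ ?_)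
  have h : Scheme.Hom.appTop (𝟙 T.left) = 𝟙 Γ(T.left, ⊤) := Scheme.Hom.id_appTop
  exact congrArg (fun φ : Γ(T.left, ⊤) ⟶ Γ(T.left, ⊤) ↦ φ.hom (Multiplicative.toAdd v i)) h

theorem pullTuple_comp {k : Type u} [Field k] (n : ℕ) {T T' T'' : Over (Spec (.of k))}
    (f : T ⟶ T') (g : T' ⟶ T'') :
    pullTuple n (f ≫ g) = (pullTuple n f).comp (pullTuple n g) := by
  refine MonoidHom.ext fun v ↦ Multiplicative.toAdd.injective (funext fun i ↦ ?_)
  exact congrArg (fun φ : Γ(T''.left, ⊤) ⟶ Γ(T.left, ⊤) ↦ φ.hom (Multiplicative.toAdd v i))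
    (Scheme.Hom.comp_appTop f.left g.left)

/-- The functor `T ↦ Γ(T, 𝒪_T)^n`, with the additive group structure (written multiplicatively). -/
noncomputable def vectorGroupFunctor (k : Type u) [Field k] (n : ℕ) :
    (Over (Spec (.of k)))ᵒᵖ ⥤ GrpCat.{u} where
  obj T := .of (Multiplicative (Fin n → Γ(T.unop.left, ⊤)))
  map f := GrpCat.ofHom (pullTuple n f.unop)
  map_id T := congrArg GrpCat.ofHom (pullTuple_id n T.unop)
  map_comp f g := congrArg GrpCat.ofHom (pullTuple_comp n g.unop f.unop)

/-- `𝔾_a^n` is a group scheme: the group law on `T`-points is the addition of coordinates. -/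
noncomputable instance instGrpObjVectorGroup (k : Type u) [Field k] (n : ℕ) :
    GrpObj (vectorGroup k n) :=
  GrpObj.ofRepresentableBy _ (vectorGroupFunctor k n)
    { homEquiv := coordsEquiv
      homEquiv_comp := by
        intro T T' f g
        refine Multiplicative.toAdd.injective (funext fun i ↦ ?_)
        exact congrArg (fun φ ↦ φ.hom (AffineSpace.coord (Spec (.of k)) ⟨i⟩))
          (Scheme.Hom.comp_appTop f.left g.left) }

/-- An action of a group scheme `G` on `X` is effective: a `T`-point of `G` that acts trivially on
`T × X` is the neutral element. -/
def IsEffectiveAction {k : Type u} [Field k] (G X : Over (Spec (.of k))) [GrpObj G]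
    [ModObj G X] : Prop :=
  ∀ (T : Over (Spec (.of k))) (g : T ⟶ G),
    (fst T X ≫ g) • snd T X = snd T X → g = toUnit T ≫ MonObj.one

/-- The open subset `U` of `X` is an orbit of the action of `G` on `X`: it is not empty, and the
geometric points of `U` form one orbit among the geometric points of `X`. -/
def IsOpenOrbit {k : Type u} [Field k] (G X : Over (Spec (.of k))) [GrpObj G] [ModObj G X]
    (U : X.left.Opens) : Prop :=
  (U : Set X.left).Nonempty ∧
    ∀ (K : Type u) [Field K] [IsAlgClosed K] (a : Spec (.of K) ⟶ Spec (.of k))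
      (x y : Over.mk a ⟶ X), Set.range x.left ⊆ U →
        (Set.range y.left ⊆ U ↔ ∃ g : Over.mk a ⟶ G, g • x = y)

/-- The action of the vector group `𝔾_a^n` on the `k`-scheme `X` makes it a vector group variety:
`X` is an integral `k`-scheme of finite type, and the action is effective with `U` as a dense
open orbit. -/
structure IsVectorGroupStructure {k : Type u} [Field k] (n : ℕ) (X : Over (Spec (.of k)))
    [ModObj (vectorGroup k n) X] (U : X.left.Opens) : Prop where
  isIntegral : IsIntegral X.left
  locallyOfFiniteType : LocallyOfFiniteType X.hom
  quasiCompact : QuasiCompact X.hom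
  effective : IsEffectiveAction (vectorGroup k n) X
  orbit : IsOpenOrbit (vectorGroup k n) X U
  dense : Dense (U : Set X.left)

/-- The `k`-scheme `X` admits a vector group structure. -/
def AdmitsVectorGroupStructure {k : Type u} [Field k] (X : Over (Spec (.of k))) : Prop :=
  ∃ (n : ℕ) (_ : ModObj (vectorGroup k n) X) (U : X.left.Opens), IsVectorGroupStructure n X U

/-- An algebraic representation `𝔾_a^n → GL_m`, given by a matrix of polynomials in the
coordinates `t` of `𝔾_a^n` with `ρ(0) = 1` and `ρ(t + t') = ρ(t) ρ(t')`. -/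
structure VectorGroupRep (k : Type u) [Field k] (n m : ℕ) where
  mat : Matrix (Fin m) (Fin m) (MvPolynomial (Fin n) k)
  map_zero : mat.map (MvPolynomial.eval 0) = 1
  map_add : mat.map (MvPolynomial.aeval fun i ↦
      (.X (.inl i) + .X (.inr i) : MvPolynomial (Fin n ⊕ Fin n) k)) =
    mat.map (MvPolynomial.rename Sum.inl) * mat.map (MvPolynomial.rename Sum.inr)

/-- The representation is unipotent. -/
def VectorGroupRep.IsUnipotent {k : Type u} [Field k] {n m : ℕ} (ρ : VectorGroupRep k n m) :
    Prop :=
  IsNilpotent (ρ.mat - 1)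

/-- The matrix `ρ(t)` at a `T`-point `t` of `𝔾_a^n`. -/
noncomputable def VectorGroupRep.evalAt {k : Type u} [Field k] {n m : ℕ} (ρ : VectorGroupRep k n m)
    {T : Over (Spec (.of k))} (t : T ⟶ vectorGroup k n) :
    Matrix (Fin m) (Fin m) Γ(T.left, ⊤) :=
  ρ.mat.map (MvPolynomial.eval₂Hom (scalars T) (coords t))

/-- If `A` acts on `V^∨` by `e_j^∨ ↦ ∑ i, A i j e_i^∨`, then `Λ² A` acts on the Plücker coordinates
`w_ij = e_i^∨ ∧ e_j^∨` by `w_ij ↦ ∑ a < b, (A a i * A b j - A a j * A b i) w_ab`. -/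
def wedgeAct {R : Type u} [CommRing R] (A : Matrix (Fin 5) (Fin 5) R) (w : Pairs → R) :
    Pairs → R := fun p ↦
  ∑ q : Pairs, (A q.1.1 p.1.1 * A q.1.2 p.1.2 - A q.1.1 p.1.2 * A q.1.2 p.1.1) * w q

/-- The action of `𝔾_a^n` on `X_L` is the restriction of the action on `ℙ⁹ = ℙ(Λ² V^∨)` induced
by the second exterior power of the representation `ρ` on `V^∨`. -/
def IsInducedByWedge {k : Type u} [Field k] {n : ℕ} (L : Submodule k (Pairs → k))
    [ModObj (vectorGroup k n) (linearSection L)] (ρ : VectorGroupRep k n 5) : Prop :=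
  ∀ (T : Over (Spec (.of k))) [IsAffine T.left] (t : T ⟶ vectorGroup k n)
    (x : T ⟶ linearSection L) (w : Pairs → Γ(T.left, ⊤)) (hw : Ideal.span (Set.range w) = ⊤),
    x.left ≫ linearSectionEmb L = homogPoint T w hw →
      ∃ hw' : Ideal.span (Set.range (wedgeAct (ρ.evalAt t) w)) = ⊤,
        (t • x).left ≫ linearSectionEmb L = homogPoint T (wedgeAct (ρ.evalAt t) w) hw'

/-! ### `σ_{2,2}`-planes and the projections from them -/

/-- The alternating bilinear form on `V = k⁵` of an element `s = ∑ s_ij e_i^∨ ∧ e_j^∨`. -/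
def altForm {k : Type u} [Field k] (s : Pairs → k) (x y : Fin 5 → k) : k :=
  ∑ p : Pairs, s p * (x p.1.1 * y p.1.2 - x p.1.2 * y p.1.1)

theorem altForm_add {k : Type u} [Field k] (s s' : Pairs → k) (x y : Fin 5 → k) :
    altForm (s + s') x y = altForm s x y + altForm s' x y := by
  simp [altForm, add_mul, Finset.sum_add_distrib]

theorem altForm_smul {k : Type u} [Field k] (c : k) (s : Pairs → k) (x y : Fin 5 → k) :
    altForm (c • s) x y = c * altForm s x y := by
  simp [altForm, Finset.mul_sum, mul_assoc]

/-- The forms on `V` that vanish on `V₃`: the linear forms on `ℙ⁹` vanishing on the plane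
`σ_{2,2}(V₃)` of the lines contained in `ℙ(V₃)`. -/
def formsVanishingOn {k : Type u} [Field k] (V₃ : Submodule k (Fin 5 → k)) :
    Submodule k (Pairs → k) where
  carrier := {s | ∀ x ∈ V₃, ∀ y ∈ V₃, altForm s x y = 0}
  zero_mem' x _ y _ := by simp [altForm]
  add_mem' hs hs' x hx y hy := by rw [altForm_add, hs x hx y hy, hs' x hx y hy, add_zero]
  smul_mem' c s hs x hx y hy := by rw [altForm_smul, hs x hx y hy, mul_zero]

/-- The subspace `Λ² (V / V₃)^∨` of `Λ² V^∨`: the forms on `V` whose kernel contains `V₃`. -/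
def formsWithKernel {k : Type u} [Field k] (V₃ : Submodule k (Fin 5 → k)) :
    Submodule k (Pairs → k) where
  carrier := {s | ∀ x ∈ V₃, ∀ y, altForm s x y = 0}
  zero_mem' x _ y := by simp [altForm]
  add_mem' hs hs' x hx y := by rw [altForm_add, hs x hx y, hs' x hx y, add_zero]
  smul_mem' c s hs x hx y := by rw [altForm_smul, hs x hx y, mul_zero]

/-- The forms `ζ 0, …, ζ n` induce a basis of `K^∨ / L`, where `K^∨` is the space of the forms
vanishing on `V₃`, and `ζ 0` spans the line `Λ² (V / V₃)^∨` of `K^∨`. They are the homogeneous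
coordinates of the target `ℙ(K^∨ / L) = ℙⁿ` of the projection of `X_L` from `σ_{2,2}(V₃)`. -/
structure IsProjectionCoordinates {k : Type u} [Field k] {n : ℕ} (L : Submodule k (Pairs → k))
    (V₃ : Submodule k (Fin 5 → k)) (ζ : Fin (n + 1) → Pairs → k) : Prop where
  linearIndependent : LinearIndependent k ζ
  disjoint : Disjoint (Submodule.span k (Set.range ζ)) L
  sup_eq : Submodule.span k (Set.range ζ) ⊔ L = formsVanishingOn V₃
  span_zero : Submodule.span k {ζ 0} = formsWithKernel V₃

/-- The values of the linear forms `ζ i` at homogeneous coordinates `w`. -/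
noncomputable def evalForms {k : Type u} [Field k] {n : ℕ} (ζ : Fin (n + 1) → Pairs → k)
    {T : Over (Spec (.of k))} (w : Pairs → Γ(T.left, ⊤)) : Fin (n + 1) → Γ(T.left, ⊤) := fun i ↦
  ∑ p : Pairs, scalars T (ζ i p) * w p

/-- The complement in `X_L` of the common zeros of the forms `ζ i`. -/
noncomputable def projectionDomain {k : Type u} [Field k] {n : ℕ} (L : Submodule k (Pairs → k))
    (ζ : Fin (n + 1) → Pairs → k) : (linearSection L).left.Opens :=
  ⨆ i, nonvanishing L (ζ i)

/-- The morphism `π` is the linear projection `[w] ↦ [ζ 0 (w) : … : ζ n (w)]`. -/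
def IsLinearProjection {k : Type u} [Field k] {n : ℕ} (L : Submodule k (Pairs → k))
    (ζ : Fin (n + 1) → Pairs → k)
    (π : (projectionDomain L ζ).toScheme ⟶ PSpace (Fin (n + 1)) k) : Prop :=
  ∀ (T : Over (Spec (.of k))) [IsAffine T.left] (y : T.left ⟶ (projectionDomain L ζ).toScheme)
    (w : Pairs → Γ(T.left, ⊤)) (hw : Ideal.span (Set.range w) = ⊤),
    y ≫ (projectionDomain L ζ).ι ≫ linearSectionEmb L = homogPoint T w hw →
      ∃ hz : Ideal.span (Set.range (evalForms ζ w)) = ⊤,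
        y ≫ π = homogPoint T (evalForms ζ w) hz

/-- The morphism `π` restricts to an isomorphism from the complement in `X_L` of the hyperplane
section `{ζ 0 = 0}` onto the complement of the hyperplane `{z_0 = 0}` of `ℙⁿ`. -/
def IsIsoOverComplement {k : Type u} [Field k] {n : ℕ} (L : Submodule k (Pairs → k))
    (ζ : Fin (n + 1) → Pairs → k)
    (π : (projectionDomain L ζ).toScheme ⟶ PSpace (Fin (n + 1)) k) : Prop :=
  (projectionDomain L ζ).ι ''ᵁ (π ⁻¹ᵁ
      Proj.basicOpen (MvPolynomial.homogeneousSubmodule (Fin (n + 1)) k) (.X 0)) =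
    nonvanishing L (ζ 0) ∧
  IsIso (π ∣_ Proj.basicOpen (MvPolynomial.homogeneousSubmodule (Fin (n + 1)) k) (.X 0))

/-- The toric action of `t ∈ 𝔾_a^n` on `ℙⁿ` in homogeneous coordinates: `z_0 ↦ z_0` and
`z_i ↦ z_i + t_i z_0` for `i = 1, …, n`. -/
def toricAct {R : Type u} [CommRing R] {n : ℕ} (t : Fin n → R) (z : Fin (n + 1) → R) :
    Fin (n + 1) → R :=
  Fin.cons (z 0) fun i ↦ z i.succ + t i * z 0

/-- The action of `𝔾_a^n` on `X_L` lifts the toric action on `ℙⁿ` through the projection `π`: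
the domain of `π` is stable, and `π` is equivariant. -/
def LiftsToricAction {k : Type u} [Field k] {n : ℕ} (L : Submodule k (Pairs → k))
    [ModObj (vectorGroup k n) (linearSection L)] (ζ : Fin (n + 1) → Pairs → k)
    (π : (projectionDomain L ζ).toScheme ⟶ PSpace (Fin (n + 1)) k) : Prop :=
  ∀ (T : Over (Spec (.of k))) [IsAffine T.left] (t : T ⟶ vectorGroup k n)
    (x : T ⟶ linearSection L) (y : T.left ⟶ (projectionDomain L ζ).toScheme),
    y ≫ (projectionDomain L ζ).ι = x.left →
      ∃ y' : T.left ⟶ (projectionDomain L ζ).toScheme,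
        y' ≫ (projectionDomain L ζ).ι = (t • x).left ∧
        ∀ (z : Fin (n + 1) → Γ(T.left, ⊤)) (hz : Ideal.span (Set.range z) = ⊤),
          y ≫ π = homogPoint T z hz →
            ∃ hz' : Ideal.span (Set.range (toricAct (coords t) z)) = ⊤,
              y' ≫ π = homogPoint T (toricAct (coords t) z) hz'

end LinearSectionG25

open LinearSectionG25

/-! Let `V₃` be isotropic for `L` and let `K^∨`, of dimension 7, be the space of forms vanishing on
`V₃`. Take covectors `α, β` cutting out `V₃` and dual vectors `a₁, a₂`. A point of `G(2,5)` with `α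
∧ β = 1` is `(a₁ + c) ∧ (a₂ + d)` for unique `c, d` in `V₃`, and a form `s` in `K^∨` takes there the
value `s(a₁, a₂) + s(c, a₂) + s(a₁, d)`, because the quadratic term `s(c, d)` is zero. So in this
chart the equations of `X_L` are affine linear, the chart of `X_L` is an affine space with
coordinates `ζ_i / ζ_0`, and its translations come from the maps `x ↦ x + α(x) c + β(x) d` of `V`.
The nilpotent parts of these maps have all products zero, hence the maps form a unipotent vector
group. Its action extends to all of `X_L`, fixes the form `ζ_0`, and adds to `ζ_i` a multiple of
`ζ_0`: this is the toric action.

The linear algebra is in `IsCoframe.exists_shift` (every functional on `K^∨` killing `α ∧ β` is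
realized by a pair `(c, d)`), `IsProjectionCoordinates.exists_isAdaptedFrame` (a base point and
directions dual to the `ζ_i`), `IsCoframe.pairing_wedgeAct` (the effect of a shift on the values of
forms) and `IsCoframe.eq_wedge_of_pairing` (the values of `K^∨` determine a point of the chart). An
isotropic `V₃` exists by `exists_isotropic`: one form has a kernel vector `v`, and modulo `v` both
forms live on a three-dimensional space, where they are given by two vectors and have a common
isotropic plane.

Smoothness enters three times. First, `L` contains no form of rank two, even after a field extension
(`eq_zero_of_mem_formsWithKernel`): such a form `ω` vanishes to second order along bivectors of its
kernel, which gives a tangent vector modulo `ε²` with no lift modulo `ε³`. Hence `L` does not meet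
the line `Λ² (V / V₃)^∨`, and coordinates `ζ` exist. Second, the same fact gives density of the
chart (`dense_nonvanishing`): through each point outside the plane there is a line of `X_L` leaving
`ζ_0 = 0`, and through each point of the plane there is a line of `X_L` leaving the plane. Third,
smooth over a field implies reduced; with density of the orbit, which is an image of affine space,
this gives integrality.

The passage to schemes uses homogeneous coordinates. A morphism to projective space locally has
coordinates, unique up to a unit (`HasCoords.exists_isUnit`), and an operation on coordinates that
is natural and homogeneous of degree one glues to a morphism (`exists_hom_of_operator`). The action
and the projection are built in this way on points with values in arbitrary `k`-schemes. -/

namespace LinearSectionG25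

/-! ### Morphisms to `Proj` given by global sections -/

section AwayLift

variable {A σ : Type u} [CommRing A] [SetLike σ A] [AddSubgroupClass σ A] (𝒜 : ℕ → σ)
  [GradedRing 𝒜]

/-- The ring homomorphism `(A_r)₀ → B` induced by a ring homomorphism `A → B` that maps `r` to
a unit. -/
noncomputable def awayLift {B : Type u} [CommRing B] (f : A →+* B) {r : A} (hr : IsUnit (f r)) :
    HomogeneousLocalization.Away 𝒜 r →+* B :=
  (IsLocalization.Away.lift (S := Localization.Away r) r hr).comp
    (algebraMap (HomogeneousLocalization.Away 𝒜 r) (Localization.Away r))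

/-- The denominator is cleared so that no inverse of `f r` has to be named; later comparisons
multiply by powers of the unit and cancel. -/
theorem awayLift_mk {B : Type u} [CommRing B] (f : A →+* B) {r : A} (hr : IsUnit (f r))
    {d : ℕ} (hrd : r ∈ 𝒜 d) (n : ℕ) (a : A) (ha : a ∈ 𝒜 (n • d)) :
    awayLift 𝒜 f hr (HomogeneousLocalization.Away.mk 𝒜 hrd n a ha) * f r ^ n = f a := by
  simp only [awayLift, RingHom.comp_apply, HomogeneousLocalization.algebraMap_apply,
    HomogeneousLocalization.Away.val_mk]
  rw [Localization.mk_eq_mk', IsLocalization.Away.lift]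
  have h := (IsLocalization.lift_mk'_spec (S := Localization.Away r) (M := .powers r) (g := f)
    (fun y ↦ by obtain ⟨_, m, rfl⟩ := y; simpa using hr.pow m) a
    _ ⟨r ^ n, n, rfl⟩).mp rfl
  rw [mul_comm]
  simpa using h.symm

theorem awayLift_fromZero {B : Type u} [CommRing B] (f : A →+* B) {r : A} (hr : IsUnit (f r))
    (x : 𝒜 0) :
    awayLift 𝒜 f hr (HomogeneousLocalization.fromZeroRingHom 𝒜 (.powers r) x) = f x := by
  rw [← HomogeneousLocalization.algebraMap_eq]
  simp only [awayLift, RingHom.comp_apply, HomogeneousLocalization.algebraMap_apply]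
  exact IsLocalization.Away.lift_eq _ hr _

theorem awayLift_algebraMap {r : A} (hr : IsUnit (algebraMap A (Localization.Away r) r)) :
    awayLift 𝒜 (algebraMap A (Localization.Away r)) hr = algebraMap _ _ := by
  have : IsLocalization.Away.lift (S := Localization.Away r) r hr = RingHom.id _ :=
    IsLocalization.ringHom_ext (.powers r) (by ext x; simp)
  rw [awayLift, this]
  rfl

/-- Identifies the bracketed morphism, a piece of `Proj.toBasicOpenOfGlobalSections`, by its
composite with the monomorphism into `Spec Γ(X, ⊤)`. -/
theorem basicOpen_isoSpecAway_fac (X : Scheme.{u}) (s : Γ(X, ⊤)) :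
    ((X.isoOfEq (X.toSpecΓ_preimage_basicOpen s)).inv ≫
      X.toSpecΓ ∣_ PrimeSpectrum.basicOpen s ≫ (basicOpenIsoSpecAway s).hom) ≫
        Spec.map (CommRingCat.ofHom (algebraMap Γ(X, ⊤) (Localization.Away s))) =
      (X.basicOpen s).ι ≫ X.toSpecΓ := by
  have h0 : ∀ D : (Spec Γ(X, ⊤)).Opens, IsOpenImmersion D.ι := fun D ↦ inferInstance
  have h1 : (basicOpenIsoSpecAway s).hom ≫
      Spec.map (CommRingCat.ofHom (algebraMap Γ(X, ⊤) (Localization.Away s))) =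
      Scheme.Opens.ι (X := Spec Γ(X, ⊤)) (PrimeSpectrum.basicOpen s) :=
    @IsOpenImmersion.isoOfRangeEq_hom_fac _ _ _ _ _ (h0 _) _ _
  have h2 := morphismRestrict_ι X.toSpecΓ (PrimeSpectrum.basicOpen s)
  have h3 := Scheme.isoOfEq_inv_ι X (X.toSpecΓ_preimage_basicOpen s)
  refine Eq.trans (Category.assoc _ _ _) ?_
  refine Eq.trans (congrArg _ (Category.assoc _ _ _)) ?_
  refine Eq.trans (congrArg _ (congrArg _ h1)) ?_
  refine Eq.trans (congrArg _ h2) ?_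
  rw [← Category.assoc, h3]

/-- If `r` becomes a unit on `Y`, then `g` lands in the basic open set of `f r`, where the morphism
to `Proj` is by construction a morphism to the affine chart of `r`. All comparisons of morphisms to
`Proj` reduce to this description. -/
theorem comp_fromOfGlobalSections {X Y : Scheme.{u}} (f : A →+* Γ(X, ⊤))
    (hf : (HomogeneousIdeal.irrelevant 𝒜).toIdeal.map f = ⊤) (g : Y ⟶ X) {r : A} {n : ℕ}
    (hn : 0 < n) (hr : r ∈ 𝒜 n) (hu : IsUnit ((g.appTop.hom.comp f) r)) :
    g ≫ Proj.fromOfGlobalSections 𝒜 f hf =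
      Y.toSpecΓ ≫ Spec.map (CommRingCat.ofHom (awayLift 𝒜 (g.appTop.hom.comp f) hu)) ≫
        Proj.awayι 𝒜 r hr hn := by
  have hg : Set.range g ⊆ Set.range (X.basicOpen (f r)).ι := by
    rintro _ ⟨y, rfl⟩
    have : y ∈ g ⁻¹ᵁ X.basicOpen (f r) := by
      rw [Scheme.preimage_basicOpen_top]
      exact (Scheme.basicOpen_of_isUnit _ hu).ge trivial
    rwa [Scheme.Opens.range_ι]
  obtain ⟨g', rfl⟩ : ∃ g' : Y ⟶ X.basicOpen (f r), g = g' ≫ (X.basicOpen (f r)).ι :=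
    ⟨IsOpenImmersion.lift _ g hg, (IsOpenImmersion.lift_fac _ _ _).symm⟩
  rw [Category.assoc, ← Scheme.Hom.resLE_comp_ι _
    (Proj.fromOfGlobalSections_preimage_basicOpen 𝒜 f hf hn hr).ge,
    Proj.fromOfGlobalSections_resLE 𝒜 f hf hn hr, Proj.toBasicOpenOfGlobalSections]
  simp only [Category.assoc]
  rw [Proj.basicOpenIsoSpec_inv_ι]
  simp only [← Category.assoc]
  congr 1
  -- Both sides are morphisms to the spectrum of the localization at `f r`, so it suffices to
  -- compare them in `Spec Γ(X, ⊤)`.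
  have key : g' ≫ (X.isoOfEq (X.toSpecΓ_preimage_basicOpen (f r))).inv ≫
      (X.toSpecΓ ∣_ PrimeSpectrum.basicOpen (f r)) ≫ (basicOpenIsoSpecAway (f r)).hom =
      Y.toSpecΓ ≫ Spec.map (CommRingCat.ofHom (IsLocalization.Away.lift
        (S := Localization.Away (f r)) (g := (g' ≫ (X.basicOpen (f r)).ι).appTop.hom)
        (f r) hu)) := by
    rw [← cancel_mono (Spec.map (CommRingCat.ofHom (algebraMap Γ(X, ⊤) (Localization.Away (f r))))),
      Category.assoc, basicOpen_isoSpecAway_fac, Category.assoc, ← Spec.map_comp,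
      ← Category.assoc, Scheme.toSpecΓ_naturality]
    congr 2
    ext a
    simp
  simp only [Category.assoc]
  have key' := fun Z (φ : _ ⟶ Z) ↦ congrArg (· ≫ φ) key
  simp only [Category.assoc] at key'
  rw [key', ← Spec.map_comp, ← CommRingCat.ofHom_comp]
  congr 3
  rw [awayLift, ← RingHom.comp_assoc]
  congr 1
  refine IsLocalization.ringHom_ext (Submonoid.powers r) (RingHom.ext fun a ↦ ?_)
  simp [IsLocalization.Away.lift_eq]

end AwayLift

/-! ### Local computations with global sections -/

theorem isUnit_of_basicOpen_eq_top {X : Scheme.{u}} {s : Γ(X, ⊤)} (h : X.basicOpen s = ⊤) :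
    IsUnit s :=
  RingedSpace.isUnit_of_isUnit_germ X.toRingedSpace ⊤ s fun x _ ↦
    (X.mem_basicOpen_top s x).mp (h.ge trivial)

theorem isUnit_appTop_of_range_subset {X Y : Scheme.{u}} {g : Y ⟶ X} {s : Γ(X, ⊤)}
    (h : Set.range g ⊆ X.basicOpen s) : IsUnit (g.appTop s) := by
  refine isUnit_of_basicOpen_eq_top ?_
  rw [← Scheme.preimage_basicOpen_top, eq_top_iff]
  exact fun y _ ↦ h ⟨y, rfl⟩

theorem section_ext_of_forall {X : Scheme.{u}} {s t : Γ(X, ⊤)}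
    (h : ∀ x : X, ∃ O : X.Opens, x ∈ O ∧ O.ι.appTop s = O.ι.appTop t) : s = t := by
  refine TopCat.Presheaf.IsSheaf.section_ext X.IsSheaf fun x _ ↦ ?_
  obtain ⟨O, hx, e⟩ := h x
  refine ⟨O, le_top, hx, ?_⟩
  have h : X.presheaf.map (homOfLE le_top).op = O.ι.appTop ≫ O.topIso.hom := by
    rw [Scheme.Opens.ι_appTop, Scheme.Opens.topIso_hom]
    exact X.presheaf.map_comp (homOfLE _).op (eqToHom _).op
  rw [h]
  exact congrArg O.topIso.hom e

theorem exists_mem_basicOpen_of_span_eq_top {X : Scheme.{u}} {ι : Type} {v : ι → Γ(X, ⊤)}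
    (hv : Ideal.span (Set.range v) = ⊤) (x : X) : ∃ i, x ∈ X.basicOpen (v i) := by
  have := (iSup_basicOpen_of_span_eq_top ⊤ _ hv).ge (TopologicalSpace.Opens.mem_top x)
  simpa using this

/-- Taking global sections recovers the ring homomorphism. -/
theorem toSpecΓ_comp_injective {X : Scheme.{u}} {R : CommRingCat.{u}} {φ ψ : R ⟶ Γ(X, ⊤)}
    (h : X.toSpecΓ ≫ Spec.map φ = X.toSpecΓ ≫ Spec.map ψ) : φ = ψ := by
  have := congrArg (fun f ↦ (Scheme.ΓSpecIso R).inv ≫ f.appTop) h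
  simpa [Scheme.toSpecΓ_appTop] using this

/-! ### Comparison of morphisms to `Proj` on charts -/

section AwayLift

variable {A σ : Type u} [CommRing A] [SetLike σ A] [AddSubgroupClass σ A] (𝒜 : ℕ → σ)
  [GradedRing 𝒜]

theorem ringHom_away_ext {B : Type u} [CommRing B] {r : A} {d : ℕ} (hrd : r ∈ 𝒜 d)
    {φ ψ : HomogeneousLocalization.Away 𝒜 r →+* B}
    (h : ∀ n a (ha : a ∈ 𝒜 (n • d)), φ (HomogeneousLocalization.Away.mk 𝒜 hrd n a ha) =
      ψ (HomogeneousLocalization.Away.mk 𝒜 hrd n a ha)) : φ = ψ := by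
  ext x
  obtain ⟨n, a, ha, rfl⟩ := HomogeneousLocalization.Away.mk_surjective 𝒜 hrd x
  exact h n a ha

/-- The hypothesis is the equality of the fractions `f a / f r ^ n` and `f' a / f' r ^ n`,
cross-multiplied. It holds in particular when `f'` is `f` twisted by the powers of a unit according
to degree. -/
theorem awayLift_congr {B : Type u} [CommRing B] {f f' : A →+* B} {r : A} {d : ℕ} (hrd : r ∈ 𝒜 d)
    (hr : IsUnit (f r)) (hr' : IsUnit (f' r))
    (h : ∀ n, ∀ a ∈ 𝒜 (n • d), f a * f' r ^ n = f' a * f r ^ n) :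
    awayLift 𝒜 f hr = awayLift 𝒜 f' hr' := by
  refine ringHom_away_ext 𝒜 hrd fun n a ha ↦ ?_
  refine ((hr.pow n).mul (hr'.pow n)).mul_left_injective ?_
  have h1 := awayLift_mk 𝒜 f hr hrd n a ha
  have h2 := awayLift_mk 𝒜 f' hr' hrd n a ha
  change _ * (f r ^ n * f' r ^ n) = _ * (f r ^ n * f' r ^ n)
  rw [← mul_assoc, h1, mul_left_comm, h2, h n a ha, mul_comm]

theorem exists_mem_basicOpen_of_irrelevant {X : Scheme.{u}} (f : A →+* Γ(X, ⊤))
    (hf : (HomogeneousIdeal.irrelevant 𝒜).toIdeal.map f = ⊤) (x : X) :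
    ∃ n r, 0 < n ∧ r ∈ 𝒜 n ∧ x ∈ X.basicOpen (f r) := by
  obtain ⟨⟨n, r, hn, hr⟩, y, rfl⟩ := (Proj.openCoverOfMapIrrelevantEqTop 𝒜 f hf).exists_eq x
  exact ⟨n, r, hn, hr, y.2⟩

theorem map_irrelevant_comp {B C : Type u} [CommRing B] [CommRing C] (f : A →+* B) (g : B →+* C)
    (hf : (HomogeneousIdeal.irrelevant 𝒜).toIdeal.map f = ⊤) :
    (HomogeneousIdeal.irrelevant 𝒜).toIdeal.map (g.comp f) = ⊤ := by
  rw [← Ideal.map_map, hf, Ideal.map_top]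

theorem comp_fromOfGlobalSections_eq {X Y : Scheme.{u}} (f : A →+* Γ(X, ⊤))
    (hf : (HomogeneousIdeal.irrelevant 𝒜).toIdeal.map f = ⊤) (g : Y ⟶ X) :
    g ≫ Proj.fromOfGlobalSections 𝒜 f hf =
      Proj.fromOfGlobalSections 𝒜 (g.appTop.hom.comp f) (map_irrelevant_comp 𝒜 f _ hf) := by
  refine Scheme.hom_ext_of_forall _ _ fun y ↦ ?_
  obtain ⟨n, r, hn, hr, hy⟩ := exists_mem_basicOpen_of_irrelevant 𝒜 (g.appTop.hom.comp f)
    (map_irrelevant_comp 𝒜 f _ hf) y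
  refine ⟨_, hy, ?_⟩
  set O := Y.basicOpen (g.appTop.hom.comp f r)
  have hu : IsUnit ((O.ι.appTop.hom.comp (g.appTop.hom.comp f)) r) :=
    isUnit_appTop_of_range_subset (by rw [Scheme.Opens.range_ι])
  have e : (O.ι ≫ g).appTop.hom.comp f = O.ι.appTop.hom.comp (g.appTop.hom.comp f) := by
    rw [Scheme.Hom.comp_appTop]; rfl
  rw [comp_fromOfGlobalSections 𝒜 _ _ O.ι hn hr hu, ← Category.assoc,
    comp_fromOfGlobalSections 𝒜 f hf (O.ι ≫ g) hn hr (by rw [e]; exact hu)]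
  simp only [e]

theorem fromOfGlobalSections_eq_away {X : Scheme.{u}} (f : A →+* Γ(X, ⊤))
    (hf : (HomogeneousIdeal.irrelevant 𝒜).toIdeal.map f = ⊤) {r : A} {n : ℕ}
    (hn : 0 < n) (hr : r ∈ 𝒜 n) (hu : IsUnit (f r)) :
    Proj.fromOfGlobalSections 𝒜 f hf =
      X.toSpecΓ ≫ Spec.map (CommRingCat.ofHom (awayLift 𝒜 f hu)) ≫ Proj.awayι 𝒜 r hr hn := by
  have e : (Scheme.Hom.appTop (𝟙 X)).hom.comp f = f := by
    rw [Scheme.Hom.id_appTop]; rfl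
  have := comp_fromOfGlobalSections 𝒜 f hf (𝟙 X) hn hr (by rw [e]; exact hu)
  simp only [e, Category.id_comp] at this
  exact this

end AwayLift

/-! ### The calculus of homogeneous coordinates -/

section HomogeneousCoordinates

variable {ι : Type} {k : Type u} [Field k] {T T' : Over (Spec (.of k))}

/-- The pullback of functions along a morphism of `k`-schemes. -/
noncomputable def pull (f : T' ⟶ T) : Γ(T.left, ⊤) →+* Γ(T'.left, ⊤) := f.left.appTop.hom

theorem pull_comp_scalars (f : T' ⟶ T) : (pull f).comp (scalars T) = scalars T' := by
  have h : T'.hom.appTop = T.hom.appTop ≫ f.left.appTop := by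
    rw [← Scheme.Hom.comp_appTop, Over.w f]
  rw [scalars, scalars, h]
  rfl

theorem pull_scalars (f : T' ⟶ T) (c : k) : pull f (scalars T c) = scalars T' c :=
  congrArg (fun φ ↦ φ c) (pull_comp_scalars f)

theorem span_pull_eq_top (f : T' ⟶ T) {w : ι → Γ(T.left, ⊤)}
    (hw : Ideal.span (Set.range w) = ⊤) : Ideal.span (Set.range fun i ↦ pull f (w i)) = ⊤ := by
  have := congrArg (Ideal.map (pull f)) hw
  rwa [Ideal.map_span, Ideal.map_top, ← Set.range_comp] at this

theorem span_mul_eq_top {B : Type u} [CommRing B] {w : ι → B} {c : B} (hc : IsUnit c)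
    (hw : Ideal.span (Set.range w) = ⊤) : Ideal.span (Set.range fun i ↦ c * w i) = ⊤ := by
  rw [eq_top_iff, ← hw, Ideal.span_le]
  rintro _ ⟨i, rfl⟩
  have h : c * w i ∈ Ideal.span (Set.range fun i ↦ c * w i) := Ideal.subset_span ⟨i, rfl⟩
  simpa [← mul_assoc] using Ideal.mul_mem_left _ (↑hc.unit⁻¹ : B) h

theorem pull_comp_eval₂Hom (f : T' ⟶ T) (w : ι → Γ(T.left, ⊤)) :
    (pull f).comp (MvPolynomial.eval₂Hom (scalars T) w) =
      MvPolynomial.eval₂Hom (scalars T') fun i ↦ pull f (w i) := by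
  refine MvPolynomial.ringHom_ext (fun c ↦ ?_) fun i ↦ ?_ <;> simp [pull_scalars]

theorem fromOfGlobalSections_congr {A σ : Type u} [CommRing A] [SetLike σ A]
    [AddSubgroupClass σ A] (𝒜 : ℕ → σ) [GradedRing 𝒜] {X : Scheme.{u}} {f f' : A →+* Γ(X, ⊤)}
    (h : f = f') (hf : (HomogeneousIdeal.irrelevant 𝒜).toIdeal.map f = ⊤)
    (hf' : (HomogeneousIdeal.irrelevant 𝒜).toIdeal.map f' = ⊤) :
    Proj.fromOfGlobalSections 𝒜 f hf = Proj.fromOfGlobalSections 𝒜 f' hf' := by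
  subst h; rfl

theorem comp_homogPoint (f : T' ⟶ T) (w : ι → Γ(T.left, ⊤)) (hw : Ideal.span (Set.range w) = ⊤) :
    f.left ≫ homogPoint T w hw = homogPoint T' (fun i ↦ pull f (w i)) (span_pull_eq_top f hw) := by
  rw [homogPoint, comp_fromOfGlobalSections_eq, homogPoint]
  exact fromOfGlobalSections_congr _ (pull_comp_eval₂Hom f w) _ _

theorem eval₂Hom_mul_of_homogeneous {B : Type u} [CommRing B] (a : k →+* B) (w : ι → B) (c : B)
    {n : ℕ} {p : MvPolynomial ι k} (hp : p ∈ MvPolynomial.homogeneousSubmodule ι k n) :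
    MvPolynomial.eval₂Hom a (fun i ↦ c * w i) p = c ^ n * MvPolynomial.eval₂Hom a w p := by
  simp only [MvPolynomial.coe_eval₂Hom, MvPolynomial.eval₂_eq, Finset.mul_sum]
  refine Finset.sum_congr rfl fun d hd ↦ ?_
  have hdeg : ∑ i ∈ d.support, d i = n := by
    have := hp (MvPolynomial.mem_support_iff.mp hd)
    simpa [Finsupp.weight_apply, Finsupp.sum] using this
  simp only [mul_pow, Finset.prod_mul_distrib, Finset.prod_pow_eq_pow_sum, hdeg]
  ring

theorem X_mem (p : ι) :
    (MvPolynomial.X p : MvPolynomial ι k) ∈ MvPolynomial.homogeneousSubmodule ι k 1 :=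
  MvPolynomial.isHomogeneous_X k p

/-- In the chart where the coordinate `w p` is invertible, the morphism `[w]` is given by the
quotients of the coordinates. -/
theorem homogPoint_eq_away (w : ι → Γ(T.left, ⊤)) (hw : Ideal.span (Set.range w) = ⊤) (p : ι)
    (hu : IsUnit (MvPolynomial.eval₂Hom (scalars T) w (.X p))) :
    homogPoint T w hw = T.left.toSpecΓ ≫ Spec.map (CommRingCat.ofHom
      (awayLift (MvPolynomial.homogeneousSubmodule ι k)
        (MvPolynomial.eval₂Hom (scalars T) w) (r := MvPolynomial.X p) hu)) ≫
      Proj.awayι (MvPolynomial.homogeneousSubmodule ι k) (MvPolynomial.X p) (m := 1)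
        (X_mem p) one_pos :=
  fromOfGlobalSections_eq_away _ _ (irrelevant_map_eq_top _ w hw) one_pos (X_mem p) hu

/-- The open subscheme of a `k`-scheme. -/
noncomputable def openSub (T : Over (Spec (.of k))) (O : T.left.Opens) : Over (Spec (.of k)) :=
  Over.mk (O.ι ≫ T.hom)

/-- The inclusion of an open subscheme. -/
noncomputable def openSubι (T : Over (Spec (.of k))) (O : T.left.Opens) : openSub T O ⟶ T :=
  Over.homMk O.ι

theorem isUnit_pull_of_le (O : T.left.Opens) {s : Γ(T.left, ⊤)} (h : O ≤ T.left.basicOpen s) :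
    IsUnit (pull (openSubι T O) s) :=
  isUnit_appTop_of_range_subset (g := O.ι) (by rw [Scheme.Opens.range_ι]; exact h)

theorem homogPoint_mul (w : ι → Γ(T.left, ⊤)) (hw : Ideal.span (Set.range w) = ⊤)
    {c : Γ(T.left, ⊤)} (hc : IsUnit c) :
    homogPoint T (fun i ↦ c * w i) (span_mul_eq_top hc hw) = homogPoint T w hw := by
  refine Scheme.hom_ext_of_forall _ _ fun x ↦ ?_
  obtain ⟨p, hp⟩ := exists_mem_basicOpen_of_span_eq_top hw x
  refine ⟨_, hp, ?_⟩
  set O := T.left.basicOpen (w p)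
  have hu := isUnit_pull_of_le (T := T) O (s := w p) le_rfl
  have hc' : IsUnit (pull (openSubι T O) c) := hc.map _
  have e1 := comp_homogPoint (openSubι T O) _ (span_mul_eq_top hc hw)
  have e2 := comp_homogPoint (openSubι T O) _ hw
  refine e1.trans (Eq.trans ?_ e2.symm)
  rw [homogPoint_eq_away _ _ p (by simpa using hc'.mul hu),
    homogPoint_eq_away _ _ p (by simpa using hu)]
  congr 4
  refine awayLift_congr _ (X_mem p) _ _ fun n a ha ↦ ?_
  simp only [map_mul]
  rw [eval₂Hom_mul_of_homogeneous _ _ _ ha]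
  simp only [MvPolynomial.coe_eval₂Hom, MvPolynomial.eval₂_X]
  simp only [smul_eq_mul, mul_one, mul_pow]
  ring

theorem homogPoint_preimage_basicOpen (w : ι → Γ(T.left, ⊤)) (hw : Ideal.span (Set.range w) = ⊤)
    {n : ℕ} (hn : 0 < n) {p : MvPolynomial ι k}
    (hp : p ∈ MvPolynomial.homogeneousSubmodule ι k n) :
    homogPoint T w hw ⁻¹ᵁ Proj.basicOpen (MvPolynomial.homogeneousSubmodule ι k) p =
      T.left.basicOpen (MvPolynomial.eval₂Hom (scalars T) w p) :=
  Proj.fromOfGlobalSections_preimage_basicOpen _ _ _ hn hp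

/-- Where the coordinate of index `p` is invertible, the morphism to the affine chart remembers the
ratios `w i / w p`. This gives the relation for the pairs `(i, p)` and `(j, p)`, and dividing by the
units gives it for `(i, j)`. -/
theorem mul_eq_mul_of_homogPoint_eq {w w' : ι → Γ(T.left, ⊤)}
    {hw : Ideal.span (Set.range w) = ⊤} {hw' : Ideal.span (Set.range w') = ⊤}
    (h : homogPoint T w hw = homogPoint T w' hw') (i j : ι) : w i * w' j = w' i * w j := by
  have key : ∀ i p, ∀ {T : Over (Spec (.of k))} {w w' : ι → Γ(T.left, ⊤)}
    {hw : Ideal.span (Set.range w) = ⊤} {hw' : Ideal.span (Set.range w') = ⊤}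
    (_ : homogPoint T w hw = homogPoint T w' hw') (_ : IsUnit (w p)) (_ : IsUnit (w' p)),
      w i * w' p = w' i * w p := by
    intro i p T w w' hw hw' h hu hu'
    rw [homogPoint_eq_away _ _ p (by simpa using hu),
      homogPoint_eq_away _ _ p (by simpa using hu')] at h
    simp only [← Category.assoc] at h
    rw [cancel_mono] at h
    have h' := congrArg CommRingCat.Hom.hom (toSpecΓ_comp_injective h)
    simp only [CommRingCat.hom_ofHom] at h'
    have e1 := awayLift_mk (MvPolynomial.homogeneousSubmodule ι k)
      (MvPolynomial.eval₂Hom (scalars T) w) (r := .X p) (by simpa using hu) (X_mem p) 1 (.X i)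
      (by simpa using X_mem i)
    have e2 := awayLift_mk (MvPolynomial.homogeneousSubmodule ι k)
      (MvPolynomial.eval₂Hom (scalars T) w') (r := .X p) (by simpa using hu') (X_mem p) 1 (.X i)
      (by simpa using X_mem i)
    rw [h'] at e1
    simp only [MvPolynomial.coe_eval₂Hom, MvPolynomial.eval₂_X, pow_one] at e1 e2
    rw [← e1, ← e2]
    ring
  refine section_ext_of_forall fun x ↦ ?_
  obtain ⟨p, hp⟩ := exists_mem_basicOpen_of_span_eq_top hw x
  refine ⟨_, hp, ?_⟩
  set O := T.left.basicOpen (w p) with hO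
  -- Both open sets are the preimage of the same chart under the common morphism, so both
  -- coordinates of index `p` are invertible on `O`.
  have hO' : O = T.left.basicOpen (w' p) := by
    have h1 := homogPoint_preimage_basicOpen w hw one_pos (X_mem p)
    have h2 := homogPoint_preimage_basicOpen w' hw' one_pos (X_mem p)
    rw [h, h2] at h1
    simpa using h1.symm
  have hu := isUnit_pull_of_le (T := T) O (s := w p) le_rfl
  have hu' := isUnit_pull_of_le (T := T) O (s := w' p) hO'.le
  have e : homogPoint (openSub T O) _ (span_pull_eq_top (openSubι T O) hw) =
      homogPoint (openSub T O) _ (span_pull_eq_top (openSubι T O) hw') := by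
    rw [← comp_homogPoint _ w hw, ← comp_homogPoint _ w' hw', h]
  have h1 := key i p e hu hu'
  have h2 := key j p e hu hu'
  change pull (openSubι T O) _ = pull (openSubι T O) _
  simp only [map_mul]
  refine (hu.mul hu').mul_left_injective ?_
  linear_combination (pull (openSubι T O) (w' j)) * (pull (openSubι T O) (w p)) * h1 -
    (pull (openSubι T O) (w' i)) * (pull (openSubι T O) (w p)) * h2

/-- If `1 = ∑ a_i w_i`, then `c = ∑ a_i w'_i` is the factor, by the cross-multiplied relations; no
gluing is needed. It is a unit because it divides all members of the family `w'`, which generates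
the unit ideal. -/
theorem exists_isUnit_of_homogPoint_eq {w w' : ι → Γ(T.left, ⊤)}
    {hw : Ideal.span (Set.range w) = ⊤} {hw' : Ideal.span (Set.range w') = ⊤}
    (h : homogPoint T w hw = homogPoint T w' hw') :
    ∃ c, IsUnit c ∧ ∀ i, w' i = c * w i := by
  have key : ∀ {w w' : ι → Γ(T.left, ⊤)} (hw : Ideal.span (Set.range w) = ⊤)
      (_ : ∀ i j, w i * w' j = w' i * w j), ∃ c, ∀ i, w' i = c * w i := by
    intro w w' hw h
    have h1 : (1 : Γ(T.left, ⊤)) ∈ Ideal.span (Set.range w) := by rw [hw]; trivial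
    obtain ⟨a, ha⟩ := Finsupp.mem_span_range_iff_exists_finsupp.mp h1
    refine ⟨a.sum fun i b ↦ b * w' i, fun j ↦ ?_⟩
    rw [Finsupp.sum, Finset.sum_mul]
    rw [← one_mul (w' j), ← ha, Finsupp.sum, Finset.sum_mul]
    refine Finset.sum_congr rfl fun i _ ↦ ?_
    rw [smul_eq_mul, mul_assoc, h i j, mul_assoc]
  obtain ⟨c, hc⟩ := key hw (mul_eq_mul_of_homogPoint_eq h)
  refine ⟨c, ?_, hc⟩
  have h2 : (1 : Γ(T.left, ⊤)) ∈ Ideal.span {c} := by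
    have : Ideal.span (Set.range w') ≤ Ideal.span {c} := by
      rw [Ideal.span_le]
      rintro _ ⟨i, rfl⟩
      exact Ideal.mem_span_singleton.mpr ⟨w i, hc i⟩
    exact this (by rw [hw']; trivial)
  exact isUnit_of_dvd_one (Ideal.mem_span_singleton.mp h2)

end HomogeneousCoordinates

/-! ### Points of projective space and of its closed subschemes -/

section Points

variable {ι : Type} {k : Type u} [Field k] {T T' : Over (Spec (.of k))}

/-- The structure morphism of projective space. -/
noncomputable def pspaceToSpec (ι : Type) (k : Type u) [Field k] : PSpace ι k ⟶ Spec (.of k) :=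
  Proj.toSpecZero (MvPolynomial.homogeneousSubmodule ι k) ≫
    Spec.map (CommRingCat.ofHom (algebraMap k (MvPolynomial.homogeneousSubmodule ι k 0)))

theorem eq_toSpecΓ_comp {X : Scheme.{u}} {R : CommRingCat.{u}} (f : X ⟶ Spec R) :
    f = X.toSpecΓ ≫ Spec.map ((Scheme.ΓSpecIso R).inv ≫ f.appTop) := by
  rw [Spec.map_comp, ← Category.assoc, ← Scheme.toSpecΓ_naturality, Category.assoc]
  simp

theorem toSpecΓ_scalars : T.left.toSpecΓ ≫ Spec.map (CommRingCat.ofHom (scalars T)) = T.hom :=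
  (eq_toSpecΓ_comp T.hom).symm

theorem homogPoint_over (w : ι → Γ(T.left, ⊤)) (hw : Ideal.span (Set.range w) = ⊤) :
    homogPoint T w hw ≫ pspaceToSpec ι k = T.hom := by
  refine (Category.assoc _ _ _).symm.trans ?_
  have h := Proj.fromOfGlobalSections_toSpecZero (MvPolynomial.homogeneousSubmodule ι k)
    (MvPolynomial.eval₂Hom (scalars T) w) (irrelevant_map_eq_top _ w hw)
  refine (congrArg (· ≫ _) h).trans ?_
  rw [Category.assoc, ← Spec.map_comp, ← CommRingCat.ofHom_comp]
  refine Eq.trans ?_ toSpecΓ_scalars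
  congr 3
  ext c
  exact MvPolynomial.eval₂_C _ _ _

/-- Dehomogenization: dividing by a power of `X p` amounts to evaluating at the fractions `X q / X
p`. It is checked in the full localization, after multiplying by the power of `X p`, by homogeneity.
-/
theorem eval₂Hom_away {p : ι} (n : ℕ) (a : MvPolynomial ι k)
    (ha : a ∈ MvPolynomial.homogeneousSubmodule ι k (n • 1)) :
    MvPolynomial.eval₂Hom ((HomogeneousLocalization.fromZeroRingHom
        (MvPolynomial.homogeneousSubmodule ι k) (.powers (MvPolynomial.X p))).comp
          (algebraMap k (MvPolynomial.homogeneousSubmodule ι k 0)))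
      (fun q ↦ HomogeneousLocalization.Away.mk _ (X_mem p) 1 (MvPolynomial.X q)
        (by simpa using X_mem q)) a =
      HomogeneousLocalization.Away.mk _ (X_mem p) n a ha := by
  have hu : IsUnit (algebraMap (MvPolynomial ι k)
      (Localization.Away (MvPolynomial.X p : MvPolynomial ι k)) (MvPolynomial.X p)) :=
    IsLocalization.Away.algebraMap_isUnit _
  set f := algebraMap (MvPolynomial ι k) (Localization.Away (MvPolynomial.X p : MvPolynomial ι k))
  have hinj : Function.Injective (awayLift (MvPolynomial.homogeneousSubmodule ι k) f hu) := by
    rw [awayLift_algebraMap]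
    exact HomogeneousLocalization.val_injective _
  refine hinj ((hu.pow n).mul_left_injective ?_)
  change _ * _ = _ * _
  rw [awayLift_mk, MvPolynomial.coe_eval₂Hom, MvPolynomial.hom_eval₂, mul_comm,
    ← MvPolynomial.coe_eval₂Hom]
  have h := eval₂Hom_mul_of_homogeneous
    ((awayLift (MvPolynomial.homogeneousSubmodule ι k) f hu).comp
    ((HomogeneousLocalization.fromZeroRingHom
        (MvPolynomial.homogeneousSubmodule ι k) (.powers (MvPolynomial.X p))).comp
          (algebraMap k (MvPolynomial.homogeneousSubmodule ι k 0))))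
    (fun q ↦ awayLift (MvPolynomial.homogeneousSubmodule ι k) f hu
      (HomogeneousLocalization.Away.mk _ (X_mem p) 1 (MvPolynomial.X q)
        (by simpa using X_mem q))) (f (.X p)) (n := n) (by simpa using ha)
  refine h.symm.trans ?_
  congr 1
  refine MvPolynomial.ringHom_ext (fun c ↦ ?_) fun i ↦ ?_
  · simp only [MvPolynomial.coe_eval₂Hom, MvPolynomial.eval₂_C, RingHom.comp_apply]
    exact awayLift_fromZero _ f hu _
  · simp only [MvPolynomial.coe_eval₂Hom, MvPolynomial.eval₂_X]
    rw [mul_comm]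
    simpa using awayLift_mk (MvPolynomial.homogeneousSubmodule ι k) f hu (X_mem p) 1
      (MvPolynomial.X i) (by simpa using X_mem i)

theorem opensRange_chart (p : ι) : (Proj.awayι (MvPolynomial.homogeneousSubmodule ι k)
    (MvPolynomial.X p) (m := 1) (X_mem p) one_pos).opensRange =
      Proj.basicOpen (MvPolynomial.homogeneousSubmodule ι k) (MvPolynomial.X p) :=
  Proj.opensRange_awayι (MvPolynomial.homogeneousSubmodule ι k) (MvPolynomial.X p) (m := 1)
    (X_mem p) one_pos

/-- A point of the chart `{w p ≠ 0}` of projective space has homogeneous coordinates. -/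
theorem exists_eq_homogPoint (x : T.left ⟶ PSpace ι k) (hover : x ≫ pspaceToSpec ι k = T.hom)
    (p : ι) (hx : Set.range x ⊆ (Proj.basicOpen (MvPolynomial.homogeneousSubmodule ι k)
      (MvPolynomial.X p) : (PSpace ι k).Opens)) :
    ∃ (w : ι → Γ(T.left, ⊤)) (hw : Ideal.span (Set.range w) = ⊤), w p = 1 ∧
      x = homogPoint T w hw := by
  rw [← opensRange_chart] at hx
  obtain ⟨y, hy⟩ : ∃ y, x = y ≫ Proj.awayι (MvPolynomial.homogeneousSubmodule ι k)
      (MvPolynomial.X p) (m := 1) (X_mem p) one_pos :=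
    ⟨IsOpenImmersion.lift _ _ hx, (IsOpenImmersion.lift_fac _ _ _).symm⟩
  obtain ⟨θ, rfl⟩ : ∃ θ : HomogeneousLocalization.Away (MvPolynomial.homogeneousSubmodule ι k)
      (MvPolynomial.X p) →+* Γ(T.left, ⊤), y = T.left.toSpecΓ ≫ Spec.map (CommRingCat.ofHom θ) :=
    ⟨_, eq_toSpecΓ_comp y⟩
  -- That `x` is a morphism over `k` means that `θ` is the given structure map on constants.
  have hθ : θ.comp ((HomogeneousLocalization.fromZeroRingHom
        (MvPolynomial.homogeneousSubmodule ι k) (.powers (MvPolynomial.X p))).comp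
          (algebraMap k (MvPolynomial.homogeneousSubmodule ι k 0))) = scalars T := by
    have h := hover
    rw [hy, ← toSpecΓ_scalars (T := T)] at h
    have h2 := Proj.awayι_toSpecZero_assoc (MvPolynomial.homogeneousSubmodule ι k)
      (MvPolynomial.X p) (m := 1) (X_mem p) one_pos
      (Spec.map (CommRingCat.ofHom (algebraMap k (MvPolynomial.homogeneousSubmodule ι k 0))))
    rw [Category.assoc, Category.assoc] at h
    have h3 :=
      (congrArg (fun g ↦ T.left.toSpecΓ ≫ Spec.map (CommRingCat.ofHom θ) ≫ g) h2).symm.trans h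
    simp only [← Spec.map_comp, ← CommRingCat.ofHom_comp] at h3
    have h4 := congrArg CommRingCat.Hom.hom (toSpecΓ_comp_injective h3)
    exact h4
  -- The coordinates are the values of the fractions `X q / X p`, so the one of index `p` is 1.
  set w : ι → Γ(T.left, ⊤) := fun q ↦ θ (HomogeneousLocalization.Away.mk _ (X_mem p) 1
    (MvPolynomial.X q) (by simpa using X_mem q)) with hwdef
  have hwp : w p = 1 := by
    have : HomogeneousLocalization.Away.mk (MvPolynomial.homogeneousSubmodule ι k) (X_mem p) 1
        (MvPolynomial.X p) (by simpa using X_mem p) = 1 := by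
      refine HomogeneousLocalization.val_injective _ ?_
      rw [HomogeneousLocalization.Away.val_mk, HomogeneousLocalization.val_one]
      simp only [pow_one]
      exact Localization.mk_self (⟨MvPolynomial.X p, 1, pow_one _⟩ : Submonoid.powers
        (MvPolynomial.X p : MvPolynomial ι k))
    rw [hwdef]
    simp only [this, map_one]
  have hw : Ideal.span (Set.range w) = ⊤ :=
    Ideal.eq_top_of_unit_mem _ 1 1 (hwp ▸ Ideal.subset_span ⟨p, rfl⟩) (one_mul 1)
  refine ⟨w, hw, hwp, ?_⟩
  have hu : IsUnit (MvPolynomial.eval₂Hom (scalars T) w (.X p)) := by simp [hwp]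
  rw [homogPoint_eq_away w hw p hu, hy, Category.assoc]
  congr 4
  refine ringHom_away_ext _ (X_mem p) fun n a ha ↦ ?_
  have h := awayLift_mk (MvPolynomial.homogeneousSubmodule ι k)
    (MvPolynomial.eval₂Hom (scalars T) w) (r := MvPolynomial.X p) hu (X_mem p) n a ha
  rw [MvPolynomial.eval₂Hom_X', hwp, one_pow, mul_one] at h
  refine Eq.trans ?_ h.symm
  rw [← eval₂Hom_away, MvPolynomial.coe_eval₂Hom, MvPolynomial.hom_eval₂, hθ]
  rfl

/-! ### Points of the closed subscheme `Proj (k[x] / I)` -/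

section Subscheme

variable (I : HomogeneousIdeal (MvPolynomial.homogeneousSubmodule ι k))

theorem quotX_mem (p : ι) : quotGradedHom I (MvPolynomial.X p) ∈ quotGrading I 1 :=
  (quotGradedHom I).map_mem (X_mem p)

/-- The inclusion of the chart `{w p ≠ 0}` of `Proj (k[x] / I)`. -/
noncomputable def chartι (p : ι) : Spec (.of (HomogeneousLocalization.Away (quotGrading I)
    (quotGradedHom I (MvPolynomial.X p)))) ⟶ (projSubscheme I).left :=
  Proj.awayι (quotGrading I) (quotGradedHom I (MvPolynomial.X p)) (m := 1) (quotX_mem I p) one_pos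

instance isOpenImmersion_chartι (p : ι) : IsOpenImmersion (chartι I p) :=
  inferInstanceAs (IsOpenImmersion (Proj.awayι (quotGrading I)
    (quotGradedHom I (MvPolynomial.X p)) (m := 1) (quotX_mem I p) one_pos))

theorem opensRange_chartι (p : ι) :
    (chartι I p).opensRange = projSubschemeBasicOpen I (MvPolynomial.X p) :=
  Proj.opensRange_awayι (quotGrading I) (quotGradedHom I (MvPolynomial.X p)) (m := 1)
    (quotX_mem I p) one_pos

/-- The embedding of the chart `{w p ≠ 0}` of `Proj (k[x] / I)`. -/
theorem awayι_projSubschemeEmb (p : ι) :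
    chartι I p ≫ projSubschemeEmb I = Spec.map (CommRingCat.ofHom
        (HomogeneousLocalization.Away.map (quotGradedHom I) (MvPolynomial.X p))) ≫
      Proj.awayι (MvPolynomial.homogeneousSubmodule ι k) (MvPolynomial.X p) (m := 1)
        (X_mem p) one_pos :=
  Proj.awayι_comp_map (quotGradedHom I) (irrelevant_le_map_quotGradedHom I) one_pos
    (MvPolynomial.X p) (X_mem p)

/-- On each chart the embedding is therefore a closed immersion, which is how it is seen to be a
monomorphism. -/
theorem away_map_surjective (p : ι) : Function.Surjective
    (HomogeneousLocalization.Away.map (quotGradedHom I) (MvPolynomial.X p)) := by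
  intro x
  obtain ⟨n, a, ha, rfl⟩ := HomogeneousLocalization.Away.mk_surjective (quotGrading I)
    (quotX_mem I p) x
  obtain ⟨b, hb, rfl⟩ := ha
  exact ⟨HomogeneousLocalization.Away.mk _ (X_mem p) n b hb,
    HomogeneousLocalization.Away.map_mk _ _ _ _ _ _⟩

/-- Every monomial of positive degree is divisible by a variable. -/
theorem pspace_iSup_basicOpen : ⨆ p : ι, Proj.basicOpen (MvPolynomial.homogeneousSubmodule ι k)
    (MvPolynomial.X p) = ⊤ := by
  refine Proj.iSup_basicOpen_eq_top _ _ ?_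
  rw [HomogeneousIdeal.toIdeal_irrelevant_le]
  intro n hn a ha
  rw [← MvPolynomial.support_sum_monomial_coeff a]
  refine Ideal.sum_mem _ fun d hd ↦ ?_
  have hdeg := ha (MvPolynomial.mem_support_iff.mp hd)
  obtain ⟨i, hi⟩ : ∃ i, d i ≠ 0 := by
    by_contra! h
    have : d = 0 := Finsupp.ext h
    subst this
    simp at hdeg
    omega
  have : (MvPolynomial.X i : MvPolynomial ι k) ∣ MvPolynomial.monomial d (a.coeff d) := by
    rw [MvPolynomial.X_dvd_monomial]
    exact Or.inr hi
  exact Ideal.mem_of_dvd _ this (Ideal.subset_span ⟨i, rfl⟩)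

theorem exists_mem_pspace_basicOpen (x : PSpace ι k) :
    ∃ p : ι, x ∈ Proj.basicOpen (MvPolynomial.homogeneousSubmodule ι k) (MvPolynomial.X p) := by
  have := (pspace_iSup_basicOpen (ι := ι) (k := k)).ge (TopologicalSpace.Opens.mem_top x)
  simpa using this

theorem exists_lift_chart {Y : Scheme.{u}} (x : Y ⟶ (projSubscheme I).left) (p : ι)
    (h : Set.range (x ≫ projSubschemeEmb I) ⊆
      (Proj.basicOpen (MvPolynomial.homogeneousSubmodule ι k)
      (MvPolynomial.X p) : (PSpace ι k).Opens)) :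
    ∃ y, x = y ≫ chartι I p := by
  have hx : Set.range x ⊆ Set.range (chartι I p) := by
    rintro _ ⟨y, rfl⟩
    have : x y ∈ projSubschemeEmb I ⁻¹ᵁ Proj.basicOpen (MvPolynomial.homogeneousSubmodule ι k)
      (MvPolynomial.X p) := h ⟨y, rfl⟩
    exact (opensRange_chartι I p).ge this
  exact ⟨IsOpenImmersion.lift _ _ hx, (IsOpenImmersion.lift_fac _ _ _).symm⟩

/-- A point of the subscheme is thus determined by homogeneous coordinates of its image; this is the
only property of the embedding needed to compare points. -/
instance mono_projSubschemeEmb : Mono (projSubschemeEmb I) where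
  right_cancellation {Y} x y h := by
    refine Scheme.hom_ext_of_forall _ _ fun t ↦ ?_
    obtain ⟨p, hp⟩ := exists_mem_pspace_basicOpen ((x ≫ projSubschemeEmb I) t)
    refine ⟨(x ≫ projSubschemeEmb I) ⁻¹ᵁ
      Proj.basicOpen (MvPolynomial.homogeneousSubmodule ι k) (MvPolynomial.X p), hp, ?_⟩
    set O := (x ≫ projSubschemeEmb I) ⁻¹ᵁ
      Proj.basicOpen (MvPolynomial.homogeneousSubmodule ι k) (MvPolynomial.X p)
    have hO : Set.range (O.ι ≫ x ≫ projSubschemeEmb I) ⊆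
      (Proj.basicOpen (MvPolynomial.homogeneousSubmodule ι k)
        (MvPolynomial.X p) : (PSpace ι k).Opens) := by
      rintro _ ⟨z, rfl⟩
      exact z.2
    obtain ⟨x', hx'⟩ := exists_lift_chart I (O.ι ≫ x) p (by rwa [Category.assoc])
    obtain ⟨y', hy'⟩ := exists_lift_chart I (O.ι ≫ y) p (by rwa [Category.assoc, ← h])
    have h' := congrArg (O.ι ≫ ·) h
    simp only [← Category.assoc] at h'
    rw [hx', hy', Category.assoc, Category.assoc, awayι_projSubschemeEmb, ← Category.assoc,
      ← Category.assoc, cancel_mono] at h'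
    have : IsClosedImmersion (Spec.map (CommRingCat.ofHom
        (HomogeneousLocalization.Away.map (quotGradedHom I) (MvPolynomial.X p)))) :=
      IsClosedImmersion.spec_of_surjective _ (away_map_surjective I p)
    rw [cancel_mono] at h'
    rw [hx', hy', h']

theorem projSubschemeEmb_over :
    projSubschemeEmb I ≫ pspaceToSpec ι k = (projSubscheme I).hom := by
  refine Scheme.hom_ext_of_forall _ _ fun t ↦ ?_
  obtain ⟨p, hp⟩ := exists_mem_pspace_basicOpen (projSubschemeEmb I t)
  refine ⟨projSubschemeEmb I ⁻¹ᵁ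
    Proj.basicOpen (MvPolynomial.homogeneousSubmodule ι k) (MvPolynomial.X p), hp, ?_⟩
  set O := projSubschemeEmb I ⁻¹ᵁ
    Proj.basicOpen (MvPolynomial.homogeneousSubmodule ι k) (MvPolynomial.X p)
  obtain ⟨y, hy⟩ := exists_lift_chart I O.ι p (by rintro _ ⟨z, rfl⟩; exact z.2)
  have h1 := Proj.awayι_toSpecZero_assoc (MvPolynomial.homogeneousSubmodule ι k)
      (MvPolynomial.X p) (m := 1) (X_mem p) one_pos
      (Spec.map (CommRingCat.ofHom (algebraMap k (MvPolynomial.homogeneousSubmodule ι k 0))))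
  have h2 := Proj.awayι_toSpecZero_assoc (quotGrading I) (quotGradedHom I (MvPolynomial.X p))
    (m := 1) (quotX_mem I p) one_pos (Spec.map (CommRingCat.ofHom (algebraMap k (quotGrading I 0))))
  have h3 : chartι I p ≫ projSubschemeEmb I ≫ pspaceToSpec ι k =
      chartι I p ≫ (projSubscheme I).hom := by
    refine Eq.trans ?_ h2.symm
    refine (Category.assoc _ _ _).symm.trans ?_
    refine (congrArg (· ≫ _) (awayι_projSubschemeEmb I p)).trans ?_
    refine (Category.assoc _ _ _).trans ?_
    refine (congrArg (_ ≫ ·) h1).trans ?_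
    simp only [← Spec.map_comp, ← CommRingCat.ofHom_comp]
    congr 2
  rw [hy, Category.assoc, Category.assoc, h3]

theorem map_irrelevant_quot {B : Type u} [CommRing B] {a : k →+* B} {w : ι → B}
    (hw : Ideal.span (Set.range w) = ⊤)
    (hI : ∀ f ∈ I.toIdeal, MvPolynomial.eval₂Hom a w f = 0) :
    (HomogeneousIdeal.irrelevant (quotGrading I)).toIdeal.map
      (Ideal.Quotient.lift I.toIdeal (MvPolynomial.eval₂Hom a w) hI) = ⊤ := by
  rw [eq_top_iff, ← irrelevant_map_eq_top a w hw, Ideal.map_le_iff_le_comap]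
  refine (HomogeneousIdeal.toIdeal_irrelevant_le _).mpr fun i hi f hf ↦ ?_
  have h : quotGradedHom I f ∈ (HomogeneousIdeal.irrelevant (quotGrading I)).toIdeal :=
    HomogeneousIdeal.mem_irrelevant_of_mem _ hi ((quotGradedHom I).map_mem hf)
  exact Ideal.mem_map_of_mem (Ideal.Quotient.lift I.toIdeal (MvPolynomial.eval₂Hom a w) hI) h

/-- The morphism `[w] : T → Proj (k[x] / I)`, if the coordinates `w` satisfy the equations
in `I`. -/
noncomputable def subPoint (w : ι → Γ(T.left, ⊤)) (hw : Ideal.span (Set.range w) = ⊤)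
    (hI : ∀ f ∈ I.toIdeal, MvPolynomial.eval₂Hom (scalars T) w f = 0) :
    T.left ⟶ (projSubscheme I).left :=
  Proj.fromOfGlobalSections (quotGrading I)
    (Ideal.Quotient.lift I.toIdeal (MvPolynomial.eval₂Hom (scalars T) w) hI)
    (map_irrelevant_quot I hw hI)

theorem eval₂Hom_pull_eq_zero (g : T' ⟶ T) {w : ι → Γ(T.left, ⊤)}
    (hI : ∀ f ∈ I.toIdeal, MvPolynomial.eval₂Hom (scalars T) w f = 0) :
    ∀ f ∈ I.toIdeal, MvPolynomial.eval₂Hom (scalars T') (fun i ↦ pull g (w i)) f = 0 := by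
  intro f hf
  rw [← pull_comp_eval₂Hom, RingHom.comp_apply, hI f hf, map_zero]

theorem comp_subPoint (g : T' ⟶ T) (w : ι → Γ(T.left, ⊤)) (hw : Ideal.span (Set.range w) = ⊤)
    (hI : ∀ f ∈ I.toIdeal, MvPolynomial.eval₂Hom (scalars T) w f = 0) :
    g.left ≫ subPoint I w hw hI =
      subPoint I (fun i ↦ pull g (w i)) (span_pull_eq_top g hw) (eval₂Hom_pull_eq_zero I g hI) := by
  refine (comp_fromOfGlobalSections_eq _ _ _ _).trans
    (fromOfGlobalSections_congr _ (Ideal.Quotient.ringHom_ext ?_) _ _)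
  refine RingHom.ext fun f ↦ ?_
  exact congrArg (fun φ ↦ φ f) (pull_comp_eval₂Hom g w)

theorem subPoint_comp_of_isUnit (w : ι → Γ(T.left, ⊤)) (hw : Ideal.span (Set.range w) = ⊤)
    (hI : ∀ f ∈ I.toIdeal, MvPolynomial.eval₂Hom (scalars T) w f = 0) {p : ι} (hu : IsUnit (w p)) :
    subPoint I w hw hI ≫ projSubschemeEmb I = homogPoint T w hw := by
  have hu1 : IsUnit (MvPolynomial.eval₂Hom (scalars T) w (.X p)) := by simpa using hu
  have hu2 : IsUnit (Ideal.Quotient.lift I.toIdeal (MvPolynomial.eval₂Hom (scalars T) w) hI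
      (quotGradedHom I (MvPolynomial.X p))) := hu1
  have h1 := fromOfGlobalSections_eq_away (quotGrading I)
    (Ideal.Quotient.lift I.toIdeal (MvPolynomial.eval₂Hom (scalars T) w) hI)
    (map_irrelevant_quot I hw hI) (n := 1) one_pos (quotX_mem I p) hu2
  rw [homogPoint_eq_away _ _ p hu1]
  refine (congrArg (· ≫ _) h1).trans ?_
  refine (Category.assoc _ _ _).trans ?_
  refine (congrArg (_ ≫ ·) ((Category.assoc _ _ _).trans
    (congrArg (_ ≫ ·) (awayι_projSubschemeEmb I p)))).trans ?_
  refine (congrArg (_ ≫ ·) (Category.assoc _ _ _).symm).trans ?_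
  rw [← Spec.map_comp, ← CommRingCat.ofHom_comp]
  refine congrArg (fun φ ↦ _ ≫ Spec.map (CommRingCat.ofHom φ) ≫ _) ?_
  refine ringHom_away_ext _ (X_mem p) fun n a ha ↦ ?_
  rw [RingHom.comp_apply, HomogeneousLocalization.Away.map_mk]
  refine (hu1.pow n).mul_left_injective ?_
  exact (awayLift_mk (quotGrading I) (Ideal.Quotient.lift I.toIdeal
    (MvPolynomial.eval₂Hom (scalars T) w) hI) hu2 (quotX_mem I p) n (quotGradedHom I a)
    ((quotGradedHom I).map_mem ha)).trans (awayLift_mk (MvPolynomial.homogeneousSubmodule ι k)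
      (MvPolynomial.eval₂Hom (scalars T) w) hu1 (X_mem p) n a ha).symm

theorem exists_comp_projSubschemeEmb_eq (w : ι → Γ(T.left, ⊤))
    (hw : Ideal.span (Set.range w) = ⊤)
    (hI : ∀ f ∈ I.toIdeal, MvPolynomial.eval₂Hom (scalars T) w f = 0) :
    ∃ x : T ⟶ projSubscheme I, x.left ≫ projSubschemeEmb I = homogPoint T w hw := by
  have hx : subPoint I w hw hI ≫ projSubschemeEmb I = homogPoint T w hw := by
    refine Scheme.hom_ext_of_forall _ _ fun t ↦ ?_
    obtain ⟨p, hp⟩ := exists_mem_basicOpen_of_span_eq_top hw t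
    refine ⟨_, hp, ?_⟩
    set O := T.left.basicOpen (w p)
    have hu := isUnit_pull_of_le (T := T) O (s := w p) le_rfl
    have h1 := subPoint_comp_of_isUnit I _ (span_pull_eq_top (openSubι T O) hw)
      (eval₂Hom_pull_eq_zero I _ hI) (p := p) hu
    rw [← comp_subPoint I _ w hw hI, ← comp_homogPoint _ w hw] at h1
    exact (Category.assoc _ _ _).symm.trans h1
  refine ⟨Over.homMk (subPoint I w hw hI) ?_, hx⟩
  rw [← projSubschemeEmb_over, ← Category.assoc, hx, homogPoint_over]

/-- In the chart of `p` the point factors through the degree-zero localization of `k[x] / I`, where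
the fraction of `f` by a power of `X p` is zero. -/
theorem eval₂Hom_eq_zero_of_isUnit (x : T.left ⟶ (projSubscheme I).left) (w : ι → Γ(T.left, ⊤))
    (hw : Ideal.span (Set.range w) = ⊤) (hx : x ≫ projSubschemeEmb I = homogPoint T w hw)
    {n : ℕ} {f : MvPolynomial ι k} (hfI : f ∈ I.toIdeal)
    (hf : f ∈ MvPolynomial.homogeneousSubmodule ι k n) {p : ι} (hu : IsUnit (w p)) :
    MvPolynomial.eval₂Hom (scalars T) w f = 0 := by
  obtain ⟨y, hy⟩ := exists_lift_chart I x p (by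
    rw [hx]
    rintro _ ⟨z, rfl⟩
    have h := homogPoint_preimage_basicOpen w hw one_pos (X_mem p)
    rw [MvPolynomial.eval₂Hom_X', Scheme.basicOpen_of_isUnit _ hu] at h
    exact h.ge trivial)
  have hu' : IsUnit (MvPolynomial.eval₂Hom (scalars T) w (.X p)) := by simpa using hu
  rw [homogPoint_eq_away _ _ p hu', hy, Category.assoc, awayι_projSubschemeEmb, ← Category.assoc,
    ← Category.assoc, cancel_mono, eq_toSpecΓ_comp y, Category.assoc, ← Spec.map_comp] at hx
  have h3 := congrArg CommRingCat.Hom.hom (toSpecΓ_comp_injective hx)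
  have h4 := congrArg (fun φ ↦ φ (HomogeneousLocalization.Away.mk _ (X_mem p) n f
    (by simpa using hf))) h3
  have h5 : HomogeneousLocalization.Away.map (quotGradedHom I) (MvPolynomial.X p)
      (HomogeneousLocalization.Away.mk _ (X_mem p) n f (by simpa using hf)) = 0 := by
    rw [HomogeneousLocalization.Away.map_mk]
    refine HomogeneousLocalization.val_injective _ ?_
    rw [HomogeneousLocalization.Away.val_mk, HomogeneousLocalization.val_zero]
    have : quotGradedHom I f = 0 := Ideal.Quotient.eq_zero_iff_mem.mpr hfI
    rw [this, Localization.mk_zero]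
  have e2 := awayLift_mk (MvPolynomial.homogeneousSubmodule ι k)
      (MvPolynomial.eval₂Hom (scalars T) w) hu' (X_mem p) n f (by simpa using hf)
  rw [← e2]
  refine mul_eq_zero_of_left (h4.symm.trans ?_) _
  simp only [CommRingCat.hom_comp, RingHom.comp_apply, CommRingCat.hom_ofHom, h5, map_zero]

theorem eval₂Hom_eq_zero_of_comp_eq (x : T.left ⟶ (projSubscheme I).left) (w : ι → Γ(T.left, ⊤))
    (hw : Ideal.span (Set.range w) = ⊤) (hx : x ≫ projSubschemeEmb I = homogPoint T w hw)
    {n : ℕ} {f : MvPolynomial ι k} (hfI : f ∈ I.toIdeal)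
    (hf : f ∈ MvPolynomial.homogeneousSubmodule ι k n) :
    MvPolynomial.eval₂Hom (scalars T) w f = 0 := by
  refine section_ext_of_forall fun t ↦ ?_
  obtain ⟨p, hp⟩ := exists_mem_basicOpen_of_span_eq_top hw t
  refine ⟨_, hp, ?_⟩
  set O := T.left.basicOpen (w p)
  have hu := isUnit_pull_of_le (T := T) O (s := w p) le_rfl
  have h1 := eval₂Hom_eq_zero_of_isUnit I (T := openSub T O) ((openSubι T O).left ≫ x)
    (fun i ↦ pull (openSubι T O) (w i)) (span_pull_eq_top _ hw)
    (by rw [Category.assoc, hx, comp_homogPoint]) hfI hf hu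
  rw [← pull_comp_eval₂Hom] at h1
  rw [map_zero]
  exact h1

end Subscheme
end Points

/-! ### Homogeneous coordinates as a relation, and gluing of morphisms -/

section Coordinates

variable {ι : Type} {k : Type u} [Field k] {T T' : Over (Spec (.of k))}

/-- The morphism `m : T → ℙ^ι_k` has the homogeneous coordinates `w`. -/
def HasCoords (T : Over (Spec (.of k))) (m : T.left ⟶ PSpace ι k) (w : ι → Γ(T.left, ⊤)) : Prop :=
  ∃ hw : Ideal.span (Set.range w) = ⊤, m = homogPoint T w hw

theorem HasCoords.comp {m : T.left ⟶ PSpace ι k} {w : ι → Γ(T.left, ⊤)} (h : HasCoords T m w)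
    (f : T' ⟶ T) : HasCoords T' (f.left ≫ m) fun i ↦ pull f (w i) := by
  obtain ⟨hw, rfl⟩ := h
  exact ⟨span_pull_eq_top f hw, comp_homogPoint f w hw⟩

theorem HasCoords.mul {m : T.left ⟶ PSpace ι k} {w : ι → Γ(T.left, ⊤)} (h : HasCoords T m w)
    {c : Γ(T.left, ⊤)} (hc : IsUnit c) : HasCoords T m fun i ↦ c * w i := by
  obtain ⟨hw, rfl⟩ := h
  exact ⟨span_mul_eq_top hc hw, (homogPoint_mul w hw hc).symm⟩

theorem HasCoords.exists_isUnit {m : T.left ⟶ PSpace ι k} {w w' : ι → Γ(T.left, ⊤)}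
    (h : HasCoords T m w) (h' : HasCoords T m w') : ∃ c, IsUnit c ∧ w' = fun i ↦ c * w i := by
  obtain ⟨hw, rfl⟩ := h
  obtain ⟨hw', e⟩ := h'
  obtain ⟨c, hc, h⟩ := exists_isUnit_of_homogPoint_eq e
  exact ⟨c, hc, funext h⟩

theorem HasCoords.hom_ext {m m' : T.left ⟶ PSpace ι k} {w : ι → Γ(T.left, ⊤)}
    (h : HasCoords T m w) (h' : HasCoords T m' w) : m = m' := by
  obtain ⟨hw, rfl⟩ := h
  obtain ⟨hw', rfl⟩ := h'
  rfl

theorem HasCoords.over {m : T.left ⟶ PSpace ι k} {w : ι → Γ(T.left, ⊤)} (h : HasCoords T m w) :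
    m ≫ pspaceToSpec ι k = T.hom := by
  obtain ⟨hw, rfl⟩ := h
  exact homogPoint_over w hw

theorem HasCoords.preimage_basicOpen {m : T.left ⟶ PSpace ι k} {w : ι → Γ(T.left, ⊤)}
    (h : HasCoords T m w) {n : ℕ} (hn : 0 < n) {p : MvPolynomial ι k}
    (hp : p ∈ MvPolynomial.homogeneousSubmodule ι k n) :
    m ⁻¹ᵁ Proj.basicOpen (MvPolynomial.homogeneousSubmodule ι k) p =
      T.left.basicOpen (MvPolynomial.eval₂Hom (scalars T) w p) := by
  obtain ⟨hw, rfl⟩ := h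
  exact homogPoint_preimage_basicOpen w hw hn hp

theorem exists_hasCoords_of_range_subset (m : T.left ⟶ PSpace ι k)
    (hm : m ≫ pspaceToSpec ι k = T.hom) (p : ι)
    (h : Set.range m ⊆ (Proj.basicOpen (MvPolynomial.homogeneousSubmodule ι k)
      (MvPolynomial.X p) : (PSpace ι k).Opens)) : ∃ w, w p = 1 ∧ HasCoords T m w := by
  obtain ⟨w, hw, hp, rfl⟩ := exists_eq_homogPoint m hm p h
  exact ⟨w, hp, hw, rfl⟩

/-- Coordinates need not exist globally, as the pullback of `𝒪(1)` may be nontrivial; the preimages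
of the charts are where they do. -/
theorem exists_open_hasCoords (m : T.left ⟶ PSpace ι k) (hm : m ≫ pspaceToSpec ι k = T.hom)
    (V : T.left.Opens) (t : T.left) (ht : t ∈ V) :
    ∃ (O : T.left.Opens) (_ : t ∈ O) (_ : O ≤ V) (w : ι → Γ((openSub T O).left, ⊤)),
      HasCoords (openSub T O) ((openSubι T O).left ≫ m) w := by
  obtain ⟨p, hp⟩ := exists_mem_pspace_basicOpen (m t)
  refine ⟨m ⁻¹ᵁ Proj.basicOpen (MvPolynomial.homogeneousSubmodule ι k) (MvPolynomial.X p) ⊓ V,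
    ⟨hp, ht⟩, inf_le_right, ?_⟩
  obtain ⟨w, -, hw⟩ := exists_hasCoords_of_range_subset (T := openSub T _)
    ((openSubι T (m ⁻¹ᵁ Proj.basicOpen (MvPolynomial.homogeneousSubmodule ι k)
      (MvPolynomial.X p) ⊓ V)).left ≫ m) (by rw [Category.assoc, hm, Over.w]) p (by
        rintro _ ⟨z, rfl⟩
        exact z.2.1)
  exact ⟨w, hw⟩

/-- A morphism from a local scheme has homogeneous coordinates. -/
theorem exists_hasCoords_of_isLocalRing {R : Type u} [CommRing R] [IsLocalRing R]
    (a : Spec (.of R) ⟶ Spec (.of k)) (m : Spec (.of R) ⟶ PSpace ι k)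
    (hm : m ≫ pspaceToSpec ι k = a) :
    ∃ p w, w p = 1 ∧ HasCoords (Over.mk a) m w := by
  obtain ⟨p, hp⟩ := exists_mem_pspace_basicOpen (m (IsLocalRing.closedPoint R))
  obtain ⟨w, h⟩ := exists_hasCoords_of_range_subset (T := Over.mk a) m hm p (by
    rintro _ ⟨z, rfl⟩
    have h : (IsLocalRing.closedPoint R) ∈ m ⁻¹ᵁ
      Proj.basicOpen (MvPolynomial.homogeneousSubmodule ι k) (MvPolynomial.X p) := hp
    -- An open set containing the closed point of a local scheme is the whole scheme, so one chart
    -- suffices.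
    have h2 := (IsLocalRing.closed_point_mem_iff (R := R)).mp h
    have h3 : z ∈ m ⁻¹ᵁ
      Proj.basicOpen (MvPolynomial.homogeneousSubmodule ι k) (MvPolynomial.X p) := by
      rw [show m ⁻¹ᵁ Proj.basicOpen (MvPolynomial.homogeneousSubmodule ι k)
        (MvPolynomial.X p) = ⊤ from h2]
      trivial
    exact h3)
  exact ⟨p, w, h⟩

/-- The restriction of a morphism of `k`-schemes to the preimage of an open subscheme. -/
noncomputable def openSubMap (f : T' ⟶ T) (O : T.left.Opens) :
    openSub T' (f.left ⁻¹ᵁ O) ⟶ openSub T O :=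
  Over.homMk (f.left ∣_ O) (by
    change f.left ∣_ O ≫ O.ι ≫ T.hom = (f.left ⁻¹ᵁ O).ι ≫ T'.hom
    rw [← Category.assoc, morphismRestrict_ι, Category.assoc, Over.w])

theorem openSubMap_comp (f : T' ⟶ T) (O : T.left.Opens) :
    openSubMap f O ≫ openSubι T O = openSubι T' (f.left ⁻¹ᵁ O) ≫ f := by
  ext1
  exact morphismRestrict_ι _ _

theorem over_hom_ext_of_forall {Y : Over (Spec (.of k))} {y y' : T ⟶ Y}
    (h : ∀ t : T.left, ∃ O : T.left.Opens, t ∈ O ∧ openSubι T O ≫ y = openSubι T O ≫ y') :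
    y = y' := by
  ext1
  refine Scheme.hom_ext_of_forall _ _ fun t ↦ ?_
  obtain ⟨O, ht, e⟩ := h t
  exact ⟨O, ht, congrArg (fun f ↦ Over.Hom.left f) e⟩

/-- Gluing of morphisms that are locally characterized by a property. -/
theorem exists_glue {Y : Over (Spec (.of k))}
    (R : ∀ {T' : Over (Spec (.of k))}, (T' ⟶ T) → (T' ⟶ Y) → Prop)
    (hcomp : ∀ {T' T'' : Over (Spec (.of k))} (f : T' ⟶ T) (y : T' ⟶ Y) (g : T'' ⟶ T'),
      R f y → R (g ≫ f) (g ≫ y))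
    (huniq : ∀ {T' : Over (Spec (.of k))} (f : T' ⟶ T) (y y' : T' ⟶ Y), R f y → R f y' → y = y')
    (hloc : ∀ t : T.left, ∃ O : T.left.Opens, t ∈ O ∧ ∃ y, R (openSubι T O) y) :
    ∃ y : T ⟶ Y, ∀ {T' : Over (Spec (.of k))} (f : T' ⟶ T) (y' : T' ⟶ Y), R f y' → f ≫ y = y' := by
  choose O hO y hy using hloc
  let 𝒰 : T.left.OpenCover := T.left.openCoverOfIsOpenCover O (by
    rw [TopologicalSpace.IsOpenCover, eq_top_iff]
    exact fun t _ ↦ TopologicalSpace.Opens.mem_iSup.mpr ⟨t, hO t⟩)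
  have hglue : ∀ i j : T.left,
      Limits.pullback.fst (𝒰.f i) (𝒰.f j) ≫ (y i).left =
        Limits.pullback.snd (𝒰.f i) (𝒰.f j) ≫ (y j).left := by
    intro i j
    let P : Over (Spec (.of k)) := Over.mk (Limits.pullback.fst (𝒰.f i) (𝒰.f j) ≫ (O i).ι ≫ T.hom)
    let g₁ : P ⟶ openSub T (O i) := Over.homMk (Limits.pullback.fst (𝒰.f i) (𝒰.f j))
    let g₂ : P ⟶ openSub T (O j) := Over.homMk (Limits.pullback.snd (𝒰.f i) (𝒰.f j)) (by
      change Limits.pullback.snd (𝒰.f i) (𝒰.f j) ≫ (𝒰.f j) ≫ T.hom =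
        Limits.pullback.fst (𝒰.f i) (𝒰.f j) ≫ (𝒰.f i) ≫ T.hom
      rw [← Category.assoc, ← Limits.pullback.condition, Category.assoc])
    have e : g₁ ≫ openSubι T (O i) = g₂ ≫ openSubι T (O j) := by
      ext1
      exact Limits.pullback.condition
    have h1 := hcomp _ _ g₁ (hy i)
    have h2 := hcomp _ _ g₂ (hy j)
    rw [← e] at h2
    exact congrArg (fun f ↦ Over.Hom.left f) (huniq _ _ _ h1 h2)
  let z : T.left ⟶ Y.left := Scheme.Cover.glueMorphisms 𝒰 (fun i ↦ (y i).left) hglue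
  have hz : ∀ i, (O i).ι ≫ z = (y i).left := fun i ↦ Scheme.Cover.ι_glueMorphisms 𝒰 _ hglue i
  have hzover : z ≫ Y.hom = T.hom := by
    refine Scheme.hom_ext_of_forall _ _ fun t ↦ ⟨O t, hO t, ?_⟩
    rw [← Category.assoc, hz]
    exact Over.w (y t)
  refine ⟨Over.homMk z hzover, fun {T'} f y' hR ↦ ?_⟩
  refine over_hom_ext_of_forall fun t' ↦ ⟨f.left ⁻¹ᵁ O (f.left t'), hO _, ?_⟩
  have h1 := hcomp _ _ (openSubMap f (O (f.left t'))) (hy (f.left t'))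
  have h2 := hcomp _ _ (openSubι T' (f.left ⁻¹ᵁ O (f.left t'))) hR
  rw [openSubMap_comp] at h1
  refine Eq.trans ?_ (huniq _ _ _ h1 h2)
  rw [← Category.assoc, ← openSubMap_comp, Category.assoc]
  refine congrArg (_ ≫ ·) ?_
  ext1
  exact hz _

/-- A natural operation on homogeneous coordinates, homogeneous of degree one, that is defined
locally defines a morphism. -/
theorem exists_hom_of_local_operator {J : Type} {Y : Over (Spec (.of k))} (m : T.left ⟶ PSpace ι k)
    (e : Y.left ⟶ PSpace J k) [Mono e]
    (op : ∀ {T' : Over (Spec (.of k))}, (T' ⟶ T) → (ι → Γ(T'.left, ⊤)) → J → Γ(T'.left, ⊤))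
    (hnat : ∀ {T' T'' : Over (Spec (.of k))} (f : T' ⟶ T) (g : T'' ⟶ T') (w : ι → Γ(T'.left, ⊤)),
      op (g ≫ f) (fun i ↦ pull g (w i)) = fun j ↦ pull g (op f w j))
    (hmul : ∀ {T' : Over (Spec (.of k))} (f : T' ⟶ T) (w : ι → Γ(T'.left, ⊤)) (c : Γ(T'.left, ⊤)),
      op f (fun i ↦ c * w i) = fun j ↦ c * op f w j)
    (hop : ∀ t : T.left, ∃ O : T.left.Opens, t ∈ O ∧ ∃ (y : openSub T O ⟶ Y) (w : _),
      HasCoords (openSub T O) ((openSubι T O).left ≫ m) w ∧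
        HasCoords (openSub T O) (y.left ≫ e) (op (openSubι T O) w)) :
    ∃ y : T ⟶ Y, ∀ {T' : Over (Spec (.of k))} (f : T' ⟶ T) (w : ι → Γ(T'.left, ⊤)) (y' : T' ⟶ Y),
      HasCoords T' (f.left ≫ m) w → HasCoords T' (y'.left ≫ e) (op f w) → f ≫ y = y' := by
  obtain ⟨y, hy⟩ := exists_glue (T := T) (Y := Y)
    (fun {T'} f y ↦ ∃ w, HasCoords T' (f.left ≫ m) w ∧ HasCoords T' (y.left ≫ e) (op f w))
    (by
      rintro T' T'' f y g ⟨w, h1, h2⟩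
      refine ⟨_, by simpa using h1.comp g, ?_⟩
      rw [hnat]
      simpa using h2.comp g)
    (by
      rintro T' f y y' ⟨w, h1, h2⟩ ⟨w', h1', h2'⟩
      -- Two choices of coordinates differ by a unit, which homogeneity of degree one carries
      -- through `op`; hence the result does not depend on the choice.
      obtain ⟨c, hc, rfl⟩ := h1.exists_isUnit h1'
      rw [hmul] at h2'
      ext1
      rw [← cancel_mono e]
      exact (h2.mul hc).hom_ext h2')
    hop
  exact ⟨y, fun f w y' hw hyw ↦ hy f y' ⟨w, hw, hyw⟩⟩

/-- A natural operation on homogeneous coordinates, homogeneous of degree one, defines a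
morphism. -/
theorem exists_hom_of_operator {J : Type} {Y : Over (Spec (.of k))} (m : T.left ⟶ PSpace ι k)
    (hm : m ≫ pspaceToSpec ι k = T.hom) (e : Y.left ⟶ PSpace J k) [Mono e]
    (op : ∀ {T' : Over (Spec (.of k))}, (T' ⟶ T) → (ι → Γ(T'.left, ⊤)) → J → Γ(T'.left, ⊤))
    (hnat : ∀ {T' T'' : Over (Spec (.of k))} (f : T' ⟶ T) (g : T'' ⟶ T') (w : ι → Γ(T'.left, ⊤)),
      op (g ≫ f) (fun i ↦ pull g (w i)) = fun j ↦ pull g (op f w j))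
    (hmul : ∀ {T' : Over (Spec (.of k))} (f : T' ⟶ T) (w : ι → Γ(T'.left, ⊤)) (c : Γ(T'.left, ⊤)),
      op f (fun i ↦ c * w i) = fun j ↦ c * op f w j)
    (hop : ∀ {T' : Over (Spec (.of k))} (f : T' ⟶ T) (w : ι → Γ(T'.left, ⊤)),
      HasCoords T' (f.left ≫ m) w → ∃ y : T' ⟶ Y, HasCoords T' (y.left ≫ e) (op f w)) :
    ∃ y : T ⟶ Y, ∀ {T' : Over (Spec (.of k))} (f : T' ⟶ T) (w : ι → Γ(T'.left, ⊤)),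
      HasCoords T' (f.left ≫ m) w → HasCoords T' ((f ≫ y).left ≫ e) (op f w) := by
  obtain ⟨y, hy⟩ := exists_hom_of_local_operator m e op hnat hmul fun t ↦ by
    obtain ⟨O, ht, -, w, hw⟩ := exists_open_hasCoords m hm ⊤ t trivial
    obtain ⟨y, hy⟩ := hop _ w hw
    exact ⟨O, ht, y, w, hw, hy⟩
  refine ⟨y, fun {T'} f w hw ↦ ?_⟩
  obtain ⟨y', hy'⟩ := hop f w hw
  rw [hy f w y' hw hy']
  exact hy'

end Coordinates

/-! ### Bivectors and the Plücker relations -/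

section Bivectors

variable {R : Type u} [CommRing R]

/-- The Plücker coordinates of the bivector `x ∧ y`. -/
def wedge (x y : Fin 5 → R) : Pairs → R := fun p ↦ x p.1.1 * y p.1.2 - x p.1.2 * y p.1.1

/-- The Plücker relations. -/
def IsPlucker (w : Pairs → R) : Prop :=
  ∀ (i j l m : Fin 5) (hij : i < j) (hjl : j < l) (hlm : l < m),
    w ⟨(i, j), hij⟩ * w ⟨(l, m), hlm⟩
      - w ⟨(i, l), hij.trans hjl⟩ * w ⟨(j, m), hjl.trans hlm⟩
      + w ⟨(i, m), (hij.trans hjl).trans hlm⟩ * w ⟨(j, l), hjl⟩ = 0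

theorem isPlucker_wedge (x y : Fin 5 → R) : IsPlucker (wedge x y) := by
  intro i j l m _ _ _
  simp only [wedge]
  ring

theorem isPlucker_mul {w : Pairs → R} (h : IsPlucker w) (c : R) : IsPlucker fun p ↦ c * w p := by
  intro i j l m hij hjl hlm
  linear_combination c ^ 2 * h i j l m hij hjl hlm

/-- The skew-symmetric matrix of a bivector. -/
def skew (w : Pairs → R) (i j : Fin 5) : R :=
  if h : i < j then w ⟨(i, j), h⟩ else if h : j < i then - w ⟨(j, i), h⟩ else 0

theorem skew_of_lt (w : Pairs → R) {i j : Fin 5} (h : i < j) : skew w i j = w ⟨(i, j), h⟩ := by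
  simp [skew, h]

theorem skew_self (w : Pairs → R) (i : Fin 5) : skew w i i = 0 := by
  simp [skew]

theorem skew_swap (w : Pairs → R) (i j : Fin 5) : skew w j i = - skew w i j := by
  rcases lt_trichotomy i j with h | rfl | h
  · simp [skew, h, h.not_gt]
  · simp [skew]
  · simp [skew, h, h.not_gt]

theorem sum_pairs (f : Fin 5 → Fin 5 → R) : ∑ p : Pairs, f p.1.1 p.1.2 =
    f 0 1 + f 0 2 + f 0 3 + f 0 4 + f 1 2 + f 1 3 + f 1 4 + f 2 3 + f 2 4 + f 3 4 := by
  have h : (Finset.univ : Finset Pairs) = {⟨(0, 1), by decide⟩, ⟨(0, 2), by decide⟩,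
    ⟨(0, 3), by decide⟩, ⟨(0, 4), by decide⟩, ⟨(1, 2), by decide⟩, ⟨(1, 3), by decide⟩,
    ⟨(1, 4), by decide⟩, ⟨(2, 3), by decide⟩, ⟨(2, 4), by decide⟩, ⟨(3, 4), by decide⟩} := by
    decide
  rw [h]
  simp only [Finset.sum_insert, Finset.mem_insert, Finset.mem_singleton, Subtype.mk.injEq,
    Prod.mk.injEq, Fin.isValue, Fin.reduceEq, and_false, and_true, or_false,
    not_false_eq_true, Finset.sum_singleton, and_self]
  ring

/-- Passing to full double sums makes contractions of a bivector with covectors available. -/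
theorem sum_pairs_skew (w : Pairs → R) (f : Fin 5 → Fin 5 → R) :
    ∑ p : Pairs, (f p.1.1 p.1.2 - f p.1.2 p.1.1) * w p = ∑ i, ∑ j, f i j * skew w i j := by
  have h : ∀ p : Pairs, (f p.1.1 p.1.2 - f p.1.2 p.1.1) * w p =
      (f p.1.1 p.1.2 - f p.1.2 p.1.1) * skew w p.1.1 p.1.2 := fun p ↦ by rw [skew_of_lt w p.2]
  rw [Finset.sum_congr rfl fun p _ ↦ h p,
    sum_pairs fun i j ↦ (f i j - f j i) * skew w i j]
  simp only [Fin.sum_univ_five, skew_self, skew_swap w 0 1, skew_swap w 0 2, skew_swap w 0 3,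
    skew_swap w 0 4, skew_swap w 1 2, skew_swap w 1 3, skew_swap w 1 4, skew_swap w 2 3,
    skew_swap w 2 4, skew_swap w 3 4]
  ring

/-- The expression is alternating in the four indices: it vanishes if two agree and changes sign
under transpositions. So it is enough to sort the indices, one at a time. -/
theorem IsPlucker.skew_relation {w : Pairs → R} (h : IsPlucker w) (i j l m : Fin 5) :
    skew w i j * skew w l m - skew w i l * skew w j m + skew w i m * skew w j l = 0 := by
  set s := skew w
  have hs : ∀ i j, s j i = - s i j := skew_swap w
  have h0 : ∀ i, s i i = 0 := skew_self w
  have hlt : ∀ i j l m, i < j → j < l → l < m →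
      s i j * s l m - s i l * s j m + s i m * s j l = 0 := by
    intro i j l m hij hjl hlm
    simpa only [s, skew_of_lt w hij, skew_of_lt w hlm, skew_of_lt w (hij.trans hjl),
      skew_of_lt w (hjl.trans hlm), skew_of_lt w ((hij.trans hjl).trans hlm), skew_of_lt w hjl]
      using h i j l m hij hjl hlm
  have h1 : ∀ i j l m, j < l → l < m → s i j * s l m - s i l * s j m + s i m * s j l = 0 := by
    intro i j l m hjl hlm
    rcases lt_trichotomy i j with hij | rfl | hji
    · exact hlt i j l m hij hjl hlm
    · rw [h0]; ring
    rcases lt_trichotomy i l with hil | rfl | hli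
    · rw [hs j i]; linear_combination -hlt j i l m hji hil hlm
    · rw [h0, hs j i]; ring
    rcases lt_trichotomy i m with him | rfl | hmi
    · rw [hs j i, hs l i]; linear_combination hlt j l i m hjl hli him
    · rw [h0, hs j i, hs l i]; ring
    · rw [hs j i, hs l i, hs m i]; linear_combination -hlt j l m i hjl hlm hmi
  have h2 : ∀ i j l m, l < m → s i j * s l m - s i l * s j m + s i m * s j l = 0 := by
    intro i j l m hlm
    rcases lt_trichotomy j l with hjl | rfl | hlj
    · exact h1 i j l m hjl hlm
    · rw [h0]; ring
    rcases lt_trichotomy j m with hjm | rfl | hmj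
    · rw [hs l j]; linear_combination -h1 i l j m hlj hjm
    · rw [h0, hs l j]; ring
    · rw [hs l j, hs m j]; linear_combination h1 i l m j hlm hmj
  rcases lt_trichotomy l m with hlm | rfl | hml
  · exact h2 i j l m hlm
  · rw [h0]; ring
  · rw [hs m l]; linear_combination -h2 i j m l hml

/-- A bivector satisfying the Plücker relations is decomposable up to a factor. -/
theorem IsPlucker.contract {w : Pairs → R} (h : IsPlucker w) (α β : Fin 5 → R) (p : Pairs) :
    (∑ q, wedge α β q * w q) * w p =
      wedge (fun a ↦ ∑ i, α i * skew w i a) (fun a ↦ ∑ i, β i * skew w i a) p := by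
  obtain ⟨⟨a, b⟩, hab⟩ := p
  have h1 : ∑ q, wedge α β q * w q = ∑ i, ∑ j, α i * β j * skew w i j := by
    rw [← sum_pairs_skew w fun i j ↦ α i * β j]
    refine Finset.sum_congr rfl fun q _ ↦ ?_
    simp only [wedge]
  rw [h1, ← skew_of_lt w hab]
  simp only [wedge]
  rw [Finset.sum_mul_sum, Finset.sum_mul_sum, Finset.sum_mul]
  rw [← Finset.sum_sub_distrib]
  refine Finset.sum_congr rfl fun i _ ↦ ?_
  rw [Finset.sum_mul, ← Finset.sum_sub_distrib]
  refine Finset.sum_congr rfl fun j _ ↦ ?_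
  -- The Plücker relation for `i, j, a, b` reads `w_ij w_ab = w_ia w_jb - w_ib w_ja`; it is summed
  -- against `α i * β j`.
  linear_combination α i * β j * h.skew_relation i j a b

theorem wedgeAct_wedge (A : Matrix (Fin 5) (Fin 5) R) (x y : Fin 5 → R) :
    wedgeAct A (wedge x y) = wedge (fun i ↦ ∑ a, A a i * x a) (fun i ↦ ∑ a, A a i * y a) := by
  funext p
  simp only [wedgeAct, wedge]
  rw [sum_pairs fun a b ↦ (A a p.1.1 * A b p.1.2 - A a p.1.2 * A b p.1.1) *
    (x a * y b - x b * y a)]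
  simp only [Fin.sum_univ_five]
  ring

theorem wedgeAct_mul (A : Matrix (Fin 5) (Fin 5) R) (c : R) (w : Pairs → R) :
    wedgeAct A (fun p ↦ c * w p) = fun p ↦ c * wedgeAct A w p := by
  funext p
  simp only [wedgeAct, Finset.mul_sum]
  exact Finset.sum_congr rfl fun q _ ↦ by ring

theorem wedgeAct_one (w : Pairs → R) : wedgeAct 1 w = w := by
  funext p
  simp only [wedgeAct]
  rw [Finset.sum_eq_single p]
  · have := p.2.ne
    simp [this, this.symm]
  · intro q _ hq
    obtain ⟨⟨a, b⟩, hab⟩ := p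
    obtain ⟨⟨c, d⟩, hcd⟩ := q
    have h1 : ¬ (c = a ∧ d = b) := fun h ↦ hq (by simp [h.1, h.2])
    have h2 : ¬ (c = b ∧ d = a) := fun h ↦ by
      simp only at hab hcd
      rw [h.1, h.2] at hcd
      exact absurd hab hcd.not_gt
    simp only [Matrix.one_apply]
    split_ifs <;> simp_all
  · simp

theorem wedgeAct_add (A : Matrix (Fin 5) (Fin 5) R) (w w' : Pairs → R) :
    wedgeAct A (w + w') = wedgeAct A w + wedgeAct A w' := by
  funext p
  simp only [wedgeAct, Pi.add_apply, mul_add, Finset.sum_add_distrib]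

/-- The action on bivectors as a linear map. -/
def wedgeActLin (A : Matrix (Fin 5) (Fin 5) R) : (Pairs → R) →ₗ[R] (Pairs → R) where
  toFun := wedgeAct A
  map_add' := wedgeAct_add A
  map_smul' c w := wedgeAct_mul A c w

theorem wedge_single (q : Pairs) :
    wedge (Pi.single q.1.1 (1 : R)) (Pi.single q.1.2 1) = Pi.single q 1 := by
  funext p
  obtain ⟨⟨a, b⟩, hab⟩ := p
  obtain ⟨⟨c, d⟩, hcd⟩ := q
  simp only [wedge, Pi.single_apply, Subtype.mk.injEq, Prod.mk.injEq]
  simp only at hab hcd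
  have h2 : ¬ (b = c ∧ a = d) := fun h ↦ by
    rw [h.1, h.2] at hab
    exact absurd hab hcd.not_gt
  split_ifs <;> simp_all

/-- The standard basis of the bivectors consists of the decomposable elements `e_i ∧ e_j`. -/
theorem bivector_hom_ext {M : Type*} [AddCommGroup M] [Module R M] {f g : (Pairs → R) →ₗ[R] M}
    (h : ∀ x y, f (wedge x y) = g (wedge x y)) : f = g := by
  refine (Pi.basisFun R Pairs).ext fun q ↦ ?_
  rw [Pi.basisFun_apply, ← wedge_single]
  exact h _ _

/-- The order of the factors is reversed because `wedgeAct A` comes from multiplying row vectors by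
`A` on the right. -/
theorem wedgeAct_wedgeAct (A B : Matrix (Fin 5) (Fin 5) R) (w : Pairs → R) :
    wedgeAct A (wedgeAct B w) = wedgeAct (B * A) w := by
  have h : wedgeActLin A ∘ₗ wedgeActLin B = wedgeActLin (B * A) := by
    refine bivector_hom_ext fun x y ↦ ?_
    have key : ∀ x : Fin 5 → R, (fun i ↦ ∑ a, A a i * ∑ b, B b a * x b) =
        fun i ↦ ∑ a, (B * A) a i * x a := by
      intro x
      funext i
      simp only [Matrix.mul_apply, Finset.mul_sum, Finset.sum_mul]
      rw [Finset.sum_comm]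
      exact Finset.sum_congr rfl fun a _ ↦ Finset.sum_congr rfl fun b _ ↦ by ring
    change wedgeAct A (wedgeAct B (wedge x y)) = wedgeAct (B * A) (wedge x y)
    simp only [wedgeAct_wedge, key]
  exact LinearMap.congr_fun h w

theorem map_wedgeAct {S : Type u} [CommRing S] (φ : R →+* S) (A : Matrix (Fin 5) (Fin 5) R)
    (w : Pairs → R) (p : Pairs) :
    φ (wedgeAct A w p) = wedgeAct (A.map φ) (fun q ↦ φ (w q)) p := by
  simp [wedgeAct]

theorem map_wedge {S : Type u} [CommRing S] (φ : R →+* S) (x y : Fin 5 → R) (p : Pairs) :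
    φ (wedge x y p) = wedge (fun i ↦ φ (x i)) (fun i ↦ φ (y i)) p := by
  simp [wedge]

/-- The value of a Plücker coordinate times the bivector is a decomposable bivector. -/
theorem IsPlucker.mul_eq_wedge {w : Pairs → R} (h : IsPlucker w) (q : Pairs) :
    (fun p ↦ w q * w p) = wedge (skew w q.1.1) (skew w q.1.2) := by
  funext p
  have := h.contract (Pi.single q.1.1 1) (Pi.single q.1.2 1) p
  rw [wedge_single] at this
  simpa [Pi.single_apply] using this

/-- The quadrics are killed by the squares of the elements `v q`, and these squares still generate
the unit ideal. -/
theorem isPlucker_of_span {w : Pairs → R} {v : Pairs → R} (hv : Ideal.span (Set.range v) = ⊤)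
    (h : ∀ q, IsPlucker fun p ↦ v q * w p) : IsPlucker w := by
  intro i j l m hij hjl hlm
  rw [← Submodule.mem_bot R]
  refine Submodule.mem_of_span_eq_top_of_smul_pow_mem _ _ hv _ ?_
  rintro ⟨_, q, rfl⟩
  refine ⟨2, ?_⟩
  rw [Submodule.mem_bot, smul_eq_mul]
  linear_combination h q i j l m hij hjl hlm

/-- Each multiple `w q • w` is decomposable, so its image is decomposable too; since the coordinates
generate the unit ideal, the relations descend to the image of `w`. -/
theorem isPlucker_wedgeAct {w : Pairs → R} (hw : Ideal.span (Set.range w) = ⊤) (h : IsPlucker w)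
    (A : Matrix (Fin 5) (Fin 5) R) : IsPlucker (wedgeAct A w) := by
  refine isPlucker_of_span hw fun q ↦ ?_
  rw [← wedgeAct_mul, h.mul_eq_wedge, wedgeAct_wedge]
  exact isPlucker_wedge _ _

theorem span_wedgeAct {w : Pairs → R} (hw : Ideal.span (Set.range w) = ⊤)
    {A B : Matrix (Fin 5) (Fin 5) R} (h : A * B = 1) :
    Ideal.span (Set.range (wedgeAct A w)) = ⊤ := by
  rw [eq_top_iff, ← hw, Ideal.span_le]
  rintro _ ⟨p, rfl⟩
  have e : w = wedgeAct B (wedgeAct A w) := by rw [wedgeAct_wedgeAct, h, wedgeAct_one]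
  rw [SetLike.mem_coe, congrFun e p]
  exact Ideal.sum_mem _ fun q _ ↦ Ideal.mul_mem_left _ _ (Ideal.subset_span ⟨q, rfl⟩)

/-- The bilinear form over `R` of a family of coefficients in `k`. -/
def form {k : Type u} [Field k] (φ : k →+* R) (s : Pairs → k) :
    (Fin 5 → R) →ₗ[R] (Fin 5 → R) →ₗ[R] R :=
  LinearMap.mk₂ R (fun x y ↦ ∑ p, φ (s p) * wedge x y p)
    (fun x x' y ↦ by
      rw [← Finset.sum_add_distrib]
      exact Finset.sum_congr rfl fun p _ ↦ by simp only [wedge, Pi.add_apply]; ring)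
    (fun c x y ↦ by
      rw [smul_eq_mul, Finset.mul_sum]
      exact Finset.sum_congr rfl fun p _ ↦ by simp only [wedge, Pi.smul_apply, smul_eq_mul]; ring)
    (fun x y y' ↦ by
      rw [← Finset.sum_add_distrib]
      exact Finset.sum_congr rfl fun p _ ↦ by simp only [wedge, Pi.add_apply]; ring)
    (fun c x y ↦ by
      rw [smul_eq_mul, Finset.mul_sum]
      exact Finset.sum_congr rfl fun p _ ↦ by simp only [wedge, Pi.smul_apply, smul_eq_mul]; ring)

theorem form_apply {k : Type u} [Field k] (φ : k →+* R) (s : Pairs → k) (x y : Fin 5 → R) :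
    form φ s x y = ∑ p, φ (s p) * wedge x y p := rfl

theorem form_self {k : Type u} [Field k] (φ : k →+* R) (s : Pairs → k) (x : Fin 5 → R) :
    form φ s x x = 0 := by
  rw [form_apply]
  exact Finset.sum_eq_zero fun p _ ↦ by simp only [wedge]; ring

theorem form_swap {k : Type u} [Field k] (φ : k →+* R) (s : Pairs → k) (x y : Fin 5 → R) :
    form φ s x y = - form φ s y x := by
  rw [form_apply, form_apply, ← Finset.sum_neg_distrib]
  exact Finset.sum_congr rfl fun p _ ↦ by simp only [wedge]; ring

theorem form_map {k : Type u} [Field k] (φ : k →+* R) (s : Pairs → k) (x y : Fin 5 → k) :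
    form φ s (fun i ↦ φ (x i)) (fun i ↦ φ (y i)) = φ (altForm s x y) := by
  simp [form_apply, altForm, wedge]

theorem map_form {k S : Type u} [Field k] [CommRing S] (φ : k →+* R) (ψ : R →+* S) (s : Pairs → k)
    (x y : Fin 5 → R) :
    ψ (form φ s x y) = form (ψ.comp φ) s (fun i ↦ ψ (x i)) (fun i ↦ ψ (y i)) := by
  simp [form_apply, wedge]

theorem altForm_eq_form {k : Type u} [Field k] (s : Pairs → k) (x y : Fin 5 → k) :
    altForm s x y = form (RingHom.id k) s x y := rfl

end Bivectors

/-! ### Frames adapted to a projection -/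

section Frames

variable {k : Type u} [Field k]

theorem altForm_add_left (s : Pairs → k) (x x' y : Fin 5 → k) :
    altForm s (x + x') y = altForm s x y + altForm s x' y :=
  LinearMap.map_add₂ (form (RingHom.id k) s) x x' y

theorem altForm_add_right (s : Pairs → k) (x y y' : Fin 5 → k) :
    altForm s x (y + y') = altForm s x y + altForm s x y' :=
  map_add (form (RingHom.id k) s x) y y'

theorem altForm_smul_left (s : Pairs → k) (c : k) (x y : Fin 5 → k) :
    altForm s (c • x) y = c * altForm s x y :=
  LinearMap.map_smul₂ (form (RingHom.id k) s) c x y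

theorem altForm_smul_right (s : Pairs → k) (c : k) (x y : Fin 5 → k) :
    altForm s x (c • y) = c * altForm s x y :=
  map_smul (form (RingHom.id k) s x) c y

theorem altForm_sub_left (s : Pairs → k) (x x' y : Fin 5 → k) :
    altForm s (x - x') y = altForm s x y - altForm s x' y :=
  LinearMap.map_sub₂ (form (RingHom.id k) s) x x' y

theorem altForm_sub_right (s : Pairs → k) (x y y' : Fin 5 → k) :
    altForm s x (y - y') = altForm s x y - altForm s x y' :=
  map_sub (form (RingHom.id k) s x) y y'

theorem altForm_self (s : Pairs → k) (x : Fin 5 → k) : altForm s x x = 0 :=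
  form_self (RingHom.id k) s x

theorem altForm_swap (s : Pairs → k) (x y : Fin 5 → k) : altForm s x y = - altForm s y x :=
  form_swap (RingHom.id k) s x y

theorem altForm_zero_left (s : Pairs → k) (y : Fin 5 → k) : altForm s 0 y = 0 :=
  LinearMap.map_zero₂ (form (RingHom.id k) s) y

theorem altForm_zero_right (s : Pairs → k) (x : Fin 5 → k) : altForm s x 0 = 0 :=
  map_zero (form (RingHom.id k) s x)

theorem altForm_wedge (α β x y : Fin 5 → k) :
    altForm (wedge α β) x y = (α ⬝ᵥ x) * (β ⬝ᵥ y) - (α ⬝ᵥ y) * (β ⬝ᵥ x) := by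
  simp only [altForm, wedge]
  rw [sum_pairs fun i j ↦ (α i * β j - α j * β i) * (x i * y j - x j * y i)]
  simp only [dotProduct, Fin.sum_univ_five]
  ring

theorem altForm_single (s : Pairs → k) (q : Pairs) :
    altForm s (Pi.single q.1.1 1) (Pi.single q.1.2 1) = s q := by
  rw [altForm_eq_form, form_apply, wedge_single]
  simp [Pi.single_apply]

theorem altForm_ext {s s' : Pairs → k} (h : ∀ x y, altForm s x y = altForm s' x y) : s = s' := by
  funext q
  rw [← altForm_single s, ← altForm_single s', h]

/-- Two vectors spanning a complement of `V₃`, with the dual covectors vanishing on `V₃`. -/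
structure IsCoframe (V₃ : Submodule k (Fin 5 → k)) (α β a₁ a₂ : Fin 5 → k) : Prop where
  left_vanish : ∀ v ∈ V₃, α ⬝ᵥ v = 0
  right_vanish : ∀ v ∈ V₃, β ⬝ᵥ v = 0
  decomp : ∀ x, x - (α ⬝ᵥ x) • a₁ - (β ⬝ᵥ x) • a₂ ∈ V₃
  left_fst : α ⬝ᵥ a₁ = 1
  left_snd : α ⬝ᵥ a₂ = 0
  right_fst : β ⬝ᵥ a₁ = 0
  right_snd : β ⬝ᵥ a₂ = 1

theorem exists_dotProduct_eq (f : (Fin 5 → k) →ₗ[k] k) : ∃ α : Fin 5 → k, ∀ x, α ⬝ᵥ x = f x := by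
  refine ⟨fun i ↦ f (Pi.single i 1), fun x ↦ ?_⟩
  conv_rhs => rw [pi_eq_sum_univ' x]
  simp [dotProduct, mul_comm]

theorem exists_isCoframe (V₃ : Submodule k (Fin 5 → k)) (h : Module.finrank k V₃ = 3) :
    ∃ α β a₁ a₂, IsCoframe V₃ α β a₁ a₂ := by
  have h2 : Module.finrank k ((Fin 5 → k) ⧸ V₃) = 2 := by
    have := V₃.finrank_quotient_add_finrank
    rw [h, Module.finrank_fin_fun] at this
    omega
  let b := Module.finBasisOfFinrankEq k _ h2
  obtain ⟨α, hα⟩ := exists_dotProduct_eq (b.coord 0 ∘ₗ V₃.mkQ)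
  obtain ⟨β, hβ⟩ := exists_dotProduct_eq (b.coord 1 ∘ₗ V₃.mkQ)
  obtain ⟨a₁, h₁⟩ := V₃.mkQ_surjective (b 0)
  obtain ⟨a₂, h₂⟩ := V₃.mkQ_surjective (b 1)
  refine ⟨α, β, a₁, a₂, ?_, ?_, ?_, ?_, ?_, ?_, ?_⟩
  · intro v hv
    simp [hα, (Submodule.Quotient.mk_eq_zero V₃).2 hv]
  · intro v hv
    simp [hβ, (Submodule.Quotient.mk_eq_zero V₃).2 hv]
  · intro x
    rw [← Submodule.Quotient.mk_eq_zero, ← Submodule.mkQ_apply, map_sub, map_sub, map_smul,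
      map_smul, h₁, h₂, hα, hβ]
    have := b.sum_repr (V₃.mkQ x)
    rw [Fin.sum_univ_two] at this
    simp only [LinearMap.comp_apply, Module.Basis.coord_apply]
    nth_rewrite 1 [← this]
    abel
  all_goals simp [hα, hβ, h₁, h₂]

namespace IsCoframe

variable {V₃ : Submodule k (Fin 5 → k)} {α β a₁ a₂ : Fin 5 → k}

theorem shift (h : IsCoframe V₃ α β a₁ a₂) {c d : Fin 5 → k} (hc : c ∈ V₃) (hd : d ∈ V₃) :
    IsCoframe V₃ α β (a₁ + c) (a₂ + d) where
  left_vanish := h.left_vanish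
  right_vanish := h.right_vanish
  decomp x := by
    have : x - (α ⬝ᵥ x) • (a₁ + c) - (β ⬝ᵥ x) • (a₂ + d) =
        (x - (α ⬝ᵥ x) • a₁ - (β ⬝ᵥ x) • a₂) - (α ⬝ᵥ x) • c - (β ⬝ᵥ x) • d := by
      rw [smul_add, smul_add]; abel
    rw [this]
    exact sub_mem (sub_mem (h.decomp x) (V₃.smul_mem _ hc)) (V₃.smul_mem _ hd)
  left_fst := by rw [dotProduct_add, h.left_fst, h.left_vanish c hc, add_zero]
  left_snd := by rw [dotProduct_add, h.left_snd, h.left_vanish d hd, add_zero]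
  right_fst := by rw [dotProduct_add, h.right_fst, h.right_vanish c hc, add_zero]
  right_snd := by rw [dotProduct_add, h.right_snd, h.right_vanish d hd, add_zero]

theorem scale (h : IsCoframe V₃ α β a₁ a₂) {r : k} (hr : r ≠ 0) :
    IsCoframe V₃ (r • α) β (r⁻¹ • a₁) a₂ where
  left_vanish v hv := by rw [smul_dotProduct, h.left_vanish v hv, smul_zero]
  right_vanish := h.right_vanish
  decomp x := by
    rw [smul_dotProduct, smul_smul, smul_eq_mul, mul_right_comm, mul_inv_cancel₀ hr, one_mul]
    exact h.decomp x
  left_fst := by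
    rw [smul_dotProduct, dotProduct_smul, h.left_fst, smul_eq_mul, smul_eq_mul, mul_one,
      mul_inv_cancel₀ hr]
  left_snd := by rw [smul_dotProduct, h.left_snd, smul_zero]
  right_fst := by rw [dotProduct_smul, h.right_fst, smul_zero]
  right_snd := h.right_snd

/-- Only the components of `y` along `a₁` and `a₂` count, since `s(c, ·)` vanishes on `V₃`. -/
theorem altForm_of_mem_left (h : IsCoframe V₃ α β a₁ a₂) {s : Pairs → k}
    (hs : s ∈ formsVanishingOn V₃) {c : Fin 5 → k} (hc : c ∈ V₃) (y : Fin 5 → k) :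
    altForm s c y = (α ⬝ᵥ y) * altForm s c a₁ + (β ⬝ᵥ y) * altForm s c a₂ := by
  have := hs c hc _ (h.decomp y)
  rw [altForm_sub_right, altForm_sub_right, altForm_smul_right, altForm_smul_right] at this
  linear_combination this

theorem altForm_of_mem_right (h : IsCoframe V₃ α β a₁ a₂) {s : Pairs → k}
    (hs : s ∈ formsVanishingOn V₃) (x : Fin 5 → k) {d : Fin 5 → k} (hd : d ∈ V₃) :
    altForm s x d = (α ⬝ᵥ x) * altForm s a₁ d + (β ⬝ᵥ x) * altForm s a₂ d := by
  rw [altForm_swap, h.altForm_of_mem_left hs hd, altForm_swap s d, altForm_swap s d]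
  ring

/-- Such a form descends to the plane `V / V₃`, which carries only one alternating form up to
scalars. -/
theorem eq_smul_wedge (h : IsCoframe V₃ α β a₁ a₂) {s : Pairs → k} (hs : s ∈ formsWithKernel V₃) :
    s = altForm s a₁ a₂ • wedge α β := by
  refine altForm_ext fun x y ↦ ?_
  rw [altForm_smul, altForm_wedge]
  have h1 := hs _ (h.decomp x) y
  rw [altForm_sub_left, altForm_sub_left, altForm_smul_left, altForm_smul_left] at h1
  have h2 := hs _ (h.decomp y) a₁
  rw [altForm_sub_left, altForm_sub_left, altForm_smul_left, altForm_smul_left, altForm_self] at h2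
  have h3 := hs _ (h.decomp y) a₂
  rw [altForm_sub_left, altForm_sub_left, altForm_smul_left, altForm_smul_left, altForm_self] at h3
  rw [altForm_swap s y] at h2 h3
  rw [altForm_swap s a₂ a₁] at h2
  linear_combination h1 - (α ⬝ᵥ x) * h2 - (β ⬝ᵥ x) * h3

theorem wedge_mem (h : IsCoframe V₃ α β a₁ a₂) : wedge α β ∈ formsWithKernel V₃ := by
  intro x hx y
  rw [altForm_wedge, h.left_vanish x hx, h.right_vanish x hx]
  ring

theorem wedge_left_mem (h : IsCoframe V₃ α β a₁ a₂) (γ : Fin 5 → k) :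
    wedge α γ ∈ formsVanishingOn V₃ := by
  intro x hx y hy
  rw [altForm_wedge, h.left_vanish x hx, h.left_vanish y hy]
  ring

theorem wedge_right_mem (h : IsCoframe V₃ α β a₁ a₂) (γ : Fin 5 → k) :
    wedge β γ ∈ formsVanishingOn V₃ := by
  intro x hx y hy
  rw [altForm_wedge, h.right_vanish x hx, h.right_vanish y hy]
  ring

theorem altForm_wedge_self (h : IsCoframe V₃ α β a₁ a₂) : altForm (wedge α β) a₁ a₂ = 1 := by
  rw [altForm_wedge, h.left_fst, h.left_snd, h.right_snd]
  ring

/-- The effect on the value at `a₁ ∧ a₂` of a shift of `a₁` and `a₂` by vectors of `V₃`. -/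
theorem exists_shift (h : IsCoframe V₃ α β a₁ a₂) (φ : (Pairs → k) →ₗ[k] k)
    (hφ : φ (wedge α β) = 0) :
    ∃ c ∈ V₃, ∃ d ∈ V₃, ∀ s ∈ formsVanishingOn V₃,
      altForm s c a₂ + altForm s a₁ d = φ s := by
  let E := formsVanishingOn V₃
  let F : V₃ × V₃ →ₗ[k] Module.Dual k E :=
    LinearMap.mk₂ k (fun (cd : V₃ × V₃) (s : E) ↦ altForm s.1 cd.1 a₂ + altForm s.1 a₁ cd.2)
      (fun x x' y ↦ by
        simp only [Prod.fst_add, Prod.snd_add, Submodule.coe_add, altForm_add_left,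
          altForm_add_right]
        ring)
      (fun r x y ↦ by
        simp only [Prod.smul_fst, Prod.smul_snd, Submodule.coe_smul, altForm_smul_left,
          altForm_smul_right, smul_eq_mul]
        ring)
      (fun x y y' ↦ by
        simp only [Submodule.coe_add, altForm_add]
        ring)
      (fun r x y ↦ by
        simp only [Submodule.coe_smul, altForm_smul, smul_eq_mul]
        ring)
  have hF : ∀ (cd : V₃ × V₃) (s : E),
    F cd s = altForm s.1 cd.1 a₂ + altForm s.1 a₁ cd.2 := fun _ _ ↦ rfl
  -- The range of `F` is the annihilator of its common zeros. A form killed by all shifts pairs to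
  -- zero with `V₃` on both sides, hence has `V₃` in its kernel and is a multiple of `α ∧ β`, where
  -- `φ` vanishes.
  have hmem : φ.domRestrict E ∈ LinearMap.range F := by
    rw [← Subspace.dualCoannihilator_dualAnnihilator_eq (W := LinearMap.range F),
      Submodule.mem_dualAnnihilator]
    intro s hs
    rw [Submodule.mem_dualCoannihilator] at hs
    have h1 : ∀ c ∈ V₃, altForm s.1 c a₂ = 0 := fun c hc ↦ by
      have := hs _ ⟨(⟨c, hc⟩, 0), rfl⟩
      rw [hF] at this
      simpa [altForm_zero_right] using this
    have h2 : ∀ d ∈ V₃, altForm s.1 a₁ d = 0 := fun d hd ↦ by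
      have := hs _ ⟨(0, ⟨d, hd⟩), rfl⟩
      rw [hF] at this
      simpa [altForm_zero_left] using this
    have h3 : s.1 ∈ formsWithKernel V₃ := fun x hx y ↦ by
      rw [h.altForm_of_mem_left s.2 hx, h1 x hx, altForm_swap, h2 x hx]
      ring
    rw [LinearMap.domRestrict_apply, h.eq_smul_wedge h3, map_smul, hφ, smul_zero]
  obtain ⟨⟨c, d⟩, hcd⟩ := hmem
  exact ⟨c, c.2, d, d.2, fun s hs ↦ by
    have := LinearMap.congr_fun hcd ⟨s, hs⟩
    rwa [hF] at this⟩

end IsCoframe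

/-- A frame adapted to the projection coordinates `ζ`: the bivector `a₁ ∧ a₂` has coordinates
`(1, 0, …, 0)`, and the infinitesimal shift by `(c i, d i)` increases the `i`-th coordinate. -/
structure IsAdaptedFrame {n : ℕ} (L : Submodule k (Pairs → k)) (V₃ : Submodule k (Fin 5 → k))
    (ζ : Fin (n + 1) → Pairs → k) (α β a₁ a₂ : Fin 5 → k) (c d : Fin n → Fin 5 → k) : Prop where
  isCoframe : IsCoframe V₃ α β a₁ a₂
  zero_eq : ζ 0 = wedge α β
  base_mem : ∀ s ∈ L, altForm s a₁ a₂ = 0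
  base_succ : ∀ j : Fin n, altForm (ζ j.succ) a₁ a₂ = 0
  left_mem : ∀ i, c i ∈ V₃
  right_mem : ∀ i, d i ∈ V₃
  shift_mem : ∀ i, ∀ s ∈ L, altForm s (c i) a₂ + altForm s a₁ (d i) = 0
  shift_succ : ∀ i j : Fin n, altForm (ζ j.succ) (c i) a₂ + altForm (ζ j.succ) a₁ (d i) =
    if i = j then 1 else 0

/-- The `ζ j` remain independent modulo `L`, so their values can be prescribed on the quotient by
`L`. -/
theorem IsProjectionCoordinates.exists_dual {n : ℕ} {L : Submodule k (Pairs → k)}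
    {V₃ : Submodule k (Fin 5 → k)} {ζ : Fin (n + 1) → Pairs → k}
    (h : IsProjectionCoordinates L V₃ ζ) (g : Fin (n + 1) → k) :
    ∃ φ : (Pairs → k) →ₗ[k] k, (∀ s ∈ L, φ s = 0) ∧ ∀ j, φ (ζ j) = g j := by
  have hli : LinearIndependent k (L.mkQ ∘ ζ) :=
    h.linearIndependent.map (by rw [Submodule.ker_mkQ]; exact h.disjoint)
  obtain ⟨φ, hφ⟩ := LinearMap.exists_extend ((Module.Basis.span hli).constr k g)
  refine ⟨φ ∘ₗ L.mkQ, fun s hs ↦ ?_, fun j ↦ ?_⟩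
  · rw [LinearMap.comp_apply, Submodule.mkQ_apply, (Submodule.Quotient.mk_eq_zero L).2 hs, map_zero]
  · have h1 := LinearMap.congr_fun hφ (Module.Basis.span hli j)
    rw [Module.Basis.constr_basis, LinearMap.comp_apply, Submodule.subtype_apply,
      Module.Basis.span_apply] at h1
    exact h1

/-- Rescaling `α` gives `ζ 0 = α ∧ β`. The base point is the bivector on which all forms vanishing
on `V₃` take the values of the functional dual to `ζ 0`, and the directions realize the functionals
dual to the other `ζ j`; both come from `exists_shift`. -/
theorem IsProjectionCoordinates.exists_isAdaptedFrame {n : ℕ} {L : Submodule k (Pairs → k)}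
    {V₃ : Submodule k (Fin 5 → k)} {ζ : Fin (n + 1) → Pairs → k} (hV : Module.finrank k V₃ = 3)
    (h : IsProjectionCoordinates L V₃ ζ) :
    ∃ α β a₁ a₂ c d, IsAdaptedFrame L V₃ ζ α β a₁ a₂ c d := by
  obtain ⟨α', β, a₁', a₂', hf'⟩ := exists_isCoframe V₃ hV
  have hL : L ≤ formsVanishingOn V₃ := h.sup_eq ▸ le_sup_right
  have hζ : ∀ j, ζ j ∈ formsVanishingOn V₃ := fun j ↦ h.sup_eq ▸
    Submodule.mem_sup_left (Submodule.subset_span ⟨j, rfl⟩)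
  have h0 : ζ 0 ∈ formsWithKernel V₃ := h.span_zero ▸ Submodule.mem_span_singleton_self _
  have hr : altForm (ζ 0) a₁' a₂' ≠ 0 := fun h1 ↦ h.linearIndependent.ne_zero 0 (by
    rw [hf'.eq_smul_wedge h0, h1, zero_smul])
  have hf := hf'.scale hr
  have hz : ζ 0 = wedge (altForm (ζ 0) a₁' a₂' • α') β := by
    conv_lhs => rw [hf'.eq_smul_wedge h0]
    funext p
    simp only [wedge, Pi.smul_apply, smul_eq_mul]
    ring
  generalize altForm (ζ 0) a₁' a₂' • α' = α at *
  generalize (altForm (ζ 0) a₁' a₂')⁻¹ • a₁' = a at *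
  obtain ⟨φ, hφL, hφ⟩ := h.exists_dual (Pi.single 0 1)
  let ev : (Pairs → k) →ₗ[k] k := 
    { toFun := fun s ↦ altForm s a a₂'
      map_add' := fun s s' ↦ altForm_add s s' _ _
      map_smul' := fun r s ↦ altForm_smul r s _ _ }
  -- The wanted values minus the current values at `a ∧ a₂'`; the difference vanishes on `α ∧ β = ζ
  -- 0`, where both are 1.
  obtain ⟨c₀, hc₀, d₀, hd₀, h₀⟩ := hf.exists_shift (φ - ev) (by
    rw [LinearMap.sub_apply, ← hz, hφ, Pi.single_eq_same]
    change 1 - altForm (ζ 0) a a₂' = 0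
    rw [hz, hf.altForm_wedge_self, sub_self])
  have hg := hf.shift hc₀ hd₀
  have hval : ∀ s ∈ formsVanishingOn V₃, altForm s (a + c₀) (a₂' + d₀) = φ s := fun s hs ↦ by
    have h1 := h₀ s hs
    rw [LinearMap.sub_apply] at h1
    change _ = φ s - altForm s a a₂' at h1
    -- The term `s(c₀, d₀)` vanishes, so the first-order shift is exact.
    rw [altForm_add_left, altForm_add_right, altForm_add_right, hs c₀ hc₀ d₀ hd₀]
    linear_combination h1
  choose ψ hψL hψ using fun i : Fin n ↦ h.exists_dual (Pi.single i.succ 1)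
  choose c hc d hd hcd using fun i : Fin n ↦ hg.exists_shift (ψ i) (by
    rw [← hz, hψ, Pi.single_eq_of_ne (Fin.succ_ne_zero i).symm])
  refine ⟨α, β, _, _, c, d, hg, hz, fun s hs ↦ ?_, fun j ↦ ?_, hc, hd, fun i s hs ↦ ?_,
    fun i j ↦ ?_⟩
  · rw [hval s (hL hs), hφL s hs]
  · rw [hval _ (hζ _), hφ, Pi.single_eq_of_ne (Fin.succ_ne_zero j)]
  · rw [hcd i s (hL hs), hψL i s hs]
  · rw [hcd i _ (hζ _), hψ, Pi.single_apply]
    simp [eq_comm]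

end Frames

/-! ### Representations by commuting matrices of square zero -/

section Representation

variable {k : Type u} [Field k] {R : Type u} [CommRing R] {n : ℕ}

/-- The matrix `1 + ∑ t_l M_l`. -/
def linMat {m : ℕ} (φ : k →+* R) (M : Fin n → Matrix (Fin m) (Fin m) k) (t : Fin n → R) :
    Matrix (Fin m) (Fin m) R :=
  1 + ∑ l, t l • (M l).map φ

theorem linMat_apply {m : ℕ} (φ : k →+* R) (M : Fin n → Matrix (Fin m) (Fin m) k) (t : Fin n → R)
    (a i : Fin m) :
    linMat φ M t a i = (1 : Matrix (Fin m) (Fin m) R) a i + ∑ l, t l * φ (M l a i) := by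
  simp [linMat, Matrix.add_apply, Matrix.sum_apply]

theorem linMat_zero {m : ℕ} (φ : k →+* R) (M : Fin n → Matrix (Fin m) (Fin m) k) :
    linMat φ M 0 = 1 := by
  simp [linMat]

theorem linMat_map {m : ℕ} {S : Type u} [CommRing S] (φ : k →+* R) (ψ : R →+* S)
    (M : Fin n → Matrix (Fin m) (Fin m) k) (t : Fin n → R) :
    (linMat φ M t).map ψ = linMat (ψ.comp φ) M fun l ↦ ψ (t l) := by
  ext a i
  rw [Matrix.map_apply, linMat_apply, linMat_apply, map_add, map_sum, Matrix.one_apply,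
    Matrix.one_apply]
  split_ifs <;> simp

theorem sum_smul_mul_sum_smul {m : ℕ} (φ : k →+* R) {M : Fin n → Matrix (Fin m) (Fin m) k}
    (hM : ∀ l l', M l * M l' = 0) (t t' : Fin n → R) :
    (∑ l, t l • (M l).map φ) * ∑ l, t' l • (M l).map φ = 0 := by
  rw [Finset.sum_mul_sum]
  refine Finset.sum_eq_zero fun l _ ↦ Finset.sum_eq_zero fun l' _ ↦ ?_
  rw [Matrix.smul_mul, Matrix.mul_smul, ← Matrix.map_mul, hM,
    Matrix.map_zero _ (map_zero φ), smul_zero, smul_zero]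

/-- In `(1 + N)(1 + N')` the product `N N'` is zero, so multiplication becomes addition of
parameters. -/
theorem linMat_mul {m : ℕ} (φ : k →+* R) {M : Fin n → Matrix (Fin m) (Fin m) k}
    (hM : ∀ l l', M l * M l' = 0) (t t' : Fin n → R) :
    linMat φ M t * linMat φ M t' = linMat φ M (t + t') := by
  simp only [linMat, Pi.add_apply, add_smul, Finset.sum_add_distrib]
  rw [mul_add, add_mul, add_mul, sum_smul_mul_sum_smul φ hM]
  simp only [one_mul, mul_one, add_zero]
  abel

/-- The representation `t ↦ 1 + ∑ t_l M_l`. -/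
noncomputable def squareZeroRep {m : ℕ} (M : Fin n → Matrix (Fin m) (Fin m) k)
    (hM : ∀ l l', M l * M l' = 0) : VectorGroupRep k n m where
  mat := linMat MvPolynomial.C M MvPolynomial.X
  map_zero := by
    rw [linMat_map]
    simp only [MvPolynomial.eval_X]
    exact linMat_zero _ M
  map_add := by
    have h1 : ∀ {σ τ : Type} (f : MvPolynomial σ k →ₐ[k] MvPolynomial τ k)
        (t : Fin n → MvPolynomial σ k),
        (linMat MvPolynomial.C M t).map f = linMat MvPolynomial.C M fun l ↦ f (t l) := by
      intro σ τ f t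
      refine (linMat_map MvPolynomial.C f.toRingHom M t).trans ?_
      congr 1
      exact RingHom.ext fun c ↦ f.commutes c
    rw [h1, h1, h1, linMat_mul _ hM]
    simp only [MvPolynomial.aeval_X, MvPolynomial.rename_X]
    rfl

theorem squareZeroRep_isUnipotent {m : ℕ} (M : Fin n → Matrix (Fin m) (Fin m) k)
    (hM : ∀ l l', M l * M l' = 0) : (squareZeroRep M hM).IsUnipotent := by
  refine ⟨2, ?_⟩
  rw [sq]
  change (linMat MvPolynomial.C M MvPolynomial.X - 1) *
    (linMat MvPolynomial.C M MvPolynomial.X - 1) = 0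
  rw [linMat, add_sub_cancel_left, sum_smul_mul_sum_smul _ hM]

theorem squareZeroRep_evalAt {m : ℕ} (M : Fin n → Matrix (Fin m) (Fin m) k)
    (hM : ∀ l l', M l * M l' = 0) {T : Over (Spec (.of k))} (t : T ⟶ vectorGroup k n) :
    (squareZeroRep M hM).evalAt t = linMat (scalars T) M (coords t) := by
  refine (linMat_map MvPolynomial.C _ M _).trans ?_
  congr 1
  · exact RingHom.ext fun c ↦ by simp
  · funext l; simp

end Representation

/-! ### The shifts `x ↦ x + α(x) c + β(x) d` and their effect on the forms vanishing on `V₃` -/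

section ShiftMatrix

variable {k : Type u} [Field k] {R : Type u} [CommRing R]

/-- The value of a form at a bivector. -/
def pairing (φ : k →+* R) (s : Pairs → k) : (Pairs → R) →ₗ[R] R where
  toFun w := ∑ p, φ (s p) * w p
  map_add' w w' := by simp [mul_add, Finset.sum_add_distrib]
  map_smul' c w := by simp [Finset.mul_sum, mul_left_comm]

theorem pairing_apply (φ : k →+* R) (s : Pairs → k) (w : Pairs → R) :
    pairing φ s w = ∑ p, φ (s p) * w p := rfl

theorem pairing_mul (φ : k →+* R) (s : Pairs → k) (c : R) (w : Pairs → R) :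
    pairing φ s (fun p ↦ c * w p) = c * pairing φ s w :=
  map_smul (pairing φ s) c w

theorem pairing_wedge (φ : k →+* R) (s : Pairs → k) (x y : Fin 5 → R) :
    pairing φ s (wedge x y) = form φ s x y := rfl

theorem pairing_add (φ : k →+* R) (s s' : Pairs → k) (w : Pairs → R) :
    pairing φ (s + s') w = pairing φ s w + pairing φ s' w := by
  simp [pairing_apply, add_mul, Finset.sum_add_distrib]

theorem pairing_smul (φ : k →+* R) (c : k) (s : Pairs → k) (w : Pairs → R) :
    pairing φ (c • s) w = φ c * pairing φ s w := by
  simp [pairing_apply, Finset.mul_sum, mul_assoc]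

theorem map_pairing {S : Type u} [CommRing S] (φ : k →+* R) (ψ : R →+* S) (s : Pairs → k)
    (w : Pairs → R) : ψ (pairing φ s w) = pairing (ψ.comp φ) s fun p ↦ ψ (w p) := by
  simp [pairing_apply]

/-- The matrix, acting from the right, of the map `x ↦ α(x) c + β(x) d`. -/
def shiftMatrix (α β c d : Fin 5 → k) : Matrix (Fin 5) (Fin 5) k :=
  Matrix.of fun a ↦ α a • c + β a • d

theorem shiftMatrix_apply (α β c d : Fin 5 → k) (a : Fin 5) :
    shiftMatrix α β c d a = α a • c + β a • d := rfl

namespace IsCoframe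

variable {V₃ : Submodule k (Fin 5 → k)} {α β a₁ a₂ : Fin 5 → k}

/-- The image of the first map lies in `V₃`, where `α` and `β` vanish. -/
theorem shiftMatrix_mul (h : IsCoframe V₃ α β a₁ a₂) {c d c' d' : Fin 5 → k} (hc : c ∈ V₃)
    (hd : d ∈ V₃) : shiftMatrix α β c d * shiftMatrix α β c' d' = 0 := by
  have h1 := h.left_vanish c hc
  have h2 := h.left_vanish d hd
  have h3 := h.right_vanish c hc
  have h4 := h.right_vanish d hd
  ext a i
  simp only [dotProduct, Fin.sum_univ_five] at h1 h2 h3 h4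
  simp only [Matrix.mul_apply, Matrix.zero_apply, shiftMatrix_apply, Fin.sum_univ_five,
    Pi.add_apply, Pi.smul_apply, smul_eq_mul]
  linear_combination α a * c' i * h1 + β a * c' i * h2 + α a * d' i * h3 + β a * d' i * h4

theorem shiftMatrix_mem {c d : Fin 5 → k} (hc : c ∈ V₃) (hd : d ∈ V₃) (a : Fin 5) :
    shiftMatrix α β c d a ∈ V₃ :=
  add_mem (V₃.smul_mem _ hc) (V₃.smul_mem _ hd)

/-- The first-order variation of `s` under the shift is an alternating form with `V₃` in its kernel,
hence a multiple of `α ∧ β`; the factor is its value at `a₁ ∧ a₂`. -/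
theorem altForm_shiftMatrix (h : IsCoframe V₃ α β a₁ a₂) {s : Pairs → k}
    (hs : s ∈ formsVanishingOn V₃) {c d : Fin 5 → k} (hc : c ∈ V₃) (hd : d ∈ V₃) (q : Pairs) :
    altForm s (shiftMatrix α β c d q.1.1) (Pi.single q.1.2 1) +
        altForm s (Pi.single q.1.1 1) (shiftMatrix α β c d q.1.2) =
      (altForm s c a₂ + altForm s a₁ d) * wedge α β q := by
  simp only [shiftMatrix_apply, altForm_add_left, altForm_add_right, altForm_smul_left,
    altForm_smul_right, h.altForm_of_mem_left hs hc (Pi.single q.1.2 1),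
    h.altForm_of_mem_left hs hd (Pi.single q.1.2 1),
    h.altForm_of_mem_right hs (Pi.single q.1.1 1) hc,
    h.altForm_of_mem_right hs (Pi.single q.1.1 1) hd, dotProduct_single_one, wedge]
  rw [altForm_swap s c a₁, altForm_swap s d a₁, altForm_swap s d a₂, altForm_swap s c a₂]
  ring

/-- This is the formula behind both the invariance of `X_L` and the toric action: `s` changes by a
multiple of `α ∧ β` that is linear in `t`. -/
theorem pairing_wedgeAct (h : IsCoframe V₃ α β a₁ a₂) (φ : k →+* R) {s : Pairs → k}
    (hs : s ∈ formsVanishingOn V₃) {n : ℕ} {c d : Fin n → Fin 5 → k} (hc : ∀ l, c l ∈ V₃)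
    (hd : ∀ l, d l ∈ V₃) (t : Fin n → R) (w : Pairs → R) :
    pairing φ s (wedgeAct (linMat φ (fun l ↦ shiftMatrix α β (c l) (d l)) t) w) =
      pairing φ s w + (∑ l, t l * φ (altForm s (c l) a₂ + altForm s a₁ (d l))) *
        pairing φ (wedge α β) w := by
  set M := fun l ↦ shiftMatrix α β (c l) (d l) with hM
  set A := linMat φ M t with hA
  set r := ∑ l, t l * φ (altForm s (c l) a₂ + altForm s a₁ (d l))
  have key : pairing φ s ∘ₗ wedgeActLin A = pairing φ s + r • pairing φ (wedge α β) := by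
    refine (Pi.basisFun R Pairs).ext fun q ↦ ?_
    rw [Pi.basisFun_apply, LinearMap.comp_apply, LinearMap.add_apply, LinearMap.smul_apply,
      ← wedge_single]
    change pairing φ s (wedgeAct A _) = _
    have hrow : ∀ a, (fun i ↦ ∑ b, A b i * (Pi.single a (1 : R) : Fin 5 → R) b) =
        (fun i ↦ φ ((Pi.single a (1 : k) : Fin 5 → k) i)) +
          ∑ l, t l • (fun i ↦ φ (M l a i) : Fin 5 → R) := by
      intro a
      funext i
      rw [Finset.sum_eq_single a (fun b _ hb ↦ by rw [Pi.single_eq_of_ne hb, mul_zero])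
        (by simp), Pi.single_eq_same, mul_one, hA, linMat_apply]
      simp only [Pi.add_apply, Finset.sum_apply, Pi.smul_apply, smul_eq_mul, Pi.single_apply,
        Matrix.one_apply, apply_ite φ, map_one, map_zero, eq_comm]
    have hsingle : ∀ a, (Pi.single a (1 : R) : Fin 5 → R) =
        fun i ↦ φ ((Pi.single a (1 : k) : Fin 5 → k) i) := by
      intro a
      funext i
      simp only [Pi.single_apply, apply_ite φ, map_one, map_zero]
    rw [wedgeAct_wedge, hrow, hrow, pairing_wedge, pairing_wedge, pairing_wedge, hsingle, hsingle]
    simp only [map_add, LinearMap.add_apply, map_sum, LinearMap.sum_apply, map_smul,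
      LinearMap.smul_apply, form_map, smul_eq_mul]
    -- There is no term of second order, because both arguments lie in `V₃`.
    have h0 : ∀ l l', altForm s (M l q.1.1) (M l' q.1.2) = 0 := fun l l' ↦
      hs _ (shiftMatrix_mem (hc l) (hd l) _) _ (shiftMatrix_mem (hc l') (hd l') _)
    simp only [h0, map_zero, mul_zero, Finset.sum_const_zero, add_zero, altForm_single, r,
      Finset.sum_mul]
    rw [add_assoc, ← Finset.sum_add_distrib]
    congr 1
    refine Finset.sum_congr rfl fun l _ ↦ ?_
    rw [mul_assoc, ← map_mul, ← h.altForm_shiftMatrix hs (hc l) (hd l) q, map_add]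
    ring
  exact LinearMap.congr_fun key w

/-- A point of the Grassmannian is determined by the values of the forms vanishing on `V₃`, if it
is not in the hyperplane `α ∧ β = 0`. -/
theorem eq_wedge_of_pairing (h : IsCoframe V₃ α β a₁ a₂) (φ : k →+* R) {w : Pairs → R}
    (hw : IsPlucker w)
    (hs : ∀ s ∈ formsVanishingOn V₃, pairing φ s w = φ (altForm s a₁ a₂)) :
    w = wedge (fun i ↦ φ (a₁ i)) (fun i ↦ φ (a₂ i)) := by
  have hpair : ∀ γ δ : Fin 5 → k, ∑ q, wedge (fun i ↦ φ (γ i)) (fun i ↦ φ (δ i)) q * w q =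
      pairing φ (wedge γ δ) w := fun γ δ ↦ by
    rw [pairing_apply]
    exact Finset.sum_congr rfl fun q _ ↦ by rw [map_wedge]
  have hrow : ∀ (γ : Fin 5 → k) (a : Fin 5), ∑ i, φ (γ i) * skew w i a =
      pairing φ (wedge γ (Pi.single a 1)) w := by
    intro γ a
    rw [← hpair]
    have := sum_pairs_skew w fun i j ↦ φ (γ i) * φ ((Pi.single a (1 : k) : Fin 5 → k) j)
    simp only [wedge]
    refine Eq.trans ?_ this.symm
    refine Finset.sum_congr rfl fun i _ ↦ ?_
    simp [Pi.single_apply]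
  funext p
  -- As `(α ∧ β)(w) = 1`, the bivector is the wedge of its contractions with `α` and `β`. Their
  -- entries are the values of `α ∧ e_a^∨` and `β ∧ e_a^∨`, which vanish on `V₃`, so they are known;
  -- they turn out to be `a₂` and `-a₁`.
  have h1 := hw.contract (fun i ↦ φ (α i)) (fun i ↦ φ (β i)) p
  have hmem : wedge α β ∈ formsVanishingOn V₃ := h.wedge_left_mem β
  rw [hpair, hs _ hmem, h.altForm_wedge_self, map_one, one_mul] at h1
  rw [h1]
  have hα : (fun a ↦ ∑ i, φ (α i) * skew w i a) = fun a ↦ φ (a₂ a) := by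
    funext a
    rw [hrow, hs _ (h.wedge_left_mem _), altForm_wedge, h.left_fst, h.left_snd]
    simp
  have hβ : (fun a ↦ ∑ i, φ (β i) * skew w i a) = fun a ↦ - φ (a₁ a) := by
    funext a
    rw [hrow, hs _ (h.wedge_right_mem _), altForm_wedge, h.right_fst, h.right_snd]
    simp
  rw [hα, hβ]
  simp only [wedge]
  ring

end IsCoframe

end ShiftMatrix

/-! ### Points of linear sections -/

section SectionPoints

variable {k : Type u} [Field k]

/-- The homogeneous coordinates `w` satisfy the equations of the linear section. -/
def IsSectionPoint {R : Type u} [CommRing R] (φ : k →+* R) (L : Submodule k (Pairs → k))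
    (w : Pairs → R) : Prop :=
  IsPlucker w ∧ ∀ s ∈ L, pairing φ s w = 0

theorem IsSectionPoint.map {R S : Type u} [CommRing R] [CommRing S] {φ : k →+* R}
    {L : Submodule k (Pairs → k)} {w : Pairs → R} (h : IsSectionPoint φ L w) (ψ : R →+* S) :
    IsSectionPoint (ψ.comp φ) L fun p ↦ ψ (w p) := by
  refine ⟨fun i j l m hij hjl hlm ↦ ?_, fun s hs ↦ ?_⟩
  · rw [← map_mul, ← map_mul, ← map_mul, ← map_sub, ← map_add, h.1, map_zero]
  · rw [← map_pairing, h.2 s hs, map_zero]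

variable {T : Over (Spec (.of k))} {L : Submodule k (Pairs → k)}

theorem eval₂Hom_linForm {R : Type u} [CommRing R] (φ : k →+* R) (s : Pairs → k) (w : Pairs → R) :
    MvPolynomial.eval₂Hom φ w (linForm s) = pairing φ s w := by
  simp [linForm, pairing_apply]

theorem linForm_mem (s : Pairs → k) :
    linForm s ∈ MvPolynomial.homogeneousSubmodule Pairs k 1 :=
  sum_mem fun p _ ↦ (MvPolynomial.isHomogeneous_X k p).C_mul (s p)

theorem pluckerQuadric_mem (i j l m : Fin 5) (hij : i < j) (hjl : j < l) (hlm : l < m) :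
    pluckerQuadric k i j l m hij hjl hlm ∈ MvPolynomial.homogeneousSubmodule Pairs k 2 := by
  have h : ∀ p q : Pairs, (MvPolynomial.X p * MvPolynomial.X q : MvPolynomial Pairs k) ∈
      MvPolynomial.homogeneousSubmodule Pairs k 2 := fun p q ↦
    (MvPolynomial.isHomogeneous_X k p).mul (MvPolynomial.isHomogeneous_X k q)
  exact add_mem (sub_mem (h _ _) (h _ _)) (h _ _)

theorem IsSectionPoint.eval₂Hom_eq_zero {R : Type u} [CommRing R] {φ : k →+* R} {w : Pairs → R}
    (h : IsSectionPoint φ L w) {f : MvPolynomial Pairs k} (hf : f ∈ (sectionIdeal L).toIdeal) :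
    MvPolynomial.eval₂Hom φ w f = 0 := by
  have hle : (sectionIdeal L).toIdeal ≤ RingHom.ker (MvPolynomial.eval₂Hom φ w) := by
    refine Ideal.span_le.mpr ?_
    rintro f (⟨i, j, l, m, hij, hjl, hlm, rfl⟩ | ⟨s, hs, rfl⟩)
    · have := h.1 i j l m hij hjl hlm
      simpa [RingHom.mem_ker, pluckerQuadric] using this
    · rw [SetLike.mem_coe, RingHom.mem_ker, eval₂Hom_linForm, h.2 s hs]
  exact hle hf

theorem exists_hasCoords_linearSection {w : Pairs → Γ(T.left, ⊤)}
    (hw : Ideal.span (Set.range w) = ⊤) (h : IsSectionPoint (scalars T) L w) :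
    ∃ x : T ⟶ linearSection L, HasCoords T (x.left ≫ linearSectionEmb L) w := by
  obtain ⟨x, hx⟩ := exists_comp_projSubschemeEmb_eq (sectionIdeal L) w hw
    fun f hf ↦ h.eval₂Hom_eq_zero hf
  exact ⟨x, hw, hx⟩

theorem HasCoords.isSectionPoint {x : T.left ⟶ (linearSection L).left} {w : Pairs → Γ(T.left, ⊤)}
    (h : HasCoords T (x ≫ linearSectionEmb L) w) : IsSectionPoint (scalars T) L w := by
  obtain ⟨hw, hx⟩ := h
  refine ⟨fun i j l m hij hjl hlm ↦ ?_, fun s hs ↦ ?_⟩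
  · have := eval₂Hom_eq_zero_of_comp_eq (sectionIdeal L) x w hw hx
      (Ideal.subset_span (Or.inl ⟨i, j, l, m, hij, hjl, hlm, rfl⟩))
      (pluckerQuadric_mem i j l m hij hjl hlm)
    simpa [pluckerQuadric] using this
  · rw [← eval₂Hom_linForm]
    exact eval₂Hom_eq_zero_of_comp_eq (sectionIdeal L) x w hw hx
      (Ideal.subset_span (Or.inr ⟨s, hs, rfl⟩)) (linForm_mem s)

instance mono_linearSectionEmb : Mono (linearSectionEmb L) :=
  mono_projSubschemeEmb (sectionIdeal L)

theorem linearSectionEmb_over :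
    linearSectionEmb L ≫ pspaceToSpec Pairs k = (linearSection L).hom :=
  projSubschemeEmb_over (sectionIdeal L)

theorem point_over (x : T ⟶ linearSection L) :
    (x.left ≫ linearSectionEmb L) ≫ pspaceToSpec Pairs k = T.hom := by
  rw [Category.assoc, linearSectionEmb_over, Over.w]

theorem HasCoords.preimage_nonvanishing {x : T.left ⟶ (linearSection L).left}
    {w : Pairs → Γ(T.left, ⊤)} (h : HasCoords T (x ≫ linearSectionEmb L) w) (s : Pairs → k) :
    x ⁻¹ᵁ nonvanishing L s = T.left.basicOpen (pairing (scalars T) s w) := by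
  rw [← eval₂Hom_linForm]
  exact h.preimage_basicOpen one_pos (linForm_mem s)

/-- A morphism to the linear section is determined by homogeneous coordinates. -/
theorem linearSection_hom_ext (x : T ⟶ linearSection L) {y y' : T ⟶ linearSection L}
    (h : ∀ {T' : Over (Spec (.of k))} (f : T' ⟶ T) (w : Pairs → Γ(T'.left, ⊤)),
      HasCoords T' ((f ≫ x).left ≫ linearSectionEmb L) w →
        ∃ w', HasCoords T' ((f ≫ y).left ≫ linearSectionEmb L) w' ∧
          HasCoords T' ((f ≫ y').left ≫ linearSectionEmb L) w') : y = y' := by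
  refine over_hom_ext_of_forall fun t ↦ ?_
  obtain ⟨O, ht, -, w, hw⟩ := exists_open_hasCoords _ (point_over x) ⊤ t trivial
  obtain ⟨w', h1, h2⟩ := h (openSubι T O) w (by simpa using hw)
  refine ⟨O, ht, ?_⟩
  ext1
  rw [← cancel_mono (linearSectionEmb L)]
  exact h1.hom_ext h2

end SectionPoints

/-! ### Points of vector groups -/

section VectorGroup

variable {k : Type u} [Field k] {n : ℕ} {T T' : Over (Spec (.of k))}

theorem coords_comp (f : T' ⟶ T) (t : T ⟶ vectorGroup k n) :
    coords (f ≫ t) = fun i ↦ pull f (coords t i) :=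
  funext fun i ↦ congrArg (fun φ ↦ φ.hom (AffineSpace.coord (Spec (.of k)) ⟨i⟩))
    (Scheme.Hom.comp_appTop f.left t.left)

theorem coords_injective : Function.Injective (coords (k := k) (n := n) (T := T)) :=
  (coordsEquiv (k := k) (n := n) (T := T)).injective

theorem exists_coords_eq (v : Fin n → Γ(T.left, ⊤)) : ∃ t : T ⟶ vectorGroup k n, coords t = v :=
  ⟨coordsEquiv.symm (.ofAdd v),
    (coordsEquiv (k := k) (n := n) (T := T)).apply_symm_apply (.ofAdd v)⟩

theorem coords_one (f : T ⟶ 𝟙_ (Over (Spec (.of k)))) :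
    coords (f ≫ MonObj.one (X := vectorGroup k n)) = 0 := by
  rw [coords_comp]
  have h : coords (MonObj.one (X := vectorGroup k n)) = 0 :=
    (coordsEquiv (k := k) (n := n) (T := 𝟙_ (Over (Spec (.of k))))).apply_symm_apply 1
  rw [h]
  funext i
  exact map_zero (pull f)

theorem coords_mul (t : T ⟶ vectorGroup k n ⊗ vectorGroup k n) :
    coords (t ≫ MonObj.mul (X := vectorGroup k n)) =
      coords (t ≫ fst _ _) + coords (t ≫ snd _ _) := by
  rw [coords_comp, coords_comp, coords_comp]
  have h : coords (MonObj.mul (X := vectorGroup k n)) =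
      coords (fst (vectorGroup k n) (vectorGroup k n)) + coords (snd _ _) :=
    (coordsEquiv (k := k) (n := n) (T := vectorGroup k n ⊗ vectorGroup k n)).apply_symm_apply
      (coordsEquiv (fst _ _) * coordsEquiv (snd _ _))
  rw [h]
  funext i
  exact map_add (pull t) _ _

end VectorGroup

/-! ### The action of a vector group on a linear section -/

/-- An action on generalized points, natural in the point, is an action of the monoid object. -/
@[reducible]
def modObjOfPoints {C : Type*} [Category C] [CartesianMonoidalCategory C] {G X : C} [MonObj G]
    (act : ∀ {T : C}, (T ⟶ G) → (T ⟶ X) → (T ⟶ X))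
    (hnat : ∀ {T T' : C} (f : T' ⟶ T) (t : T ⟶ G) (x : T ⟶ X), f ≫ act t x = act (f ≫ t) (f ≫ x))
    (hone : ∀ {T : C} (x : T ⟶ X), act (toUnit T ≫ MonObj.one) x = x)
    (hmul : ∀ {T : C} (t t' : T ⟶ G) (x : T ⟶ X),
      act (lift t t' ≫ MonObj.mul) x = act t (act t' x)) : ModObj G X where
  smul := act (fst _ _) (snd _ _)
  one_smul := by
    refine (hnat _ _ _).trans ?_
    have h : (MonObj.one (X := G) ▷ X ≫ fst G X) = toUnit _ ≫ MonObj.one := by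
      rw [whiskerRight_fst, toUnit_unique (fst _ _) (toUnit _)]
    change act (MonObj.one (X := G) ▷ X ≫ fst G X) (MonObj.one (X := G) ▷ X ≫ snd G X) = (λ_ X).hom
    rw [h, hone, whiskerRight_snd, leftUnitor_hom]
  mul_smul := by
    change MonObj.mul (X := G) ▷ X ≫ act (fst _ _) (snd _ _) =
      (α_ G G X).hom ≫ G ◁ act (fst _ _) (snd _ _) ≫ act (fst _ _) (snd _ _)
    rw [hnat, hnat, hnat, whiskerRight_fst, whiskerRight_snd, whiskerLeft_fst, whiskerLeft_snd,
      hnat, hnat]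
    rw [← hmul, associator_hom_fst, associator_hom_snd_fst, associator_hom_snd_snd, ← comp_lift,
      lift_fst_snd, Category.comp_id]

section Action

variable {k : Type u} [Field k] {n : ℕ} {L : Submodule k (Pairs → k)}

/-- The matrices `M l` have product zero, and `1 + ∑ t_l M_l` preserves the values of the
forms in `L`. -/
structure IsInfinitesimalAction (L : Submodule k (Pairs → k))
    (M : Fin n → Matrix (Fin 5) (Fin 5) k) : Prop where
  mul_eq_zero : ∀ l l', M l * M l' = 0
  pairing_eq : ∀ {R : Type u} [CommRing R] (φ : k →+* R) (t : Fin n → R) (w : Pairs → R),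
    ∀ s ∈ L, pairing φ s (wedgeAct (linMat φ M t) w) = pairing φ s w

variable {M : Fin n → Matrix (Fin 5) (Fin 5) k}

theorem IsInfinitesimalAction.isSectionPoint (hM : IsInfinitesimalAction L M) {R : Type u}
    [CommRing R] {φ : k →+* R} {w : Pairs → R} (hw : Ideal.span (Set.range w) = ⊤)
    (h : IsSectionPoint φ L w) (t : Fin n → R) :
    IsSectionPoint φ L (wedgeAct (linMat φ M t) w) :=
  ⟨isPlucker_wedgeAct hw h.1 _, fun s hs ↦ by rw [hM.pairing_eq φ t w s hs, h.2 s hs]⟩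

theorem IsInfinitesimalAction.span_eq_top (hM : IsInfinitesimalAction L M) {R : Type u}
    [CommRing R] (φ : k →+* R) {w : Pairs → R} (hw : Ideal.span (Set.range w) = ⊤)
    (t : Fin n → R) : Ideal.span (Set.range (wedgeAct (linMat φ M t) w)) = ⊤ := by
  refine span_wedgeAct hw (B := linMat φ M (-t)) ?_
  rw [linMat_mul φ hM.mul_eq_zero, add_neg_cancel, linMat_zero]

theorem map_wedgeAct_linMat {T T' : Over (Spec (.of k))} (f : T' ⟶ T) (t : T ⟶ vectorGroup k n)
    (w : Pairs → Γ(T.left, ⊤)) :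
    wedgeAct (linMat (scalars T') M (coords (f ≫ t))) (fun p ↦ pull f (w p)) =
      fun p ↦ pull f (wedgeAct (linMat (scalars T) M (coords t)) w p) := by
  funext p
  rw [map_wedgeAct, linMat_map, pull_comp_scalars, coords_comp]

/-- The characterization quantifies over all base changes `f`, since `x` itself may have no global
coordinates. -/
theorem IsInfinitesimalAction.exists_act (hM : IsInfinitesimalAction L M) {T : Over (Spec (.of k))}
    (t : T ⟶ vectorGroup k n)
    (x : T ⟶ linearSection L) :
    ∃ y : T ⟶ linearSection L, ∀ {T' : Over (Spec (.of k))} (f : T' ⟶ T)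
      (w : Pairs → Γ(T'.left, ⊤)), HasCoords T' ((f ≫ x).left ≫ linearSectionEmb L) w →
        HasCoords T' ((f ≫ y).left ≫ linearSectionEmb L)
          (wedgeAct (linMat (scalars T') M (coords (f ≫ t))) w) := by
  obtain ⟨y, hy⟩ := exists_hom_of_operator (x.left ≫ linearSectionEmb L) (point_over x)
    (linearSectionEmb L) (fun {T'} f w ↦ wedgeAct (linMat (scalars T') M (coords (f ≫ t))) w)
    (fun f g w ↦ by
      rw [Category.assoc]
      exact map_wedgeAct_linMat g (f ≫ t) w)
    (fun f w c ↦ wedgeAct_mul _ c w)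
    (fun f w hw ↦ by
      have h1 : HasCoords _ ((f ≫ x).left ≫ linearSectionEmb L) w := by simpa using hw
      exact exists_hasCoords_linearSection (hM.span_eq_top _ h1.1 _)
        (hM.isSectionPoint h1.1 h1.isSectionPoint _))
  exact ⟨y, fun f w hw ↦ hy f w (by simpa using hw)⟩

variable (hM : IsInfinitesimalAction L M)

/-- The action on points of the linear section. -/
noncomputable def IsInfinitesimalAction.act {T : Over (Spec (.of k))} (t : T ⟶ vectorGroup k n)
    (x : T ⟶ linearSection L) : T ⟶ linearSection L :=
  (hM.exists_act t x).choose

theorem IsInfinitesimalAction.comp_act_coords {T T' : Over (Spec (.of k))}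
    (t : T ⟶ vectorGroup k n) (x : T ⟶ linearSection L) (f : T' ⟶ T)
    {w : Pairs → Γ(T'.left, ⊤)} (hw : HasCoords T' ((f ≫ x).left ≫ linearSectionEmb L) w) :
    HasCoords T' ((f ≫ hM.act t x).left ≫ linearSectionEmb L)
      (wedgeAct (linMat (scalars T') M (coords (f ≫ t))) w) :=
  (hM.exists_act t x).choose_spec f w hw

theorem IsInfinitesimalAction.act_coords {T : Over (Spec (.of k))}
    (t : T ⟶ vectorGroup k n) (x : T ⟶ linearSection L)
    {w : Pairs → Γ(T.left, ⊤)} (hw : HasCoords T (x.left ≫ linearSectionEmb L) w) :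
    HasCoords T ((hM.act t x).left ≫ linearSectionEmb L)
      (wedgeAct (linMat (scalars T) M (coords t)) w) := by
  have := hM.comp_act_coords t x (𝟙 T) (w := w) (by simpa using hw)
  simpa using this

theorem IsInfinitesimalAction.comp_act {T T' : Over (Spec (.of k))}
    (t : T ⟶ vectorGroup k n) (x : T ⟶ linearSection L) (f : T' ⟶ T) :
    f ≫ hM.act t x = hM.act (f ≫ t) (f ≫ x) := by
  refine linearSection_hom_ext (f ≫ x) fun g w hw ↦ ⟨_, ?_, hM.comp_act_coords _ _ g hw⟩
  have := hM.comp_act_coords t x (g ≫ f) (w := w) (by simpa using hw)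
  simpa using this

theorem IsInfinitesimalAction.act_of_coords_eq_zero {T : Over (Spec (.of k))}
    (t : T ⟶ vectorGroup k n) (ht : coords t = 0) (x : T ⟶ linearSection L) :
    hM.act t x = x := by
  refine linearSection_hom_ext x fun f w hw ↦ ⟨_, hM.comp_act_coords _ _ f hw, ?_⟩
  have h0 : coords (f ≫ t) = 0 := by
    rw [coords_comp, ht]
    funext i
    exact map_zero (pull f)
  rw [h0, linMat_zero, wedgeAct_one]
  exact hw

theorem IsInfinitesimalAction.act_act {T : Over (Spec (.of k))}
    (t t' t'' : T ⟶ vectorGroup k n) (ht : coords t'' = coords t + coords t')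
    (x : T ⟶ linearSection L) : hM.act t'' x = hM.act t (hM.act t' x) := by
  refine linearSection_hom_ext x fun f w hw ↦ ⟨_, hM.comp_act_coords _ _ f hw, ?_⟩
  have h1 := hM.comp_act_coords t _ f (hM.comp_act_coords t' x f hw)
  -- The summands are swapped to match the reversed order in `wedgeAct_wedgeAct`.
  have h0 : coords (f ≫ t'') = coords (f ≫ t') + coords (f ≫ t) := by
    rw [coords_comp, coords_comp, coords_comp, ht]
    funext i
    exact (map_add (pull f) _ _).trans (add_comm _ _)
  rwa [wedgeAct_wedgeAct, linMat_mul _ hM.mul_eq_zero, ← h0] at h1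

/-- The action of the vector group on the linear section. -/
@[reducible]
noncomputable def IsInfinitesimalAction.modObj : ModObj (vectorGroup k n) (linearSection L) :=
  modObjOfPoints (fun t x ↦ hM.act t x) (fun f t x ↦ hM.comp_act t x f)
    (fun x ↦ hM.act_of_coords_eq_zero _ (coords_one _) x)
    (fun t t' x ↦ hM.act_act t t' _ (by
      rw [coords_mul, lift_fst, lift_snd]) x)

theorem IsInfinitesimalAction.smul_eq {T : Over (Spec (.of k))}
    (t : T ⟶ vectorGroup k n) (x : T ⟶ linearSection L) :
    letI := hM.modObj
    t • x = hM.act t x :=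
  (hM.comp_act _ _ _).trans (by rw [lift_fst, lift_snd])

end Action

/-! ### The shifts of an adapted frame -/

/-- The matrices of the maps `x ↦ α(x) c_l + β(x) d_l`. -/
def shifts {k : Type u} [Field k] {n : ℕ} (α β : Fin 5 → k) (c d : Fin n → Fin 5 → k) :
    Fin n → Matrix (Fin 5) (Fin 5) k :=
  fun l ↦ shiftMatrix α β (c l) (d l)

/-- The bivector `a₁ ∧ a₂` over `R`. -/
def baseBivector {k : Type u} [Field k] {R : Type u} [CommRing R] (φ : k →+* R)
    (a₁ a₂ : Fin 5 → k) : Pairs → R :=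
  wedge (fun i ↦ φ (a₁ i)) (fun i ↦ φ (a₂ i))

theorem map_baseBivector {k : Type u} [Field k] {R S : Type u} [CommRing R] [CommRing S]
    (φ : k →+* R) (ψ : R →+* S) (a₁ a₂ : Fin 5 → k) :
    (fun p ↦ ψ (baseBivector φ a₁ a₂ p)) = baseBivector (ψ.comp φ) a₁ a₂ :=
  funext fun p ↦ map_wedge ψ _ _ p

theorem toricAct_mul {R : Type u} [CommRing R] {n : ℕ} (t : Fin n → R) (r : R)
    (z : Fin (n + 1) → R) : toricAct t (fun i ↦ r * z i) = fun i ↦ r * toricAct t z i := by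
  funext i
  refine Fin.cases ?_ (fun j ↦ ?_) i
  · rfl
  · simp only [toricAct, Fin.cons_succ]
    ring

theorem map_toricAct {R S : Type u} [CommRing R] [CommRing S] (ψ : R →+* S) {n : ℕ} (t : Fin n → R)
    (z : Fin (n + 1) → R) (i : Fin (n + 1)) :
    ψ (toricAct t z i) = toricAct (fun j ↦ ψ (t j)) (fun i ↦ ψ (z i)) i := by
  refine Fin.cases ?_ (fun j ↦ ?_) i
  · rfl
  · simp only [toricAct, Fin.cons_succ, map_add, map_mul]

theorem span_toricAct {R : Type u} [CommRing R] {n : ℕ} (t : Fin n → R) {z : Fin (n + 1) → R}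
    (hz : Ideal.span (Set.range z) = ⊤) : Ideal.span (Set.range (toricAct t z)) = ⊤ := by
  rw [eq_top_iff, ← hz, Ideal.span_le]
  have h0 : z 0 ∈ Ideal.span (Set.range (toricAct t z)) := Ideal.subset_span ⟨0, rfl⟩
  rintro _ ⟨i, rfl⟩
  refine Fin.cases h0 (fun j ↦ ?_) i
  have h1 : z j.succ + t j * z 0 ∈ Ideal.span (Set.range (toricAct t z)) :=
    Ideal.subset_span ⟨j.succ, rfl⟩
  have := sub_mem h1 (Ideal.mul_mem_left _ (t j) h0)
  rwa [add_sub_cancel_right] at this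

theorem span_eq_top_of_isUnit {R J : Type*} [CommRing R] {v : J → R} {i : J} (h : IsUnit (v i)) :
    Ideal.span (Set.range v) = ⊤ :=
  Ideal.eq_top_of_isUnit_mem _ (Ideal.subset_span ⟨i, rfl⟩) h

namespace IsAdaptedFrame

variable {k : Type u} [Field k] {n : ℕ} {L : Submodule k (Pairs → k)}
  {V₃ : Submodule k (Fin 5 → k)} {ζ : Fin (n + 1) → Pairs → k} {α β a₁ a₂ : Fin 5 → k}
  {c d : Fin n → Fin 5 → k} {R : Type u} [CommRing R]

theorem isInfinitesimalAction (hf : IsAdaptedFrame L V₃ ζ α β a₁ a₂ c d)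
    (hp : IsProjectionCoordinates L V₃ ζ) : IsInfinitesimalAction L (shifts α β c d) where
  mul_eq_zero l l' := hf.isCoframe.shiftMatrix_mul (hf.left_mem l) (hf.right_mem l)
  pairing_eq φ t w s hs := by
    have hL : L ≤ formsVanishingOn V₃ := hp.sup_eq ▸ le_sup_right
    refine (hf.isCoframe.pairing_wedgeAct φ (hL hs) hf.left_mem hf.right_mem t w).trans ?_
    simp [hf.shift_mem _ s hs]

/-- The form `ζ 0 = α ∧ β` does not change, since the shift vectors lie in its kernel `V₃`; on the
other `ζ j` the shifts are dual. -/
theorem pairing_wedgeAct (hf : IsAdaptedFrame L V₃ ζ α β a₁ a₂ c d)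
    (hp : IsProjectionCoordinates L V₃ ζ) (φ : k →+* R) (t : Fin n → R) (w : Pairs → R) :
    (fun i ↦ pairing φ (ζ i) (wedgeAct (linMat φ (shifts α β c d) t) w)) =
      toricAct t fun i ↦ pairing φ (ζ i) w := by
  have hζ : ∀ j, ζ j ∈ formsVanishingOn V₃ := fun j ↦ hp.sup_eq ▸
    Submodule.mem_sup_left (Submodule.subset_span ⟨j, rfl⟩)
  funext i
  refine (hf.isCoframe.pairing_wedgeAct φ (hζ i) hf.left_mem hf.right_mem t w).trans ?_
  refine Fin.cases ?_ (fun j ↦ ?_) i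
  · have h0 : ∀ l, altForm (ζ 0) (c l) a₂ + altForm (ζ 0) a₁ (d l) = 0 := fun l ↦ by
      have hmem := hf.isCoframe.wedge_mem
      rw [hf.zero_eq, altForm_swap _ a₁, hmem _ (hf.left_mem l), hmem _ (hf.right_mem l)]
      simp
    simp [h0, toricAct]
  · simp only [hf.shift_succ, ← hf.zero_eq, toricAct, Fin.cons_succ]
    congr 2
    simp [apply_ite φ]

theorem pairing_baseBivector (hf : IsAdaptedFrame L V₃ ζ α β a₁ a₂ c d) (φ : k →+* R) :
    (fun i ↦ pairing φ (ζ i) (baseBivector φ a₁ a₂)) = Fin.cons 1 0 := by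
  funext i
  rw [baseBivector, pairing_wedge, form_map]
  refine Fin.cases ?_ (fun j ↦ ?_) i
  · rw [hf.zero_eq, hf.isCoframe.altForm_wedge_self]
    simp
  · rw [hf.base_succ]
    simp

theorem isSectionPoint_baseBivector (hf : IsAdaptedFrame L V₃ ζ α β a₁ a₂ c d) (φ : k →+* R) :
    IsSectionPoint φ L (baseBivector φ a₁ a₂) :=
  ⟨isPlucker_wedge _ _, fun s hs ↦ by
    rw [baseBivector, pairing_wedge, form_map, hf.base_mem s hs, map_zero]⟩

theorem span_of_pairing_eq_one {s : Pairs → k} {φ : k →+* R} {w : Pairs → R}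
    (h : pairing φ s w = 1) : Ideal.span (Set.range w) = ⊤ := by
  rw [Ideal.eq_top_iff_one, ← h, pairing_apply]
  exact Ideal.sum_mem _ fun p _ ↦ Ideal.mul_mem_left _ _ (Ideal.subset_span ⟨p, rfl⟩)

theorem span_baseBivector (hf : IsAdaptedFrame L V₃ ζ α β a₁ a₂ c d) (φ : k →+* R) :
    Ideal.span (Set.range (baseBivector φ a₁ a₂)) = ⊤ :=
  span_of_pairing_eq_one (congrFun (hf.pairing_baseBivector φ) 0)

/-- The points outside of the hyperplane `ζ 0 = 0` form the orbit of the base point. -/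
theorem eq_wedgeAct_baseBivector (hf : IsAdaptedFrame L V₃ ζ α β a₁ a₂ c d)
    (hp : IsProjectionCoordinates L V₃ ζ) {φ : k →+* R} {w : Pairs → R}
    (hw : IsSectionPoint φ L w) (h0 : pairing φ (ζ 0) w = 1) :
    w = wedgeAct (linMat φ (shifts α β c d) fun j ↦ pairing φ (ζ j.succ) w)
      (baseBivector φ a₁ a₂) := by
  set z : Fin n → R := fun j ↦ pairing φ (ζ j.succ) w with hz
  have hM := hf.isInfinitesimalAction hp
  -- Translating `w` back by its own coordinates yields a point with the values of the base point,
  -- hence the base point.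
  set w' := wedgeAct (linMat φ (shifts α β c d) (-z)) w with hw'
  have h1 : IsSectionPoint φ L w' := hM.isSectionPoint (span_of_pairing_eq_one h0) hw _
  have h2 : (fun i ↦ pairing φ (ζ i) w') = Fin.cons 1 0 := by
    rw [hw', hf.pairing_wedgeAct hp]
    funext i
    refine Fin.cases ?_ (fun j ↦ ?_) i
    · exact h0
    · simp only [toricAct, Fin.cons_succ, h0, hz, Pi.neg_apply, Pi.zero_apply]
      ring
  have h3 : w' = baseBivector φ a₁ a₂ := by
    refine hf.isCoframe.eq_wedge_of_pairing φ h1.1 fun s hs ↦ ?_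
    rw [← form_map φ s a₁ a₂, ← pairing_wedge]
    change _ = pairing φ s (baseBivector φ a₁ a₂)
    -- The forms vanishing on `V₃` are spanned by `L`, which vanishes at both points, and by the `ζ
    -- i`, whose values agree.
    rw [← hp.sup_eq] at hs
    obtain ⟨s₁, hs₁, s₂, hs₂, rfl⟩ := Submodule.mem_sup.mp hs
    rw [pairing_add, pairing_add, h1.2 _ hs₂, (hf.isSectionPoint_baseBivector φ).2 _ hs₂]
    congr 1
    clear hs
    induction hs₁ using Submodule.span_induction with
    | mem x hx =>
      obtain ⟨i, rfl⟩ := hx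
      exact congrFun (h2.trans (hf.pairing_baseBivector φ).symm) i
    | zero => simp [pairing_apply]
    | add x y hx hy h h' => rw [pairing_add, pairing_add, h, h']
    | smul r x hx h => rw [pairing_smul, pairing_smul, h]
  rw [← h3, hw', wedgeAct_wedgeAct, linMat_mul φ hM.mul_eq_zero, neg_add_cancel, linMat_zero,
    wedgeAct_one]

end IsAdaptedFrame

/-! ### The linear projection -/

section Projection

/-- Affineness is essential: on the punctured plane the two coordinates have no common zero, yet do
not generate the unit ideal. -/
theorem span_eq_top_of_forall_mem_basicOpen {X : Scheme.{u}} [IsAffine X] {J : Type*}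
    {v : J → Γ(X, ⊤)} (h : ∀ x : X, ∃ i, x ∈ X.basicOpen (v i)) :
    Ideal.span (Set.range v) = ⊤ := by
  refine ((isAffineOpen_top X).self_le_iSup_basicOpen_iff).mp fun x _ ↦ ?_
  obtain ⟨i, hi⟩ := h x
  exact TopologicalSpace.Opens.mem_iSup.mpr ⟨⟨v i, i, rfl⟩, hi⟩

variable {k : Type u} [Field k] {n : ℕ} {L : Submodule k (Pairs → k)}
  {ζ : Fin (n + 1) → Pairs → k}

theorem evalForms_eq {T : Over (Spec (.of k))} (w : Pairs → Γ(T.left, ⊤)) :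
    evalForms ζ w = fun i ↦ pairing (scalars T) (ζ i) w := rfl

theorem evalForms_mul {T : Over (Spec (.of k))} (c : Γ(T.left, ⊤)) (w : Pairs → Γ(T.left, ⊤)) :
    evalForms ζ (fun p ↦ c * w p) = fun i ↦ c * evalForms ζ w i :=
  funext fun i ↦ pairing_mul _ (ζ i) c w

theorem evalForms_pull {T T' : Over (Spec (.of k))} (f : T' ⟶ T) (w : Pairs → Γ(T.left, ⊤)) :
    evalForms ζ (fun p ↦ pull f (w p)) = fun i ↦ pull f (evalForms ζ w i) := by
  funext i
  refine Eq.trans ?_ (map_pairing (scalars T) (pull f) (ζ i) w).symm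
  rw [pull_comp_scalars]
  rfl

/-- Local homogeneous coordinates of a point in the domain of the projection. -/
theorem exists_open_hasCoords_projectionDomain {T : Over (Spec (.of k))} (x : T ⟶ linearSection L)
    (t : T.left) (ht : x.left t ∈ projectionDomain L ζ) :
    ∃ (O : T.left.Opens) (_ : t ∈ O) (w : Pairs → Γ((openSub T O).left, ⊤)),
      HasCoords (openSub T O) ((openSubι T O ≫ x).left ≫ linearSectionEmb L) w ∧
        Ideal.span (Set.range (evalForms ζ w)) = ⊤ := by
  obtain ⟨i, hi⟩ := TopologicalSpace.Opens.mem_iSup.mp ht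
  obtain ⟨O, htO, hOV, w, hw⟩ := exists_open_hasCoords _ (point_over x)
    (x.left ⁻¹ᵁ nonvanishing L (ζ i)) t hi
  have hw' : HasCoords (openSub T O) ((openSubι T O ≫ x).left ≫ linearSectionEmb L) w := by
    simpa using hw
  refine ⟨O, htO, w, hw', span_eq_top_of_isUnit (i := i) (isUnit_of_basicOpen_eq_top ?_)⟩
  refine (hw'.preimage_nonvanishing (ζ i)).symm.trans ?_
  exact eq_top_iff.mpr fun z _ ↦ hOV z.2

variable (L ζ) in
/-- The domain of the projection as a `k`-scheme. -/
noncomputable abbrev projectionSource : Over (Spec (.of k)) :=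
  openSub (linearSection L) (projectionDomain L ζ)

-- Linear forms commute with base change and with scaling. Locally on the domain one of the values
-- `ζ i (w)` is a unit, so these values are homogeneous coordinates and the gluing principle
-- applies.
variable (L ζ) in
theorem exists_projection :
    ∃ π : projectionSource L ζ ⟶ Over.mk (pspaceToSpec (Fin (n + 1)) k),
      ∀ {T : Over (Spec (.of k))} (f : T ⟶ projectionSource L ζ) (w : Pairs → Γ(T.left, ⊤)),
        HasCoords T ((f ≫ openSubι _ _).left ≫ linearSectionEmb L) w →
          Ideal.span (Set.range (evalForms ζ w)) = ⊤ →
            HasCoords T ((f ≫ π).left) (evalForms ζ w) := by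
  have hpt : ∀ {T : Over (Spec (.of k))} {z : Fin (n + 1) → Γ(T.left, ⊤)}
      (hz : Ideal.span (Set.range z) = ⊤), ∃ y : T ⟶ Over.mk (pspaceToSpec (Fin (n + 1)) k),
        y.left = homogPoint T z hz := fun {T z} hz ↦
    ⟨Over.homMk (homogPoint T z hz) (homogPoint_over z hz), rfl⟩
  obtain ⟨π, hπ⟩ := exists_hom_of_local_operator (T := projectionSource L ζ)
    (Y := Over.mk (pspaceToSpec (Fin (n + 1)) k))
    ((openSubι (linearSection L) (projectionDomain L ζ)).left ≫ linearSectionEmb L)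
    (𝟙 (Over.mk (pspaceToSpec (Fin (n + 1)) k)).left) (fun {T'} _ w ↦ evalForms ζ w)
    (fun f g w ↦ evalForms_pull g w) (fun f w c ↦ evalForms_mul c w) (fun t ↦ by
      obtain ⟨O, ht, w, hw, hs⟩ := exists_open_hasCoords_projectionDomain (ζ := ζ)
        (openSubι (linearSection L) (projectionDomain L ζ)) t t.2
      obtain ⟨y, hy⟩ := hpt hs
      exact ⟨O, ht, y, w, by simpa using hw, hs, by rw [hy]; exact Category.comp_id _⟩)
  refine ⟨π, fun {T} f w hw hs ↦ ?_⟩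
  obtain ⟨y, hy⟩ := hpt hs
  rw [hπ f w y (by simpa using hw) ⟨hs, by rw [hy]; exact Category.comp_id _⟩]
  exact ⟨hs, hy⟩

variable (L ζ) in
/-- The projection as a morphism of `k`-schemes. -/
noncomputable def projection : projectionSource L ζ ⟶ Over.mk (pspaceToSpec (Fin (n + 1)) k) :=
  (exists_projection L ζ).choose

theorem comp_projection_coords {T : Over (Spec (.of k))} (f : T ⟶ projectionSource L ζ)
    {w : Pairs → Γ(T.left, ⊤)}
    (hw : HasCoords T ((f ≫ openSubι _ _).left ≫ linearSectionEmb L) w)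
    (hs : Ideal.span (Set.range (evalForms ζ w)) = ⊤) :
    HasCoords T ((f ≫ projection L ζ).left) (evalForms ζ w) :=
  (exists_projection L ζ).choose_spec f w hw hs

/-- Lifting of a point to the domain of the projection. -/
theorem exists_lift_projectionSource {T : Over (Spec (.of k))} (x : T ⟶ linearSection L)
    (h : ∀ t, x.left t ∈ projectionDomain L ζ) :
    ∃ f : T ⟶ projectionSource L ζ, f ≫ openSubι _ _ = x := by
  have hr : Set.range x.left ⊆ Set.range (projectionDomain L ζ).ι := by
    rw [Scheme.Opens.range_ι]
    rintro _ ⟨t, rfl⟩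
    exact h t
  obtain ⟨g, hg⟩ : ∃ g, g ≫ (projectionDomain L ζ).ι = x.left :=
    ⟨IsOpenImmersion.lift _ _ hr, IsOpenImmersion.lift_fac _ _ hr⟩
  refine ⟨Over.homMk g ?_, ?_⟩
  · refine Eq.trans ?_ (Over.w x)
    rw [← hg, Category.assoc]
    rfl
  · ext1
    exact hg

theorem isLinearProjection_projection : IsLinearProjection L ζ (projection L ζ).left := by
  intro T _ y w hw hy
  have hover := (show HasCoords T _ w from ⟨hw, rfl⟩).over (m := homogPoint T w hw)
  let f : T ⟶ projectionSource L ζ := Over.homMk y (by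
    rw [← hover, ← hy, Category.assoc, Category.assoc, linearSectionEmb_over]
    rfl)
  have hf : HasCoords T ((f ≫ openSubι _ _).left ≫ linearSectionEmb L) w := ⟨hw, by
    rw [← hy]
    rfl⟩
  have hs : Ideal.span (Set.range (evalForms ζ w)) = ⊤ := by
    refine span_eq_top_of_forall_mem_basicOpen fun t ↦ ?_
    obtain ⟨i, hi⟩ := TopologicalSpace.Opens.mem_iSup.mp (y t).2
    refine ⟨i, ?_⟩
    have h1 := hf.preimage_nonvanishing (ζ i)
    exact h1.le hi
  exact comp_projection_coords f hf hs

theorem projection_preimage :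
    (projection L ζ).left ⁻¹ᵁ
        Proj.basicOpen (MvPolynomial.homogeneousSubmodule (Fin (n + 1)) k) (.X 0) =
      (projectionDomain L ζ).ι ⁻¹ᵁ nonvanishing L (ζ 0) := by
  ext t
  obtain ⟨O, ht, w, hw, hs⟩ := exists_open_hasCoords_projectionDomain (ζ := ζ)
    (openSubι (linearSection L) (projectionDomain L ζ)) t t.2
  have h1 := (comp_projection_coords _ hw hs).preimage_basicOpen one_pos (X_mem 0)
  have h2 := hw.preimage_nonvanishing (ζ 0)
  have h3 : MvPolynomial.eval₂Hom (scalars (openSub (projectionSource L ζ) O)) (evalForms ζ w)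
      (MvPolynomial.X 0) = pairing (scalars (openSub (projectionSource L ζ) O)) (ζ 0) w := by
    simp [evalForms_eq]
  rw [h3, ← h2] at h1
  exact (TopologicalSpace.Opens.ext_iff.mp h1 |> Set.ext_iff.mp) ⟨t, ht⟩

end Projection

/-! ### The orbit of the base point -/

instance mono_openSubι {k : Type u} [Field k] (T : Over (Spec (.of k))) (O : T.left.Opens) :
    Mono (openSubι T O) where
  right_cancellation f g h := by
    ext1
    exact (cancel_mono O.ι).mp (congrArg (fun f ↦ Over.Hom.left f) h)

theorem isIso_morphismRestrict_of_section {X Y : Scheme.{u}} (f : X ⟶ Y) (U : Y.Opens)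
    (σ : U.toScheme ⟶ X) (h₁ : σ ≫ f = U.ι) (h₂ : f ∣_ U ≫ σ = (f ⁻¹ᵁ U).ι) :
    IsIso (f ∣_ U) := by
  have hr : Set.range σ ⊆ Set.range (f ⁻¹ᵁ U).ι := by
    rw [Scheme.Opens.range_ι]
    rintro _ ⟨t, rfl⟩
    have : f (σ t) = U.ι t := by rw [← h₁]; rfl
    change f (σ t) ∈ U
    rw [this]
    exact t.2
  refine ⟨IsOpenImmersion.lift (f ⁻¹ᵁ U).ι σ hr, ?_, ?_⟩
  · rw [← cancel_mono (f ⁻¹ᵁ U).ι, Category.assoc, IsOpenImmersion.lift_fac, h₂, Category.id_comp]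
  · rw [← cancel_mono U.ι, Category.assoc, morphismRestrict_ι, IsOpenImmersion.lift_fac_assoc, h₁,
      Category.id_comp]

theorem nonvanishing_le_projectionDomain {k : Type u} [Field k] {n : ℕ}
    (L : Submodule k (Pairs → k)) (ζ : Fin (n + 1) → Pairs → k) (i : Fin (n + 1)) :
    nonvanishing L (ζ i) ≤ projectionDomain L ζ :=
  le_iSup (fun i ↦ nonvanishing L (ζ i)) i

namespace IsAdaptedFrame

variable {k : Type u} [Field k] {n : ℕ} {L : Submodule k (Pairs → k)}
  {V₃ : Submodule k (Fin 5 → k)} {ζ : Fin (n + 1) → Pairs → k} {α β a₁ a₂ : Fin 5 → k}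
  {c d : Fin n → Fin 5 → k} {T : Over (Spec (.of k))}

theorem exists_basePoint (hf : IsAdaptedFrame L V₃ ζ α β a₁ a₂ c d) (T : Over (Spec (.of k))) :
    ∃ x : T ⟶ linearSection L,
      HasCoords T (x.left ≫ linearSectionEmb L) (baseBivector (scalars T) a₁ a₂) :=
  exists_hasCoords_linearSection (hf.span_baseBivector _) (hf.isSectionPoint_baseBivector _)

/-- A point outside of the hyperplane `ζ 0 = 0` has coordinates with `ζ 0 = 1`. -/
theorem normalize {x : T ⟶ linearSection L} {w : Pairs → Γ(T.left, ⊤)}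
    (hw : HasCoords T (x.left ≫ linearSectionEmb L) w) {s : Pairs → k}
    (hx : ∀ t, x.left t ∈ nonvanishing L s) :
    ∃ w', HasCoords T (x.left ≫ linearSectionEmb L) w' ∧ pairing (scalars T) s w' = 1 := by
  have h1 : IsUnit (pairing (scalars T) s w) := by
    refine isUnit_of_basicOpen_eq_top ?_
    rw [← hw.preimage_nonvanishing s]
    exact eq_top_iff.mpr fun t _ ↦ hx t
  refine ⟨_, hw.mul h1.unit⁻¹.isUnit, ?_⟩
  rw [pairing_mul]
  exact h1.val_inv_mul

theorem mem_nonvanishing_of_isUnit {x : T ⟶ linearSection L} {w : Pairs → Γ(T.left, ⊤)}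
    (hw : HasCoords T (x.left ≫ linearSectionEmb L) w) {s : Pairs → k}
    (hs : IsUnit (pairing (scalars T) s w)) (t : T.left) : x.left t ∈ nonvanishing L s := by
  have h := hw.preimage_nonvanishing s
  rw [Scheme.basicOpen_of_isUnit _ hs] at h
  exact h.ge (Set.mem_univ t)

theorem pairing_zero_wedgeAct (hf : IsAdaptedFrame L V₃ ζ α β a₁ a₂ c d)
    (hp : IsProjectionCoordinates L V₃ ζ) {R : Type u} [CommRing R] (φ : k →+* R) (t : Fin n → R)
    (w : Pairs → R) :
    pairing φ (ζ 0) (wedgeAct (linMat φ (shifts α β c d) t) w) = pairing φ (ζ 0) w :=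
  congrFun (hf.pairing_wedgeAct hp φ t w) 0

/-- Fixing the coordinate of index 0 as 1 removes the ambiguity by a unit. -/
theorem eq_of_pairing_eq {m : ℕ} {m' : T.left ⟶ PSpace (Fin (m + 1)) k}
    {z z' : Fin (m + 1) → Γ(T.left, ⊤)} (hz : HasCoords T m' z) (hz' : HasCoords T m' z')
    (h : z 0 = 1) (h' : z' 0 = 1) : z = z' := by
  obtain ⟨r, -, rfl⟩ := hz.exists_isUnit hz'
  have hr : r = 1 := by simpa [h] using h'
  funext i
  rw [hr, one_mul]

/-- The inverse of the projection over `z_0 = 1` sends `z` to the translate of the base point by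
`(z_1, …, z_n)`. -/
theorem exists_section (hf : IsAdaptedFrame L V₃ ζ α β a₁ a₂ c d)
    (hp : IsProjectionCoordinates L V₃ ζ) {z : Fin (n + 1) → Γ(T.left, ⊤)} (hz : z 0 = 1) :
    ∃ x : T ⟶ linearSection L, HasCoords T (x.left ≫ linearSectionEmb L)
        (wedgeAct (linMat (scalars T) (shifts α β c d) fun j ↦ z j.succ)
          (baseBivector (scalars T) a₁ a₂)) ∧
      (∀ t, x.left t ∈ nonvanishing L (ζ 0)) ∧
      evalForms ζ (wedgeAct (linMat (scalars T) (shifts α β c d) fun j ↦ z j.succ)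
          (baseBivector (scalars T) a₁ a₂)) = z := by
  have hM := hf.isInfinitesimalAction hp
  obtain ⟨x, hx⟩ := exists_hasCoords_linearSection (T := T)
    (hM.span_eq_top (scalars T) (hf.span_baseBivector _) fun j ↦ z j.succ)
    (hM.isSectionPoint (hf.span_baseBivector _) (hf.isSectionPoint_baseBivector _) _)
  have hev : evalForms ζ (wedgeAct (linMat (scalars T) (shifts α β c d) fun j ↦ z j.succ)
          (baseBivector (scalars T) a₁ a₂)) = z := by
    rw [evalForms_eq, hf.pairing_wedgeAct hp, hf.pairing_baseBivector]
    funext i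
    refine Fin.cases ?_ (fun j ↦ ?_) i
    · simp [toricAct, hz]
    · simp [toricAct]
  refine ⟨x, hx, mem_nonvanishing_of_isUnit hx ?_, hev⟩
  rw [show pairing _ _ _ = z 0 from congrFun hev 0, hz]
  exact isUnit_one

/-- The inverse is `exists_section` applied to the universal point of the chart `z_0 ≠ 0`. That it
is a left inverse is `eq_wedgeAct_baseBivector`: a point with `ζ 0 = 1` is the translate of the base
point by its remaining coordinates. -/
theorem isIsoOverComplement (hf : IsAdaptedFrame L V₃ ζ α β a₁ a₂ c d)
    (hp : IsProjectionCoordinates L V₃ ζ) :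
    IsIsoOverComplement L ζ (projection L ζ).left := by
  refine ⟨?_, ?_⟩
  · refine (congrArg (fun U ↦ (projectionDomain L ζ).ι ''ᵁ U) projection_preimage).trans ?_
    rw [Scheme.Hom.image_preimage_eq_opensRange_inf, Scheme.Opens.opensRange_ι]
    exact inf_eq_right.mpr (nonvanishing_le_projectionDomain L ζ 0)
  set D := Proj.basicOpen (MvPolynomial.homogeneousSubmodule (Fin (n + 1)) k) (.X 0) with hD
  let P : Over (Spec (.of k)) := Over.mk (pspaceToSpec (Fin (n + 1)) k)
  obtain ⟨z, hz0, hz⟩ := exists_hasCoords_of_range_subset (T := openSub P D) (openSubι P D).left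
    (Over.w (openSubι P D)) 0 (by
      rintro _ ⟨t, rfl⟩
      exact t.2)
  obtain ⟨x, hx, hxU, hxz⟩ := hf.exists_section hp hz0
  obtain ⟨σ, hσ⟩ := exists_lift_projectionSource (ζ := ζ) x
    fun t ↦ nonvanishing_le_projectionDomain L ζ 0 (hxU t)
  have hσπ : σ ≫ projection L ζ = openSubι P D := by
    ext1
    have h1 := comp_projection_coords σ (by rw [hσ]; exact hx) (by rw [hxz]; exact hz.1)
    rw [hxz] at h1
    exact h1.hom_ext hz
  let r := openSubMap (projection L ζ) D
  have hr : r ≫ openSubι P D = openSubι _ _ ≫ projection L ζ := openSubMap_comp _ _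
  have hrσ : r ≫ σ = openSubι _ _ := by
    have key : r ≫ x = openSubι _ _ ≫ openSubι _ _ := by
      refine linearSection_hom_ext (openSubι _ _ ≫ openSubι _ _) fun {T'} f w hw ↦ ?_
      have hmem : ∀ t, (f ≫ openSubι (projectionSource L ζ) ((projection L ζ).left ⁻¹ᵁ D) ≫
          openSubι (linearSection L) (projectionDomain L ζ)).left t ∈ nonvanishing L (ζ 0) := by
        intro t
        have h1 : (f.left t).1 ∈ (projection L ζ).left ⁻¹ᵁ D := (f.left t).2
        exact (projection_preimage (L := L) (ζ := ζ)).le h1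
      obtain ⟨w', hw', hw1⟩ := normalize hw hmem
      refine ⟨w', ?_, hw'⟩
      have h1 := comp_projection_coords (ζ := ζ)
        (f ≫ openSubι (projectionSource L ζ) ((projection L ζ).left ⁻¹ᵁ D))
        (by simpa only [Category.assoc] using hw')
        (span_eq_top_of_isUnit (i := 0) (by
          rw [show evalForms ζ w' 0 = 1 from hw1]
          exact isUnit_one))
      rw [Category.assoc, ← hr] at h1
      have h2 := hz.comp (f ≫ r)
      have h3 : (fun i ↦ pull (f ≫ r) (z i)) = evalForms ζ w' := by
        refine eq_of_pairing_eq h2 (m' := (f ≫ r).left ≫ (openSubι P D).left) ?_ ?_ hw1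
        · simpa using h1
        · rw [hz0, map_one]
      have h4 := hx.comp (f ≫ r)
      have h5 := hf.eq_wedgeAct_baseBivector hp hw'.isSectionPoint hw1
      have h6 : (fun p ↦ pull (f ≫ r) (wedgeAct (linMat (scalars (openSub P D)) (shifts α β c d)
          fun j ↦ z j.succ) (baseBivector (scalars (openSub P D)) a₁ a₂) p)) = w' := by
        rw [h5]
        funext p
        rw [map_wedgeAct, linMat_map, map_baseBivector, pull_comp_scalars]
        congr 2
        funext j
        exact congrFun h3 j.succ
      rw [h6] at h4
      simpa using h4
    rw [← cancel_mono (openSubι (linearSection L) (projectionDomain L ζ)), Category.assoc, hσ, key]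
  exact isIso_morphismRestrict_of_section _ _ σ.left
    (congrArg (fun f ↦ Over.Hom.left f) hσπ) (congrArg (fun f ↦ Over.Hom.left f) hrσ)

end IsAdaptedFrame

/-! ### Effectivity, the open orbit and equivariance -/

namespace IsAdaptedFrame

variable {k : Type u} [Field k] {n : ℕ} {L : Submodule k (Pairs → k)}
  {V₃ : Submodule k (Fin 5 → k)} {ζ : Fin (n + 1) → Pairs → k} {α β a₁ a₂ : Fin 5 → k}
  {c d : Fin n → Fin 5 → k}

/-- The representation inducing the action. -/
noncomputable def rep (hf : IsAdaptedFrame L V₃ ζ α β a₁ a₂ c d)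
    (hp : IsProjectionCoordinates L V₃ ζ) : VectorGroupRep k n 5 :=
  squareZeroRep (shifts α β c d) (hf.isInfinitesimalAction hp).mul_eq_zero

/-- The action of the vector group on the linear section. -/
@[reducible]
noncomputable def modObj (hf : IsAdaptedFrame L V₃ ζ α β a₁ a₂ c d)
    (hp : IsProjectionCoordinates L V₃ ζ) : ModObj (vectorGroup k n) (linearSection L) :=
  (hf.isInfinitesimalAction hp).modObj

theorem smul_coords (hf : IsAdaptedFrame L V₃ ζ α β a₁ a₂ c d)
    (hp : IsProjectionCoordinates L V₃ ζ) {T : Over (Spec (.of k))} (t : T ⟶ vectorGroup k n)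
    (x : T ⟶ linearSection L) {w : Pairs → Γ(T.left, ⊤)}
    (hw : HasCoords T (x.left ≫ linearSectionEmb L) w) :
    letI := hf.modObj hp
    HasCoords T ((t • x).left ≫ linearSectionEmb L)
      (wedgeAct (linMat (scalars T) (shifts α β c d) (coords t)) w) := by
  rw [(hf.isInfinitesimalAction hp).smul_eq]
  exact (hf.isInfinitesimalAction hp).act_coords t x hw

theorem isInducedByWedge (hf : IsAdaptedFrame L V₃ ζ α β a₁ a₂ c d)
    (hp : IsProjectionCoordinates L V₃ ζ) :
    letI := hf.modObj hp
    IsInducedByWedge L (hf.rep hp) := by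
  let _ := hf.modObj hp
  intro T _ t x w hw hx
  rw [rep, squareZeroRep_evalAt]
  exact hf.smul_coords hp t x ⟨hw, hx⟩

/-- It suffices to test on the base point: its `ζ`-coordinates `(1, 0)` are moved to `(1, t)`, and
equality up to a unit forces `t = 0`. -/
theorem isEffectiveAction (hf : IsAdaptedFrame L V₃ ζ α β a₁ a₂ c d)
    (hp : IsProjectionCoordinates L V₃ ζ) :
    letI := hf.modObj hp
    IsEffectiveAction (vectorGroup k n) (linearSection L) := by
  let _ := hf.modObj hp
  intro T g hg
  obtain ⟨o, ho⟩ := hf.exists_basePoint T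
  have h1 := congrArg (lift (𝟙 T) o ≫ ·) hg
  simp only [ModObj.comp_smul, lift_snd, lift_fst_assoc, Category.id_comp] at h1
  have h2 := hf.smul_coords hp g o ho
  rw [h1] at h2
  obtain ⟨r, -, hr⟩ := ho.exists_isUnit h2
  have h3 := congrArg (evalForms ζ) hr
  rw [evalForms_mul, evalForms_eq, evalForms_eq, hf.pairing_wedgeAct hp,
    hf.pairing_baseBivector] at h3
  have h4 : coords g = 0 := by
    funext j
    simpa [toricAct] using congrFun h3 j.succ
  exact coords_injective (h4.trans (coords_one _).symm)

/-- The form `ζ 0` is invariant, so the open set is stable; two points with `ζ 0 = 1` differ by the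
translation by the difference of their other coordinates. -/
theorem isOpenOrbit (hf : IsAdaptedFrame L V₃ ζ α β a₁ a₂ c d)
    (hp : IsProjectionCoordinates L V₃ ζ) :
    letI := hf.modObj hp
    IsOpenOrbit (vectorGroup k n) (linearSection L) (nonvanishing L (ζ 0)) := by
  let _ := hf.modObj hp
  refine ⟨?_, fun K _ _ a x y hx ↦ ?_⟩
  · obtain ⟨o, ho⟩ := hf.exists_basePoint (Over.mk (𝟙 (Spec (.of k))))
    refine ⟨o.left (IsLocalRing.closedPoint k), mem_nonvanishing_of_isUnit ho ?_ _⟩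
    rw [show pairing _ (ζ 0) _ = 1 from congrFun (hf.pairing_baseBivector _) 0]
    exact isUnit_one
  obtain ⟨p, w, -, hw⟩ := exists_hasCoords_of_isLocalRing (ι := Pairs) a
    (x.left ≫ linearSectionEmb L) (point_over x)
  obtain ⟨w, hw, hw0⟩ := normalize hw fun t ↦ hx ⟨t, rfl⟩
  constructor
  · intro hy
    obtain ⟨p, v, -, hv⟩ := exists_hasCoords_of_isLocalRing (ι := Pairs) a
      (y.left ≫ linearSectionEmb L) (point_over y)
    obtain ⟨v, hv, hv0⟩ := normalize hv fun t ↦ hy ⟨t, rfl⟩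
    obtain ⟨g, hg⟩ := exists_coords_eq (k := k) (T := Over.mk a)
      ((fun j ↦ pairing (scalars (Over.mk a)) (ζ j.succ) v) -
        fun j ↦ pairing (scalars (Over.mk a)) (ζ j.succ) w)
    refine ⟨g, ?_⟩
    ext1
    rw [← cancel_mono (linearSectionEmb L)]
    have h1 := hf.smul_coords hp g x hw
    refine h1.hom_ext ?_
    rw [hf.eq_wedgeAct_baseBivector hp hw.isSectionPoint hw0, wedgeAct_wedgeAct,
      linMat_mul _ (hf.isInfinitesimalAction hp).mul_eq_zero, hg, add_sub_cancel,
      ← hf.eq_wedgeAct_baseBivector hp hv.isSectionPoint hv0]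
    exact hv
  · rintro ⟨g, rfl⟩
    rintro _ ⟨t, rfl⟩
    refine mem_nonvanishing_of_isUnit (hf.smul_coords hp g x hw) ?_ t
    rw [hf.pairing_zero_wedgeAct hp, hw0]
    exact isUnit_one

theorem liftsToricAction (hf : IsAdaptedFrame L V₃ ζ α β a₁ a₂ c d)
    (hp : IsProjectionCoordinates L V₃ ζ) :
    letI := hf.modObj hp
    LiftsToricAction L ζ (projection L ζ).left := by
  let _ := hf.modObj hp
  intro T _ t x y hy
  have hev : ∀ {T' : Over (Spec (.of k))} (t : T' ⟶ vectorGroup k n) (w : Pairs → Γ(T'.left, ⊤)),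
      evalForms ζ (wedgeAct (linMat (scalars T') (shifts α β c d) (coords t)) w) =
        toricAct (coords t) (evalForms ζ w) := fun t w ↦
    hf.pairing_wedgeAct hp _ (coords t) w
  have hloc : ∀ a : T.left, ∃ (O : T.left.Opens) (_ : a ∈ O)
      (w : Pairs → Γ((openSub T O).left, ⊤)),
      HasCoords (openSub T O) ((openSubι T O ≫ x).left ≫ linearSectionEmb L) w ∧
        Ideal.span (Set.range (evalForms ζ w)) = ⊤ := fun a ↦
    exists_open_hasCoords_projectionDomain x a (by rw [← hy]; exact (y a).2)
  have hact : ∀ {O : T.left.Opens} {w : Pairs → Γ((openSub T O).left, ⊤)},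
      HasCoords (openSub T O) ((openSubι T O ≫ x).left ≫ linearSectionEmb L) w →
        HasCoords (openSub T O) ((openSubι T O ≫ (t • x)).left ≫ linearSectionEmb L)
          (wedgeAct (linMat (scalars _) (shifts α β c d) (coords (openSubι T O ≫ t))) w) := by
    intro O w hw
    rw [ModObj.comp_smul]
    exact hf.smul_coords hp _ _ hw
  -- The domain is stable because the toric transformation preserves families generating the unit
  -- ideal.
  obtain ⟨f, hf'⟩ := exists_lift_projectionSource (ζ := ζ) (t • x) (by
    intro a
    obtain ⟨O, ha, w, hw, hs⟩ := hloc a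
    have h1 := span_toricAct (coords (openSubι T O ≫ t)) hs
    rw [← hev] at h1
    obtain ⟨i, hi⟩ := exists_mem_basicOpen_of_span_eq_top h1 ⟨a, ha⟩
    rw [evalForms_eq, ← (hact hw).preimage_nonvanishing] at hi
    exact nonvanishing_le_projectionDomain L ζ i hi)
  let g : T ⟶ projectionSource L ζ := Over.homMk y (by
    rw [← Over.w x, ← hy, Category.assoc]
    rfl)
  have hg : g ≫ openSubι _ _ = x := by
    ext1
    exact hy
  refine ⟨f.left, congrArg (fun f ↦ Over.Hom.left f) hf', fun z hz hyz ↦ ?_⟩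
  refine ⟨span_toricAct _ hz, ?_⟩
  have hgz : HasCoords T (g ≫ projection L ζ).left z := ⟨hz, hyz⟩
  refine Scheme.hom_ext_of_forall _ _ fun a ↦ ?_
  obtain ⟨O, ha, w, hw, hs⟩ := hloc a
  refine ⟨O, ha, ?_⟩
  have h1 := comp_projection_coords (openSubι T O ≫ g) (by rw [Category.assoc, hg]; exact hw) hs
  have h2 := hgz.comp (openSubι T O)
  have h3 := comp_projection_coords (openSubι T O ≫ f) (by
    rw [Category.assoc, hf']
    exact hact hw) (by
      rw [hev]
      exact span_toricAct _ hs)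
  rw [hev] at h3
  have h2' : HasCoords (openSub T O) ((openSubι T O ≫ g) ≫ projection L ζ).left
    (fun i ↦ pull (openSubι T O) (z i)) := by simpa using h2
  -- The given coordinates `z` and the local ones computed from `w` differ by a unit `r`, and the
  -- toric action commutes with scaling by `r`.
  obtain ⟨r, hr, hrw⟩ := h1.exists_isUnit h2'
  have h4 := h3.mul hr
  rw [← toricAct_mul, ← hrw] at h4
  have h5 := (show HasCoords T (homogPoint T (toricAct (coords t) z) (span_toricAct _ hz)) _ from
    ⟨_, rfl⟩).comp (openSubι T O)
  have h6 : (fun i ↦ pull (openSubι T O) (toricAct (coords t) z i)) =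
      toricAct (coords (openSubι T O ≫ t)) fun i ↦ pull (openSubι T O) (z i) := by
    funext i
    rw [map_toricAct, coords_comp]
  rw [h6] at h5
  exact Eq.trans (by simp; rfl) (h4.hom_ext h5)

end IsAdaptedFrame

/-! ### Pencils of alternating forms on a five-dimensional space -/

section Pencils

variable {k : Type u} [Field k]

/-- A basis is padded by zeros, so that dimensions 0, 1 and 2 are treated alike. -/
theorem exists_span_pair {V : Type*} [AddCommGroup V] [Module k V] [FiniteDimensional k V]
    (L : Submodule k V) (hL : Module.finrank k L ≤ 2) :
    ∃ s₁ ∈ L, ∃ s₂ ∈ L, ∀ s ∈ L, ∃ l m : k, s = l • s₁ + m • s₂ := by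
  let b := Module.finBasis k L
  let c : Fin 2 → L := fun i ↦ if h : i.1 < Module.finrank k L then b ⟨i.1, h⟩ else 0
  refine ⟨c 0, (c 0).2, c 1, (c 1).2, fun s hs ↦ ?_⟩
  have hspan : Submodule.span k (Set.range c) = ⊤ := by
    rw [eq_top_iff, ← b.span_eq, Submodule.span_le]
    rintro _ ⟨i, rfl⟩
    refine Submodule.subset_span ⟨⟨i.1, i.2.trans_le hL⟩, ?_⟩
    simp [c]
  have hmem : (⟨s, hs⟩ : L) ∈ Submodule.span k (Set.range c) := hspan ▸ Submodule.mem_top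
  rw [Submodule.mem_span_range_iff_exists_fun] at hmem
  obtain ⟨r, hr⟩ := hmem
  rw [Fin.sum_univ_two] at hr
  exact ⟨r 0, r 1, (congrArg Subtype.val hr).symm⟩

/-- The remaining vectors are taken in a complement of the line of `v`. -/
theorem exists_linearIndependent_cons {V : Type*} [AddCommGroup V] [Module k V]
    [FiniteDimensional k V] {n : ℕ} {v : V} (hv : v ≠ 0) (hn : n + 1 ≤ Module.finrank k V) :
    ∃ b : Fin (n + 1) → V, LinearIndependent k b ∧ b 0 = v := by
  obtain ⟨C, hC⟩ := Submodule.exists_isCompl (Submodule.span k {v})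
  have hCn : n ≤ Module.finrank k C := by
    have h1 := Submodule.finrank_add_eq_of_isCompl hC
    rw [finrank_span_singleton hv] at h1
    omega
  obtain ⟨h, hh⟩ := exists_linearIndependent_of_le_finrank hCn
  refine ⟨Fin.cons v fun i ↦ (h i : V), ?_, rfl⟩
  rw [linearIndependent_finCons]
  refine ⟨hh.map' C.subtype C.ker_subtype, fun hmem ↦ ?_⟩
  have hle : Submodule.span k (Set.range fun i ↦ (h i : V)) ≤ C := by
    rw [Submodule.span_le]
    rintro _ ⟨i, rfl⟩
    exact (h i).2
  exact hv (Submodule.disjoint_def.mp hC.disjoint _ (Submodule.mem_span_singleton_self _)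
    (hle hmem))

theorem altForm_eq_sum_skew (s : Pairs → k) (x y : Fin 5 → k) :
    altForm s x y = ∑ i, ∑ j, x i * y j * skew s i j := by
  rw [← sum_pairs_skew s fun i j ↦ x i * y j]
  exact Finset.sum_congr rfl fun p _ ↦ by ring

/-- An alternating form on a five-dimensional space is degenerate. -/
theorem exists_kernel [CharZero k] (s : Pairs → k) :
    ∃ v : Fin 5 → k, v ≠ 0 ∧ ∀ y, altForm s v y = 0 := by
  let A : Matrix (Fin 5) (Fin 5) k := Matrix.of (skew s)
  have hA : A.transpose = -A := by
    ext i j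
    exact skew_swap s i j
  have hdet : A.det = 0 := by
    have h1 := A.det_transpose
    rw [hA, Matrix.det_neg, Fintype.card_fin] at h1
    have h2 : (2 : k) * A.det = 0 := by linear_combination -h1
    exact (mul_eq_zero.mp h2).resolve_left two_ne_zero
  obtain ⟨v, hv, h⟩ := Matrix.exists_mulVec_eq_zero_iff.mpr hdet
  refine ⟨v, hv, fun y ↦ ?_⟩
  rw [altForm_swap, altForm_eq_sum_skew]
  rw [neg_eq_zero]
  refine Finset.sum_eq_zero fun i _ ↦ ?_
  have := congrFun h i
  simp only [Matrix.mulVec, dotProduct, Pi.zero_apply] at this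
  simp only [mul_assoc]
  rw [← Finset.mul_sum]
  simp only [A, Matrix.of_apply] at this
  rw [Finset.sum_congr rfl fun j _ ↦ mul_comm (v j) _, this, mul_zero]

/-- The restriction of a form to the span of `v, h₁, h₂, h₃` if `v` is in the kernel. -/
theorem altForm_of_kernel {s : Pairs → k} {b : Fin 4 → Fin 5 → k}
    (h : ∀ j, altForm s (b 0) (b j) = 0) (x y : Fin 4 → k) :
    altForm s (∑ j, x j • b j) (∑ j, y j • b j) =
      Matrix.det !![altForm s (b 2) (b 3), altForm s (b 3) (b 1), altForm s (b 1) (b 2);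
        x 1, x 2, x 3; y 1, y 2, y 3] := by
  have h' : ∀ j, altForm s (b j) (b 0) = 0 := fun j ↦ by rw [altForm_swap, h, neg_zero]
  simp only [Fin.sum_univ_four, altForm_add_left, altForm_add_right, altForm_smul_left,
    altForm_smul_right, h, h', altForm_self, altForm_swap s (b 2) (b 1),
    altForm_swap s (b 3) (b 2), altForm_swap s (b 3) (b 1), Matrix.det_fin_three]
  simp
  ring

/-- Let `v` span a line in the kernel of `s₁` and let `b 0 = v, b 1, b 2, b 3` be independent
vectors orthogonal to `v` for `s₂`. On their span both forms descend to the three-dimensional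
quotient by `v`, where each is `det(p, ·, ·)` for a vector `p`. A plane of the quotient containing
both vectors `p` is isotropic for both forms, and `V₃` is its preimage. -/
theorem exists_isotropic [CharZero k] (s₁ s₂ : Pairs → k) :
    ∃ V₃ : Submodule k (Fin 5 → k), Module.finrank k V₃ = 3 ∧ s₁ ∈ formsVanishingOn V₃ ∧
      s₂ ∈ formsVanishingOn V₃ := by
  obtain ⟨v, hv, hv₁⟩ := exists_kernel s₁
  let f : (Fin 5 → k) →ₗ[k] k := form (RingHom.id k) s₂ v
  have hvU : v ∈ LinearMap.ker f := form_self (RingHom.id k) s₂ v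
  have hU : 4 ≤ Module.finrank k (LinearMap.ker f) := by
    have h2 := f.finrank_range_add_finrank_ker
    have h3 : Module.finrank k (LinearMap.range f) ≤ 1 :=
      (Submodule.finrank_le _).trans (Module.finrank_self k).le
    rw [Module.finrank_fin_fun] at h2
    omega
  obtain ⟨b', hb', hb0⟩ := exists_linearIndependent_cons (v := (⟨v, hvU⟩ : LinearMap.ker f))
    (fun h ↦ hv (congrArg Subtype.val h)) hU
  let b : Fin 4 → Fin 5 → k := fun i ↦ (b' i : Fin 5 → k)
  have hb : LinearIndependent k b := hb'.map' (LinearMap.ker f).subtype (Submodule.ker_subtype _)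
  have hbv : b 0 = v := congrArg Subtype.val hb0
  have hb₁ : ∀ j, altForm s₁ (b 0) (b j) = 0 := fun j ↦ hbv ▸ hv₁ _
  have hb₂ : ∀ j, altForm s₂ (b 0) (b j) = 0 := fun j ↦ hbv ▸ (b' j).2
  let p : (Pairs → k) → Fin 3 → k := fun s ↦
    ![altForm s (b 2) (b 3), altForm s (b 3) (b 1), altForm s (b 1) (b 2)]
  -- The zero row only makes the matrix square; `l` is the equation of a plane containing `p s₁` and
  -- `p s₂`.
  obtain ⟨l, hl, hlp⟩ := Matrix.exists_mulVec_eq_zero_iff.mpr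
    (show Matrix.det (Matrix.of ![p s₁, p s₂, 0]) = 0 from
      Matrix.det_eq_zero_of_row_eq_zero 2 fun j ↦ rfl)
  let g : (Fin 4 → k) →ₗ[k] k := ∑ j : Fin 3, l j • LinearMap.proj j.succ
  have hg : ∀ x, g x = l 0 * x 1 + l 1 * x 2 + l 2 * x 3 := fun x ↦ by
    simp [g, Fin.sum_univ_three]
  have hg0 : g ≠ 0 := fun h0 ↦ hl (funext fun j ↦ by
    have := LinearMap.congr_fun h0 (Pi.single j.succ 1)
    simpa [g, Pi.single_apply] using this)
  let Φ : (Fin 4 → k) →ₗ[k] (Fin 5 → k) := Fintype.linearCombination k b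
  have hΦ : Function.Injective Φ := by
    rw [← LinearMap.ker_eq_bot]
    exact Fintype.linearIndependent_iff'.mp hb
  have hvan : ∀ s : Pairs → k, (∀ j, altForm s (b 0) (b j) = 0) →
      (p s 0 * l 0 + p s 1 * l 1 + p s 2 * l 2 = 0) →
        s ∈ formsVanishingOn ((LinearMap.ker g).map Φ) := by
    rintro s hs hps _ ⟨x, hx, rfl⟩ _ ⟨y, hy, rfl⟩
    have hx' : g x = 0 := hx
    have hy' : g y = 0 := hy
    rw [hg] at hx' hy'
    simp only [Φ, Fintype.linearCombination_apply]
    rw [altForm_of_kernel hs]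
    -- All three rows lie in the plane with equation `l`, so the determinant vanishes.
    refine Matrix.exists_mulVec_eq_zero_iff.mp ⟨l, hl, ?_⟩
    funext i
    fin_cases i
    · simpa [Matrix.mulVec, dotProduct, Fin.sum_univ_three, p] using hps
    · simp [Matrix.mulVec, dotProduct, Fin.sum_univ_three]
      linear_combination hx'
    · simp [Matrix.mulVec, dotProduct, Fin.sum_univ_three]
      linear_combination hy'
  refine ⟨(LinearMap.ker g).map Φ, ?_, hvan s₁ hb₁ ?_, hvan s₂ hb₂ ?_⟩
  · rw [← (Submodule.equivMapOfInjective Φ hΦ (LinearMap.ker g)).finrank_eq]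
    have h1 := g.finrank_range_add_finrank_ker
    rw [LinearMap.range_eq_top.mpr (LinearMap.surjective hg0), finrank_top, Module.finrank_self,
      Module.finrank_fin_fun] at h1
    omega
  · have := congrFun hlp 0
    simpa [Matrix.mulVec, dotProduct, Fin.sum_univ_three] using this
  · have := congrFun hlp 1
    simpa [Matrix.mulVec, dotProduct, Fin.sum_univ_three] using this

/-- It is the kernel of the surjective restriction `Λ² V^∨ → Λ² V₃^∨`, and `10 - 3 = 7`. -/
theorem finrank_formsVanishingOn (V₃ : Submodule k (Fin 5 → k)) (hV : Module.finrank k V₃ = 3) :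
    Module.finrank k (formsVanishingOn V₃) = 7 := by
  let b := Module.finBasisOfFinrankEq k V₃ hV
  choose γ' hγ' using fun i ↦ LinearMap.exists_extend (b.coord i)
  choose γ hγ using fun i ↦ exists_dotProduct_eq (γ' i)
  have hγb : ∀ i j, γ i ⬝ᵥ (b j : Fin 5 → k) = if j = i then 1 else 0 := fun i j ↦ by
    rw [hγ]
    have := LinearMap.congr_fun (hγ' i) (b j)
    simpa [Finsupp.single_apply] using this
  let r : (Pairs → k) →ₗ[k] (Fin 3 → k) :=
    { toFun := fun s ↦ ![altForm s (b 0) (b 1), altForm s (b 0) (b 2), altForm s (b 1) (b 2)]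
      map_add' := fun s s' ↦ by simp [altForm_add]
      map_smul' := fun c s ↦ by simp [altForm_smul] }
  have hker : LinearMap.ker r = formsVanishingOn V₃ := by
    ext s
    constructor
    · intro hs x hx y hy
      have h0 := congrFun (show r s = 0 from hs) 0
      have h1 := congrFun (show r s = 0 from hs) 1
      have h2 := congrFun (show r s = 0 from hs) 2
      simp only [r, LinearMap.coe_mk, AddHom.coe_mk, Matrix.cons_val_zero, Matrix.cons_val_one,
        Matrix.cons_val, Pi.zero_apply] at h0 h1 h2
      have ex := congrArg Subtype.val (b.sum_repr ⟨x, hx⟩)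
      have ey := congrArg Subtype.val (b.sum_repr ⟨y, hy⟩)
      simp only [Fin.sum_univ_three, Submodule.coe_add, Submodule.coe_smul] at ex ey
      rw [← ex, ← ey]
      simp only [altForm_add_left, altForm_add_right, altForm_smul_left, altForm_smul_right,
        altForm_self, altForm_swap s (b 1) (b 0), altForm_swap s (b 2) (b 0),
        altForm_swap s (b 2) (b 1), h0, h1, h2]
      ring
    · intro hs
      refine LinearMap.mem_ker.mpr (funext fun i ↦ ?_)
      fin_cases i
      · exact hs _ (b 0).2 _ (b 1).2
      · exact hs _ (b 0).2 _ (b 2).2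
      · exact hs _ (b 1).2 _ (b 2).2
  have hsurj : Function.Surjective r := by
    intro y
    refine ⟨y 0 • wedge (γ 0) (γ 1) + y 1 • wedge (γ 0) (γ 2) + y 2 • wedge (γ 1) (γ 2), ?_⟩
    funext i
    fin_cases i <;> simp [r, altForm_add, altForm_smul, altForm_wedge, hγb]
  have h1 := r.finrank_range_add_finrank_ker
  have h2 : Module.finrank k (Pairs → k) = 10 := by
    rw [Module.finrank_fintype_fun_eq_card]
    rfl
  rw [LinearMap.range_eq_top.mpr hsurj, finrank_top, hker, Module.finrank_fin_fun, h2] at h1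
  omega

/-- The remaining coordinates form a basis of a complement `Q` of `L ⊕ ⟨ω⟩` in the forms vanishing
on `V₃`; its dimension is `7 - dim L - 1 = n`, because `L` does not contain `ω`. -/
theorem exists_isProjectionCoordinates {n : ℕ} (L : Submodule k (Pairs → k))
    (V₃ : Submodule k (Fin 5 → k)) (hV : Module.finrank k V₃ = 3) (hL : L ≤ formsVanishingOn V₃)
    (hn : Module.finrank k L + n = 6) (hdisj : Disjoint L (formsWithKernel V₃)) :
    ∃ ζ : Fin (n + 1) → Pairs → k, IsProjectionCoordinates L V₃ ζ := by
  obtain ⟨α, β, a₁, a₂, hf⟩ := exists_isCoframe V₃ hV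
  set ω := wedge α β with hω
  have hω0 : ω ≠ 0 := fun h ↦ by
    have := hf.altForm_wedge_self
    rw [← hω, h] at this
    simp [altForm] at this
  have hspan : Submodule.span k {ω} = formsWithKernel V₃ := by
    refine le_antisymm ?_ fun s hs ↦ ?_
    · rw [Submodule.span_singleton_le_iff_mem]
      exact hf.wedge_mem
    · rw [hf.eq_smul_wedge hs]
      exact Submodule.smul_mem _ _ (Submodule.mem_span_singleton_self _)
  set W := L ⊔ Submodule.span k {ω} with hW
  have hle : W ≤ formsVanishingOn V₃ := sup_le hL (by
    rw [Submodule.span_singleton_le_iff_mem]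
    exact hf.wedge_left_mem β)
  obtain ⟨Q', hQ'⟩ := Submodule.exists_isCompl (W.comap (formsVanishingOn V₃).subtype)
  set Q := Q'.map (formsVanishingOn V₃).subtype with hQ
  have hWQ : Disjoint W Q := by
    rw [Submodule.disjoint_def]
    rintro _ hx ⟨x, hx', rfl⟩
    rw [Submodule.disjoint_def.mp hQ'.disjoint x hx hx', map_zero]
  have hWQ' : W ⊔ Q = formsVanishingOn V₃ := by
    have h1 := congrArg (Submodule.map (formsVanishingOn V₃).subtype) hQ'.sup_eq_top
    rwa [Submodule.map_sup, Submodule.map_comap_subtype, inf_eq_right.mpr hle,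
      Submodule.map_subtype_top] at h1
  have hQn : Module.finrank k Q = n := by
    have h1 := Submodule.finrank_sup_add_finrank_inf_eq W Q
    rw [hWQ', hWQ.eq_bot, finrank_bot, finrank_formsVanishingOn V₃ hV] at h1
    have h2 := Submodule.finrank_sup_add_finrank_inf_eq L (Submodule.span k {ω})
    rw [hspan, hdisj.eq_bot, finrank_bot, ← hspan, finrank_span_singleton hω0, ← hW] at h2
    omega
  let q := Module.finBasisOfFinrankEq k Q hQn
  let q' : Fin n → Pairs → k := fun i ↦ q i
  have hq' : Submodule.span k (Set.range q') = Q := by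
    have h1 := congrArg (Submodule.map Q.subtype) q.span_eq
    rw [Submodule.map_span, Submodule.map_subtype_top, ← Set.range_comp] at h1
    exact h1
  have hωW : ω ∈ W := Submodule.mem_sup_right (Submodule.mem_span_singleton_self _)
  have hζspan : Submodule.span k (Set.range (Fin.cons ω q' : Fin (n + 1) → Pairs → k)) =
      Submodule.span k {ω} ⊔ Q := by
    rw [Fin.range_cons, Submodule.span_insert, hq']
  refine ⟨Fin.cons ω q', ?_, ?_, ?_, ?_⟩
  · rw [linearIndependent_finCons]
    refine ⟨q.linearIndependent.map' Q.subtype Q.ker_subtype, fun h ↦ ?_⟩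
    rw [hq'] at h
    exact hω0 (Submodule.disjoint_def.mp hWQ _ hωW h)
  · rw [hζspan, Submodule.disjoint_def]
    intro x hx hxL
    obtain ⟨y, hy, z, hz, rfl⟩ := Submodule.mem_sup.mp hx
    have hzW : z ∈ W := by
      have := sub_mem (Submodule.mem_sup_left hxL : y + z ∈ W) (Submodule.mem_sup_right hy)
      rwa [add_sub_cancel_left] at this
    have hz0 := Submodule.disjoint_def.mp hWQ _ hzW hz
    rw [hz0, add_zero] at hxL ⊢
    exact Submodule.disjoint_def.mp hdisj _ hxL (hspan ▸ hy)
  · rw [hζspan, ← hWQ', hW]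
    ac_rfl
  · rw [Fin.cons_zero, hspan]

end Pencils

/-! ### Points with values in rings -/

section RingPoints

variable {k : Type u} [Field k] {B : Type u} [CommRing B]

/-- The spectrum of a `k`-algebra as a `k`-scheme. -/
noncomputable def specOver (φ : k →+* B) : Over (Spec (.of k)) :=
  Over.mk (Spec.map (CommRingCat.ofHom φ))

/-- The elements of `B` as functions on the spectrum. -/
noncomputable def toΓ (φ : k →+* B) : B ≃+* Γ((specOver φ).left, ⊤) :=
  (Scheme.ΓSpecIso (.of B)).symm.commRingCatIsoToRingEquiv

theorem toΓ_scalars (φ : k →+* B) (c : k) : toΓ φ (φ c) = scalars (specOver φ) c :=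
  congrArg (fun f : CommRingCat.of k ⟶ Γ(Spec (.of B), ⊤) ↦ f.hom c)
    (Scheme.ΓSpecIso_inv_naturality (CommRingCat.ofHom φ))

theorem toΓ_comp (φ : k →+* B) :
    (toΓ φ : B →+* Γ((specOver φ).left, ⊤)).comp φ = scalars (specOver φ) :=
  RingHom.ext fun c ↦ toΓ_scalars φ c

/-- The morphism of spectra given by a homomorphism of `k`-algebras. -/
noncomputable def specMap (φ : k →+* B) {C : Type u} [CommRing C] (ψ : B →+* C) :
    specOver (ψ.comp φ) ⟶ specOver φ :=
  Over.homMk (Spec.map (CommRingCat.ofHom ψ)) (Spec.map_comp _ _).symm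

theorem pull_toΓ (φ : k →+* B) {C : Type u} [CommRing C] (ψ : B →+* C) (b : B) :
    pull (specMap φ ψ) (toΓ φ b) = toΓ (ψ.comp φ) (ψ b) :=
  (congrArg (fun f : CommRingCat.of B ⟶ Γ(Spec (.of C), ⊤) ↦ f.hom b)
    (Scheme.ΓSpecIso_inv_naturality (CommRingCat.ofHom ψ))).symm

variable {L : Submodule k (Pairs → k)}

theorem isSectionPoint_toΓ_iff (φ : k →+* B) (w : Pairs → B) :
    IsSectionPoint (scalars (specOver φ)) L (fun p ↦ toΓ φ (w p)) ↔ IsSectionPoint φ L w := by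
  constructor
  · intro h
    have := h.map ((toΓ φ).symm : _ →+* B)
    rw [← toΓ_comp φ, ← RingHom.comp_assoc] at this
    simpa using this
  · intro h
    have := h.map (toΓ φ : B →+* Γ((specOver φ).left, ⊤))
    rwa [toΓ_comp] at this

/-- The `B`-point of the linear section with given homogeneous coordinates. -/
theorem exists_specPoint (φ : k →+* B) {w : Pairs → B} (hw : Ideal.span (Set.range w) = ⊤)
    (h : IsSectionPoint φ L w) :
    ∃ x : specOver φ ⟶ linearSection L,
      HasCoords _ (x.left ≫ linearSectionEmb L) fun p ↦ toΓ φ (w p) := by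
  refine exists_hasCoords_linearSection ?_ ((isSectionPoint_toΓ_iff φ w).mpr h)
  have := congrArg (Ideal.map (toΓ φ : B →+* Γ((specOver φ).left, ⊤))) hw
  rwa [Ideal.map_span, Ideal.map_top, ← Set.range_comp] at this

theorem exists_toΓ_coords {ι : Type} (φ : k →+* B) (m : (specOver φ).left ⟶ PSpace ι k)
    (hm : m ≫ pspaceToSpec ι k = (specOver φ).hom) (p : ι)
    (h : Set.range m ⊆ (Proj.basicOpen (MvPolynomial.homogeneousSubmodule ι k)
      (MvPolynomial.X p) : (PSpace ι k).Opens)) :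
    ∃ w : ι → B, w p = 1 ∧ HasCoords _ m fun p ↦ toΓ φ (w p) := by
  obtain ⟨w, hp, hw⟩ := exists_hasCoords_of_range_subset m hm p h
  refine ⟨fun p ↦ (toΓ φ).symm (w p), by simp [hp], ?_⟩
  simpa using hw

theorem smooth_specMap_chart (hsmooth : Smooth (linearSection L).hom) (p : Pairs) :
    ∃ κ : k →+* HomogeneousLocalization.Away (quotGrading (sectionIdeal L))
        (quotGradedHom (sectionIdeal L) (MvPolynomial.X p)),
      chartι (sectionIdeal L) p ≫ (linearSection L).hom = Spec.map (CommRingCat.ofHom κ) ∧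
        κ.Smooth := by
  obtain ⟨κ, hκ⟩ := Spec.map_surjective (chartι (sectionIdeal L) p ≫ (linearSection L).hom)
  refine ⟨κ.hom, hκ.symm, ?_⟩
  have h1 : Smooth (chartι (sectionIdeal L) p) := inferInstance
  have h : Smooth (chartι (sectionIdeal L) p ≫ (linearSection L).hom) :=
    @smooth_comp _ _ _ _ _ h1 hsmooth
  rw [← hκ, HasRingHomProperty.Spec_iff (P := @Smooth)] at h
  exact h

theorem exists_lift_of_ringHom_smooth {A R C : Type u} [CommRing A] [CommRing R] [CommRing C]
    {κ : A →+* R} (hκ : κ.Smooth) (φ : A →+* C) (I : Ideal C) (hI : IsNilpotent I)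
    {g : R →+* C ⧸ I} (hg : g.comp κ = (Ideal.Quotient.mk I).comp φ) :
    ∃ ψ : R →+* C, (Ideal.Quotient.mk I).comp ψ = g ∧ ψ.comp κ = φ := by
  algebraize [κ, φ]
  let g' : R →ₐ[A] C ⧸ I := { g with commutes' := fun a ↦ RingHom.congr_fun hg a }
  refine ⟨Algebra.FormallySmooth.lift I hI g', RingHom.ext fun x ↦
    Algebra.FormallySmooth.mk_lift I hI g' x, RingHom.ext fun a ↦
      (Algebra.FormallySmooth.lift I hI g').commutes a⟩

/-- Infinitesimal lifting of points of a smooth linear section. -/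
theorem exists_lift_of_smooth (hsmooth : Smooth (linearSection L).hom) (φ : k →+* B)
    (I : Ideal B) (hI : IsNilpotent I) {w : Pairs → B ⧸ I} {p : Pairs} (hp : w p = 1)
    (hw : IsSectionPoint ((Ideal.Quotient.mk I).comp φ) L w) :
    ∃ v : Pairs → B, IsSectionPoint φ L v ∧ v p = 1 ∧ ∀ q, Ideal.Quotient.mk I (v q) = w q := by
  set J := sectionIdeal L
  obtain ⟨κ, hκ, hκs⟩ := smooth_specMap_chart hsmooth p
  obtain ⟨x, hx⟩ := exists_specPoint ((Ideal.Quotient.mk I).comp φ)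
    (span_eq_top_of_isUnit (i := p) (hp ▸ isUnit_one)) hw
  have hxr : Set.range (x.left ≫ linearSectionEmb L) ⊆
      (Proj.basicOpen (MvPolynomial.homogeneousSubmodule Pairs k)
      (MvPolynomial.X p) : (PSpace Pairs k).Opens) := by
    have h1 := hx.preimage_basicOpen one_pos (X_mem p)
    rw [Scheme.basicOpen_of_isUnit _ (by simp [hp])] at h1
    rintro _ ⟨t, rfl⟩
    exact h1.ge (Set.mem_univ t)
  -- As `w p = 1`, the point lies in one affine chart, and lifting becomes formal smoothness of the
  -- coordinate ring of this chart.
  obtain ⟨y, hy⟩ := exists_lift_chart J x.left p hxr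
  obtain ⟨ψ', rfl⟩ := Spec.map_surjective y
  have hcomm : ψ'.hom.comp κ = (Ideal.Quotient.mk I).comp φ := by
    have h1 := Over.w x
    rw [hy] at h1
    have h2 : Spec.map ψ' ≫ Spec.map (CommRingCat.ofHom κ) =
        Spec.map (CommRingCat.ofHom ((Ideal.Quotient.mk I).comp φ)) := by
      rw [← hκ]
      exact (Category.assoc _ _ _).symm.trans h1
    rw [← Spec.map_comp] at h2
    exact congrArg CommRingCat.Hom.hom (Spec.map_injective h2)
  obtain ⟨ψ, hψ, hψk⟩ := exists_lift_of_ringHom_smooth hκs φ I hI hcomm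
  let z : specOver φ ⟶ linearSection L := Over.homMk
    (Spec.map (CommRingCat.ofHom ψ) ≫ chartι J p) (by
      refine (Category.assoc _ _ _).trans ?_
      refine (congrArg (_ ≫ ·) hκ).trans ((Spec.map_comp _ _).symm.trans ?_)
      exact congrArg (fun f ↦ Spec.map (CommRingCat.ofHom f)) hψk)
  have hzr : Set.range (z.left ≫ linearSectionEmb L) ⊆
      (Proj.basicOpen (MvPolynomial.homogeneousSubmodule Pairs k)
      (MvPolynomial.X p) : (PSpace Pairs k).Opens) := by
    rintro _ ⟨t, rfl⟩
    have h1 : z.left t ∈ projSubschemeBasicOpen J (MvPolynomial.X p) := by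
      rw [← opensRange_chartι]
      exact ⟨Spec.map (CommRingCat.ofHom ψ) t, rfl⟩
    exact h1
  obtain ⟨v, hvp, hv⟩ := exists_toΓ_coords φ _ (point_over z) p hzr
  refine ⟨v, (isSectionPoint_toΓ_iff φ v).mp hv.isSectionPoint, hvp, ?_⟩
  have hxz : specMap φ (Ideal.Quotient.mk I) ≫ z = x := by
    ext1
    refine Eq.trans ?_ hy.symm
    refine (Category.assoc _ _ _).symm.trans (congrArg (· ≫ _) ?_)
    exact (Spec.map_comp _ _).symm.trans (congrArg (fun f ↦ Spec.map (CommRingCat.ofHom f)) hψ)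
  have h1 := hv.comp (specMap φ (Ideal.Quotient.mk I))
  rw [← Category.assoc, ← Over.comp_left, hxz] at h1
  simp only [pull_toΓ] at h1
  -- The normalization at `p` makes this unit 1, so the coordinates themselves lift, not only the
  -- projective point.
  obtain ⟨c, -, hc⟩ := hx.exists_isUnit h1
  have hc1 : c = 1 := by
    have := congrFun hc p
    simpa [hvp, hp] using this.symm
  intro q
  have := congrFun hc q
  rw [hc1, one_mul] at this
  exact (toΓ _).injective this

end RingPoints

/-! ### Smooth linear sections contain no form of rank two -/

section RankTwo

variable {R : Type u} [CommRing R]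

theorem altForm_eq_zero_of_basis {K : Type u} [Field K] {M : Submodule K (Fin 5 → K)}
    (b : Module.Basis (Fin 3) K M) {ω : Pairs → K} {v : Fin 5 → K}
    (h : ∀ j, altForm ω v (b j) = 0) {y : Fin 5 → K} (hy : y ∈ M) : altForm ω v y = 0 := by
  have e := congrArg Subtype.val (b.sum_repr ⟨y, hy⟩)
  simp only [Fin.sum_univ_three, Submodule.coe_add, Submodule.coe_smul] at e
  rw [← e]
  simp only [altForm_add_right, altForm_smul_right, h]
  ring

theorem wedge_ne_zero {K : Type u} [Field K] {x y : Fin 5 → K} (hx : x ≠ 0)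
    (hy : y ∉ Submodule.span K {x}) : wedge x y ≠ 0 := by
  intro h
  obtain ⟨i, hi⟩ := Function.ne_iff.mp hx
  refine hy (Submodule.mem_span_singleton.mpr ⟨y i / x i, funext fun j ↦ ?_⟩)
  have hij : x i * y j - x j * y i = 0 := by
    rcases lt_trichotomy i j with hlt | rfl | hlt
    · exact congrFun h ⟨(i, j), hlt⟩
    · ring
    · have := congrFun h ⟨(j, i), hlt⟩
      simp only [wedge, Pi.zero_apply] at this
      linear_combination -this
  simp only [Pi.smul_apply, smul_eq_mul]
  simp only [Pi.zero_apply] at hi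
  field_simp
  linear_combination -hij

/-- The tangent vector at a singular point. -/
theorem exists_tangent {K : Type u} [Field K] (M : Submodule K (Fin 5 → K))
    (hM : Module.finrank K M = 3) {ω : Pairs → K} (hω : ω ∈ formsWithKernel M) (hω0 : ω ≠ 0)
    (ω' : Pairs → K) :
    ∃ w₁ ∈ M, ∃ w₂ ∈ M, ∃ x y, wedge w₁ w₂ ≠ 0 ∧ altForm ω' w₁ w₂ = 0 ∧ altForm ω x y ≠ 0 ∧
      altForm ω' x w₂ + altForm ω' w₁ y = 0 := by
  obtain ⟨α, β, x₀, y₀, hf⟩ := exists_isCoframe M hM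
  have h0 : altForm ω x₀ y₀ ≠ 0 := fun h ↦ hω0 (by rw [hf.eq_smul_wedge hω, h, zero_smul])
  let b := Module.finBasisOfFinrankEq K M hM
  -- If `ω'` vanishes on `M`, two linear conditions on the three-dimensional `M` leave a nonzero
  -- `w₂` in the kernel of `ω'`; only `ω'(w₁, y) = 0` remains to be arranged.
  by_cases hM' : ω' ∈ formsVanishingOn M
  · let f : M →ₗ[K] (Fin 2 → K) := LinearMap.pi
      ![form (RingHom.id K) ω' x₀ ∘ₗ M.subtype, form (RingHom.id K) ω' y₀ ∘ₗ M.subtype]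
    have hker : LinearMap.ker f ≠ ⊥ := by
      refine LinearMap.ker_ne_bot_of_finrank_lt ?_
      rw [hM, Module.finrank_fin_fun]
      norm_num
    obtain ⟨w₂, hw₂, hne⟩ := Submodule.exists_mem_ne_zero_of_ne_bot hker
    have h1 : altForm ω' x₀ w₂ = 0 := congrFun (show f w₂ = 0 from hw₂) 0
    have h2 : altForm ω' y₀ w₂ = 0 := congrFun (show f w₂ = 0 from hw₂) 1
    have hall : ∀ x, altForm ω' x w₂ = 0 := fun x ↦ by
      rw [hf.altForm_of_mem_right hM' x w₂.2, h1, h2]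
      ring
    have hne' : (w₂ : Fin 5 → K) ≠ 0 := fun h ↦ hne (Subtype.ext h)
    obtain ⟨w₁, hw₁, hw⟩ : ∃ w₁ ∈ M, w₁ ∉ Submodule.span K {(w₂ : Fin 5 → K)} := by
      by_contra! hcon
      have := Submodule.finrank_mono (show M ≤ Submodule.span K {(w₂ : Fin 5 → K)} from hcon)
      rw [hM, finrank_span_singleton hne'] at this
      omega
    have hwedge : wedge w₁ w₂ ≠ 0 := fun h ↦ wedge_ne_zero hne' hw (by
      funext p
      have := congrFun h p
      simp only [wedge, Pi.zero_apply] at this ⊢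
      linear_combination -this)
    by_cases hg : altForm ω' w₁ y₀ = 0
    · exact ⟨w₁, hw₁, w₂, w₂.2, x₀, y₀, hwedge, hall _, h0, by rw [hall, hg, add_zero]⟩
    -- The second vector is the combination of `x₀` and `y₀` killed by `ω'(w₁, ·)`.
    · refine ⟨w₁, hw₁, w₂, w₂.2, y₀, altForm ω' w₁ y₀ • x₀ - altForm ω' w₁ x₀ • y₀, hwedge, hall _,
        ?_, ?_⟩
      · rw [altForm_sub_right, altForm_smul_right, altForm_smul_right, altForm_self,
          altForm_swap ω y₀ x₀]
        simpa using ⟨hg, h0⟩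
      · rw [hall, altForm_sub_right, altForm_smul_right, altForm_smul_right]
        ring
  · obtain ⟨m, hm, w₂, hw₂, hmw⟩ : ∃ m ∈ M, ∃ w₂ ∈ M, altForm ω' m w₂ ≠ 0 := by
      by_contra! hcon
      exact hM' hcon
    -- The cross-product formula for the vector spanning the radical of the nonzero restriction of
    -- `ω'` to `M`.
    let w₁ : Fin 5 → K := altForm ω' (b 1) (b 2) • (b 0 : Fin 5 → K) +
      altForm ω' (b 2) (b 0) • (b 1 : Fin 5 → K) + altForm ω' (b 0) (b 1) • (b 2 : Fin 5 → K)
    have hw₁ : w₁ ∈ M := add_mem (add_mem (M.smul_mem _ (b 0).2) (M.smul_mem _ (b 1).2))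
      (M.smul_mem _ (b 2).2)
    have hker : ∀ y ∈ M, altForm ω' w₁ y = 0 := fun y hy ↦ by
      refine altForm_eq_zero_of_basis b (fun j ↦ ?_) hy
      simp only [w₁, altForm_add_left, altForm_smul_left]
      fin_cases j
      · simp only [Fin.zero_eta, altForm_self, altForm_swap ω' (b 2) (b 0),
          altForm_swap ω' (b 1) (b 0)]
        ring
      · simp only [Fin.mk_one, altForm_self, altForm_swap ω' (b 2) (b 1)]
        ring
      · simp only [Fin.reduceFinMk, altForm_self, altForm_swap ω' (b 2) (b 0)]
        ring
    have hw₁0 : w₁ ≠ 0 := by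
      intro h
      have hz : altForm ω' (b 1) (b 2) • b 0 + altForm ω' (b 2) (b 0) • b 1 +
          altForm ω' (b 0) (b 1) • b 2 = 0 := Subtype.ext h
      have hli := Fintype.linearIndependent_iff.mp b.linearIndependent
        ![altForm ω' (b 1) (b 2), altForm ω' (b 2) (b 0), altForm ω' (b 0) (b 1)]
        (by rw [Fin.sum_univ_three]; exact hz)
      have e0 := hli 0
      have e1 := hli 1
      have e2 := hli 2
      simp only [Matrix.cons_val_zero, Matrix.cons_val_one, Matrix.cons_val] at e0 e1 e2
      refine hmw (altForm_eq_zero_of_basis b (fun j ↦ ?_) hw₂)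
      rw [altForm_swap, neg_eq_zero]
      refine altForm_eq_zero_of_basis b (fun i ↦ ?_) hm
      fin_cases j <;> fin_cases i <;>
        simp [altForm_self, e0, e1, e2, altForm_swap ω' (b 1) (b 0), altForm_swap ω' (b 2) (b 1),
          altForm_swap ω' (b 0) (b 2)]
    have hspan : w₂ ∉ Submodule.span K {w₁} := by
      intro h
      obtain ⟨r, rfl⟩ := Submodule.mem_span_singleton.mp h
      rw [altForm_smul_right, altForm_swap, hker m hm] at hmw
      simp at hmw
    -- The correction by a multiple of `m` achieves tangency and does not affect `ω(x₀, y₀)`,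
    -- because `m` lies in the kernel of `ω`.
    refine ⟨w₁, hw₁, w₂, hw₂,
      x₀ - ((altForm ω' x₀ w₂ + altForm ω' w₁ y₀) / altForm ω' m w₂) • m, y₀,
      wedge_ne_zero hw₁0 hspan, hker _ hw₂, ?_, ?_⟩
    · rw [altForm_sub_left, altForm_smul_left, hω m hm]
      simpa using h0
    · rw [altForm_sub_left, altForm_smul_left, div_mul_cancel₀ _ hmw]
      ring

theorem skew_add (w w' : Pairs → R) (i : Fin 5) : skew (w + w') i = skew w i + skew w' i := by
  funext j
  rcases lt_trichotomy i j with h | rfl | h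
  · simp [skew, h]
  · simp [skew]
  · simp [skew, h, h.not_gt, add_comm]

theorem skew_smul (c : R) (w : Pairs → R) (i : Fin 5) : skew (c • w) i = c • skew w i := by
  funext j
  rcases lt_trichotomy i j with h | rfl | h
  · simp [skew, h]
  · simp [skew]
  · simp [skew, h, h.not_gt]

theorem skew_wedge (x y : Fin 5 → R) (i : Fin 5) : skew (wedge x y) i = x i • y - y i • x := by
  funext j
  rcases lt_trichotomy i j with h | rfl | h
  · simp [skew, h, wedge, mul_comm]
  · simp [skew, mul_comm]
  · simp [skew, h, h.not_gt, wedge, mul_comm]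

/-- This is `K[ε] / ε³`, the smallest ring in which a second-order obstruction is visible. -/
theorem exists_truncated_polynomials (K : Type u) [Field K] :
    ∃ (B : Type u) (_ : CommRing B) (ι : K →+* B) (ε : B), ε ^ 3 = 0 ∧
      ∀ c, ε ^ 2 * ι c = 0 → c = 0 := by
  refine ⟨Polynomial K ⧸ Ideal.span {(Polynomial.X ^ 3 : Polynomial K)}, inferInstance,
    (Ideal.Quotient.mk _).comp Polynomial.C, Ideal.Quotient.mk _ Polynomial.X, ?_, fun c hc ↦ ?_⟩
  · rw [← map_pow]
    exact Ideal.Quotient.eq_zero_iff_mem.mpr (Ideal.mem_span_singleton_self _)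
  · rw [RingHom.comp_apply, ← map_pow, ← map_mul, Ideal.Quotient.eq_zero_iff_mem,
      Ideal.mem_span_singleton, Polynomial.X_pow_dvd_iff] at hc
    simpa [Polynomial.coeff_X_pow_mul'] using hc 2 (by norm_num)

theorem form_eq_zero_of_mem {K B : Type u} [Field K] [CommRing B] (ι : K →+* B)
    {M : Submodule K (Fin 5 → K)} {ω : Pairs → K} (hω : ω ∈ formsWithKernel M) {w : Fin 5 → K}
    (hw : w ∈ M) (z : Fin 5 → B) : form ι ω (fun i ↦ ι (w i)) z = 0 := by
  have h : form ι ω (fun i ↦ ι (w i)) = 0 := (Pi.basisFun B (Fin 5)).ext fun j ↦ by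
    have e : Pi.basisFun B (Fin 5) j = fun i ↦ ι ((Pi.single j 1 : Fin 5 → K) i) := by
      funext i
      by_cases hij : i = j <;> simp [hij]
    rw [e, form_map, hω w hw, map_zero, LinearMap.zero_apply]
  rw [h, LinearMap.zero_apply]

/-- If all forms in `L` are combinations of `ω` and `ω'` over `K`, and `ω` lies in the span of `L`
over `K`, then `ω` does not have rank two. -/
theorem eq_zero_of_mem_formsWithKernel_aux {k K : Type u} [Field k] [Field K]
    {L : Submodule k (Pairs → k)} (hsmooth : Smooth (linearSection L).hom) (φ : k →+* K)
    {M : Submodule K (Fin 5 → K)} (hM : Module.finrank K M = 3) {ω ω' : Pairs → K}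
    (hω : ω ∈ formsWithKernel M)
    (hL : ∀ s ∈ L, ∃ a b : K, (fun p ↦ φ (s p)) = a • ω + b • ω')
    (hvan : ∀ (B : Type u) [CommRing B] (ι : K →+* B) (v : Pairs → B),
      IsSectionPoint (ι.comp φ) L v → pairing ι ω v = 0) : ω = 0 := by
  by_contra hω0
  -- The differential of `ω` vanishes at `w₁ ∧ w₂`, so `(x, y)` is a tangent vector of the section;
  -- `ω(x, y) ≠ 0` will obstruct its extension to second order.
  obtain ⟨w₁, hw₁, w₂, hw₂, x, y, hne, h0, hxy, h1⟩ := exists_tangent M hM hω hω0 ω'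
  obtain ⟨B, _, ι, ε, hε, hinj⟩ := exists_truncated_polynomials K
  obtain ⟨p, hp⟩ := Function.ne_iff.mp hne
  let I : Ideal B := Ideal.span {ε ^ 2}
  have hI : IsNilpotent I := ⟨2, by
    rw [Ideal.span_singleton_pow, Ideal.zero_eq_bot, Ideal.span_singleton_eq_bot]
    linear_combination ε * hε⟩
  let X : Fin 5 → B := (fun i ↦ ι (w₁ i)) + ε • fun i ↦ ι (x i)
  let Y : Fin 5 → B := (fun i ↦ ι (w₂ i)) + ε • fun i ↦ ι (y i)
  have hunit : IsUnit (wedge X Y p) := by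
    have e : wedge X Y p = ι (wedge w₁ w₂ p) + ε * (ι (w₁ p.1.1) * ι (y p.1.2) +
        ι (x p.1.1) * ι (w₂ p.1.2) - ι (w₁ p.1.2) * ι (y p.1.1) - ι (x p.1.2) * ι (w₂ p.1.1) +
        ε * (ι (x p.1.1) * ι (y p.1.2) - ι (x p.1.2) * ι (y p.1.1))) := by
      simp only [wedge, X, Y, Pi.add_apply, Pi.smul_apply, smul_eq_mul, map_sub, map_mul]
      ring
    rw [e]
    refine IsNilpotent.isUnit_add_left_of_commute ?_ ((IsUnit.mk0 _ hp).map ι) (Commute.all _ _)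
    exact (Commute.all _ _).isNilpotent_mul_right ⟨3, hε⟩
  obtain ⟨u, hu⟩ := hunit.exists_left_inv
  -- Since `ω(w₁, ·) = 0`, the value `ω(X, z)` is divisible by `ε`, and `ε³ = 0`. So corrections of
  -- order `ε²` do not change the value of `ω`.
  have hX : ∀ z, ε ^ 2 * form ι ω X z = 0 := fun z ↦ by
    simp only [X, map_add, map_smul, LinearMap.add_apply, LinearMap.smul_apply, smul_eq_mul,
      form_eq_zero_of_mem ι hω hw₁]
    linear_combination hε * form ι ω (fun i ↦ ι (x i)) z
  have hY : ∀ z, ε ^ 2 * form ι ω Y z = 0 := fun z ↦ by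
    simp only [Y, map_add, map_smul, LinearMap.add_apply, LinearMap.smul_apply, smul_eq_mul,
      form_eq_zero_of_mem ι hω hw₂]
    linear_combination hε * form ι ω (fun i ↦ ι (y i)) z
  have hXY : form ι ω X Y = ε ^ 2 * ι (altForm ω x y) := by
    rw [← form_map]
    simp only [X, Y, map_add, map_smul, LinearMap.add_apply, LinearMap.smul_apply, smul_eq_mul,
      form_eq_zero_of_mem ι hω hw₁, form_swap ι ω (fun i ↦ ι (x i)) (fun i ↦ ι (w₂ i)),
      form_eq_zero_of_mem ι hω hw₂]
    ring
  have hXY' : form ι ω' X Y = ε ^ 2 * ι (altForm ω' x y) := by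
    have h1' := congrArg ι h1
    rw [map_add, map_zero] at h1'
    simp only [X, Y, map_add, map_smul, LinearMap.add_apply, LinearMap.smul_apply, smul_eq_mul,
      form_map, h0, map_zero]
    linear_combination ε * h1'
  have hsec : IsSectionPoint ((Ideal.Quotient.mk I).comp (ι.comp φ)) L
      fun q ↦ Ideal.Quotient.mk I (u * wedge X Y q) := by
    refine ⟨fun i j l m hij hjl hlm ↦ ?_, fun s hs ↦ ?_⟩
    · have := isPlucker_mul (isPlucker_wedge X Y) u i j l m hij hjl hlm
      rw [← map_mul, ← map_mul, ← map_mul, ← map_sub, ← map_add, this, map_zero]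
    · obtain ⟨a, b, hab⟩ := hL s hs
      rw [← map_pairing, Ideal.Quotient.eq_zero_iff_mem, Ideal.mem_span_singleton]
      have e : pairing (ι.comp φ) s (fun q ↦ u * wedge X Y q) =
          pairing ι (a • ω + b • ω') (fun q ↦ u * wedge X Y q) := by rw [← hab]; rfl
      rw [e, pairing_mul, pairing_add, pairing_smul, pairing_smul, pairing_wedge, pairing_wedge,
        hXY, hXY']
      exact ⟨u * (ι a * ι (altForm ω x y) + ι b * ι (altForm ω' x y)), by ring⟩
  obtain ⟨v, hv, hvp, hvw⟩ := exists_lift_of_smooth hsmooth (ι.comp φ) I hI (p := p)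
    (by rw [hu, map_one]) hsec
  have hQ : ∀ q, ∃ r, v q = u * wedge X Y q + ε ^ 2 * r := fun q ↦ by
    obtain ⟨r, hr⟩ := Ideal.mem_span_singleton.mp (Ideal.Quotient.eq.mp (hvw q))
    exact ⟨r, by rw [← hr]; ring⟩
  choose Q hQ using hQ
  have hvQ : v = u • wedge X Y + ε ^ 2 • Q := funext hQ
  have hvan' := hvan B ι v hv
  -- The lift is decomposable because `v p = 1`; its factors are `u (X_i Y - Y_i X)` up to `ε²`, for
  -- the two indices `i` of `p`.
  have hdec : v = wedge (skew v p.1.1) (skew v p.1.2) := by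
    simpa only [hvp, one_mul] using hv.1.mul_eq_wedge p
  rw [hdec, pairing_wedge, hvQ] at hvan'
  simp only [skew_add, skew_smul, skew_wedge] at hvan'
  set z₁ := skew Q p.1.1
  set z₂ := skew Q p.1.2
  have hX1 := hX z₁
  have hX2 := hX z₂
  have hY1 := hY z₁
  have hY2 := hY z₂
  simp only [map_add, map_sub, map_smul, LinearMap.add_apply, LinearMap.sub_apply,
    LinearMap.smul_apply, smul_eq_mul, form_self, form_swap ι ω z₁ X, form_swap ι ω z₁ Y,
    form_swap ι ω Y X, hXY] at hvan'
  refine hxy (hinj _ ?_)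
  have hnorm : u * (X p.1.1 * Y p.1.2 - X p.1.2 * Y p.1.1) = 1 := hu
  -- All cross terms with the correction vanish, so `ω(v) = u ε² ω(x, y)` with `u` a unit, whereas
  -- `ω(v) = 0`.
  linear_combination (X p.1.1 * Y p.1.2 - X p.1.2 * Y p.1.1) * (hvan' - u * (X p.1.1 * hY2 -
    Y p.1.1 * hX2 - X p.1.2 * hY1 + Y p.1.2 * hX1) - ε * form ι ω z₁ z₂ * hε) -
    ε ^ 2 * ι (altForm ω x y) * (u * (X p.1.1 * Y p.1.2 - X p.1.2 * Y p.1.1) + 1) * hnorm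

/-- Over no extension field does the span of a smooth linear section contain a form of rank two. -/
theorem eq_zero_of_mem_formsWithKernel {k K : Type u} [Field k] [Field K]
    {L : Submodule k (Pairs → k)} (hsmooth : Smooth (linearSection L).hom) (φ : k →+* K)
    {s₁ s₂ : Pairs → k} (h₁ : s₁ ∈ L) (h₂ : s₂ ∈ L)
    (hL : ∀ s ∈ L, ∃ l m : k, s = l • s₁ + m • s₂) {M : Submodule K (Fin 5 → K)}
    (hM : 3 ≤ Module.finrank K M) (l m : K)
    (hω : (l • (fun p ↦ φ (s₁ p)) + m • fun p ↦ φ (s₂ p)) ∈ formsWithKernel M) :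
    (l • (fun p ↦ φ (s₁ p)) + m • fun p ↦ φ (s₂ p)) = 0 := by
  -- A three-dimensional part of the kernel is all that the obstruction argument requires.
  obtain ⟨N, hN, hfin⟩ : ∃ N ≤ M, Module.finrank K N = 3 := by
    obtain ⟨f, hf⟩ := exists_linearIndependent_of_le_finrank hM
    refine ⟨Submodule.span K (Set.range (M.subtype ∘ f)), ?_, ?_⟩
    · rw [Submodule.span_le]
      rintro _ ⟨i, rfl⟩
      exact (f i).2
    · rw [finrank_span_eq_card (hf.map' M.subtype (Submodule.ker_subtype M)), Fintype.card_fin]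
  set ω := l • (fun p ↦ φ (s₁ p)) + m • fun p ↦ φ (s₂ p) with hωdef
  have hω' : ω ∈ formsWithKernel N := fun x hx y ↦ hω x (hN hx) y
  have hvan : ∀ (B : Type u) [CommRing B] (ι : K →+* B) (v : Pairs → B),
      IsSectionPoint (ι.comp φ) L v → pairing ι ω v = 0 := fun B _ ι v hv ↦ by
    have e₁ : pairing ι (fun p ↦ φ (s₁ p)) v = 0 := hv.2 s₁ h₁
    have e₂ : pairing ι (fun p ↦ φ (s₂ p)) v = 0 := hv.2 s₂ h₂
    rw [hωdef, pairing_add, pairing_smul, pairing_smul, e₁, e₂, mul_zero, mul_zero, add_zero]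
  -- If one of the coefficients of `ω` is nonzero, the corresponding generator is a combination of
  -- `ω` and the other generator, which serves as `ω'`.
  by_cases hl : l = 0
  · by_cases hm : m = 0
    · rw [hωdef, hl, hm, zero_smul, zero_smul, add_zero]
    · refine eq_zero_of_mem_formsWithKernel_aux hsmooth φ hfin (ω' := fun p ↦ φ (s₁ p)) hω'
        (fun s hs ↦ ?_) hvan
      obtain ⟨a, b, rfl⟩ := hL s hs
      refine ⟨φ b / m, φ a, funext fun p ↦ ?_⟩
      simp only [hωdef, Pi.add_apply, Pi.smul_apply, smul_eq_mul, map_add, map_mul, hl]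
      field_simp
      ring
  · refine eq_zero_of_mem_formsWithKernel_aux hsmooth φ hfin (ω' := fun p ↦ φ (s₂ p)) hω'
      (fun s hs ↦ ?_) hvan
    obtain ⟨a, b, rfl⟩ := hL s hs
    refine ⟨φ a / l, φ b - φ a * m / l, funext fun p ↦ ?_⟩
    simp only [hωdef, Pi.add_apply, Pi.smul_apply, smul_eq_mul, map_add, map_mul]
    field_simp
    ring

theorem disjoint_formsWithKernel {k : Type u} [Field k] {L : Submodule k (Pairs → k)}
    (hsmooth : Smooth (linearSection L).hom) (hL : Module.finrank k L ≤ 2)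
    {V₃ : Submodule k (Fin 5 → k)} (hV : Module.finrank k V₃ = 3) :
    Disjoint L (formsWithKernel V₃) := by
  obtain ⟨s₁, h₁, s₂, h₂, hs⟩ := exists_span_pair L hL
  rw [Submodule.disjoint_def]
  intro s hsL hs'
  obtain ⟨l, m, rfl⟩ := hs s hsL
  exact eq_zero_of_mem_formsWithKernel hsmooth (RingHom.id k) h₁ h₂ hs hV.ge l m hs'

end RankTwo

/-! ### Density of the complement of the special hyperplane section -/

section Density

variable {k : Type u} [Field k] {L : Submodule k (Pairs → k)}

/-- Any point of the scheme, closed or not, is seen over an algebraic closure of its residue field.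
-/
theorem exists_geometricPoint (x : (linearSection L).left) :
    ∃ (K : Type u) (_ : Field K) (_ : IsAlgClosed K) (φ : k →+* K) (w : Pairs → K) (p : Pairs)
      (y : specOver φ ⟶ linearSection L) (t : (specOver φ).left),
      w p = 1 ∧ HasCoords _ (y.left ≫ linearSectionEmb L) (fun p ↦ toΓ φ (w p)) ∧
        y.left t = x := by
  let X := (linearSection L).left
  let K := AlgebraicClosure (X.residueField x)
  let f : Spec (.of K) ⟶ X :=
    Spec.map (CommRingCat.ofHom (algebraMap (X.residueField x) K)) ≫ X.fromSpecResidueField x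
  obtain ⟨φ, hφ⟩ := Spec.map_surjective (f ≫ (linearSection L).hom)
  let y : specOver φ.hom ⟶ linearSection L := Over.homMk f hφ.symm
  let t : PrimeSpectrum K := ⊥
  have hsub : Subsingleton (specOver φ.hom).left :=
    inferInstanceAs (Subsingleton (PrimeSpectrum K))
  obtain ⟨p, hp⟩ := exists_mem_pspace_basicOpen ((y.left ≫ linearSectionEmb L) t)
  obtain ⟨w, hwp, hw⟩ := exists_toΓ_coords φ.hom _ (point_over y) p (by
    rintro _ ⟨t', rfl⟩
    rw [hsub.elim t' t]
    exact hp)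
  refine ⟨K, inferInstance, inferInstance, φ.hom, w, p, y, t, hwp, hw, ?_⟩
  have h : f t ∈ Set.range (X.fromSpecResidueField x) := ⟨_, rfl⟩
  rw [Scheme.range_fromSpecResidueField] at h
  exact h

/-- If a point is the specialization of a curve that generically lies outside the hyperplane
section defined by `s`, then it is in the closure of the complement of this section. -/
theorem mem_closure_nonvanishing_of_specialization {K R : Type u} [Field K] [CommRing R]
    [IsDomain R] [IsLocalRing R] {φ : k →+* K} {w : Pairs → K} {y : specOver φ ⟶ linearSection L}
    (hw : HasCoords _ (y.left ≫ linearSectionEmb L) fun p ↦ toΓ φ (w p))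
    (t : (specOver φ).left) (φ' : k →+* R) (ψ : R →+* K) [IsLocalHom ψ] (hφ : ψ.comp φ' = φ)
    {v : Pairs → R} (hv : IsSectionPoint φ' L v) (hvw : ∀ q, ψ (v q) = w q) {s : Pairs → k}
    (hs : pairing φ' s v ≠ 0) :
    y.left t ∈ closure (nonvanishing L s : Set (linearSection L).left) := by
  subst hφ
  -- Otherwise all coordinates would lie in the maximal ideal and specialize to zero, whereas `w`
  -- generates the unit ideal.
  have hspan : Ideal.span (Set.range v) = ⊤ := by
    by_contra hne
    have hle := IsLocalRing.le_maximalIdeal hne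
    have h1 : Ideal.span (Set.range w) = ⊤ := by
      obtain ⟨h, -⟩ := hw
      have := congrArg (Ideal.map ((toΓ (ψ.comp φ')).symm : _ →+* K)) h
      rw [Ideal.map_span, Ideal.map_top, ← Set.range_comp] at this
      simpa [Function.comp_def] using this
    have h2 : Ideal.span (Set.range w) ≤ ⊥ := by
      rw [Ideal.span_le]
      rintro _ ⟨q, rfl⟩
      have hq := hle (Ideal.subset_span ⟨q, rfl⟩)
      rw [IsLocalRing.mem_maximalIdeal, mem_nonunits_iff, ← isUnit_map_iff ψ, hvw,
        isUnit_iff_ne_zero, not_not] at hq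
      exact hq
    exact bot_ne_top (eq_top_iff.mpr (h1 ▸ h2))
  obtain ⟨z, hz⟩ := exists_specPoint φ' hspan hv
  have hyz : specMap φ' ψ ≫ z = y := by
    have h1 := hz.comp (specMap φ' ψ)
    simp only [pull_toΓ, hvw] at h1
    ext1
    rw [← cancel_mono (linearSectionEmb L)]
    exact (Category.assoc _ _ _).trans (h1.hom_ext hw)
  have hint : IsIntegral (specOver φ').left := inferInstanceAs (IsIntegral (Spec (.of R)))
  have hne : (z.left ⁻¹ᵁ nonvanishing L s : Set (specOver φ').left).Nonempty := by
    have h1 : pairing (scalars (specOver φ')) s (fun p ↦ toΓ φ' (v p)) ≠ 0 := by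
      have h2 := map_pairing φ' (toΓ φ' : R →+* Γ((specOver φ').left, ⊤)) s v
      rw [toΓ_comp] at h2
      refine fun h3 ↦ hs ((toΓ φ').injective ?_)
      rw [map_zero]
      exact h2.trans h3
    rw [hz.preimage_nonvanishing s, Set.nonempty_iff_ne_empty]
    intro h2
    exact h1 ((basicOpen_eq_bot_iff _).mp (TopologicalSpace.Opens.ext h2))
  rw [mem_closure_iff]
  intro O hO hyO
  have hO' : (z.left ⁻¹' O).Nonempty := by
    refine ⟨(specMap φ' ψ).left t, ?_⟩
    rw [← hyz] at hyO
    exact hyO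
  -- The spectrum of a domain is irreducible, so a neighborhood of the special point meets the locus
  -- where `s` does not vanish.
  obtain ⟨r, hr1, hr2⟩ := nonempty_preirreducible_inter (hO.preimage z.left.continuous)
    (z.left ⁻¹ᵁ nonvanishing L s).isOpen hO' hne
  exact ⟨z.left r, hr1, hr2⟩

/-- The specialization along a line in `G(2,5)` through the point `u ∧ v`. -/
theorem mem_closure_nonvanishing_of_line {K : Type u} [Field K] {φ : k →+* K}
    {y : specOver φ ⟶ linearSection L} {u v x : Fin 5 → K}
    (hw : HasCoords _ (y.left ≫ linearSectionEmb L) fun p ↦ toΓ φ (wedge u v p))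
    (t : (specOver φ).left) (hx : ∀ s ∈ L, form φ s x v = 0) {s : Pairs → k}
    (hs : form φ s x v ≠ 0) :
    y.left t ∈ closure (nonvanishing L s : Set (linearSection L).left) := by
  -- The germ at 0 of the line `(u + T x) ∧ v`, over a local domain in which the coefficient of `T`
  -- can be read off.
  let C : K →+* PowerSeries K := PowerSeries.C
  let X : Fin 5 → PowerSeries K :=
    (fun i ↦ C (u i)) + (PowerSeries.X : PowerSeries K) • fun i ↦ C (x i)
  have hsec := (isSectionPoint_toΓ_iff φ _).mp hw.isSectionPoint
  have hform : ∀ s, pairing (C.comp φ) s (wedge X fun i ↦ C (v i)) =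
      C (form φ s u v) + PowerSeries.X * C (form φ s x v) := fun s ↦ by
    rw [pairing_wedge, map_form, map_form]
    simp only [X, map_add, map_smul, LinearMap.add_apply, LinearMap.smul_apply, smul_eq_mul]
  have hloc : IsLocalHom (PowerSeries.constantCoeff (R := K)) :=
    ⟨fun f hf ↦ PowerSeries.isUnit_iff_constantCoeff.mpr hf⟩
  refine mem_closure_nonvanishing_of_specialization (v := wedge X fun i ↦ C (v i)) hw t (C.comp φ)
    (PowerSeries.constantCoeff (R := K)) (RingHom.ext fun c ↦ by simp [C])
    ⟨isPlucker_wedge _ _, fun s hs ↦ ?_⟩ (fun q ↦ by simp [wedge, X, C]) ?_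
  · rw [hform, hx s hs, ← pairing_wedge, hsec.2 s hs]
    simp
  · rw [hform]
    intro h
    refine hs ?_
    have := congrArg (PowerSeries.coeff 1) h
    rw [map_add, PowerSeries.coeff_C, PowerSeries.coeff_mul_C] at this
    simpa using this

/-! ### Lines of the section through a given geometric point -/

variable {K : Type u} [Field K] {V₃ : Submodule k (Fin 5 → k)} {α β a₁ a₂ : Fin 5 → k}

theorem form_wedge (φ : k →+* K) (α β : Fin 5 → k) (x y : Fin 5 → K) :
    form φ (wedge α β) x y = ((fun i ↦ φ (α i)) ⬝ᵥ x) * ((fun i ↦ φ (β i)) ⬝ᵥ y) -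
      ((fun i ↦ φ (α i)) ⬝ᵥ y) * ((fun i ↦ φ (β i)) ⬝ᵥ x) := by
  rw [← altForm_wedge, form_apply]
  exact Finset.sum_congr rfl fun p _ ↦ by rw [map_wedge]; rfl

/-- Over `K` the space `V₃` is replaced by the common zeros of `α` and `β`. The claim holds because
`s = α ∧ γ + β ∧ δ - s(a₁, a₂) α ∧ β` with `γ = s(a₁, ·)` and `δ = s(a₂, ·)`. -/
theorem IsCoframe.form_eq_zero (h : IsCoframe V₃ α β a₁ a₂) (φ : k →+* K) {s : Pairs → k}
    (hs : s ∈ formsVanishingOn V₃) {x y : Fin 5 → K} (hxα : (fun i ↦ φ (α i)) ⬝ᵥ x = 0)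
    (hxβ : (fun i ↦ φ (β i)) ⬝ᵥ x = 0) (hyα : (fun i ↦ φ (α i)) ⬝ᵥ y = 0)
    (hyβ : (fun i ↦ φ (β i)) ⬝ᵥ y = 0) : form φ s x y = 0 := by
  obtain ⟨γ, hγ⟩ := exists_dotProduct_eq (form (RingHom.id k) s a₁)
  obtain ⟨δ, hδ⟩ := exists_dotProduct_eq (form (RingHom.id k) s a₂)
  have e : s = wedge α γ + wedge β δ + (-altForm s a₁ a₂) • wedge α β := by
    refine altForm_ext fun x y ↦ ?_
    have h1 := hs _ (h.decomp x) _ (h.decomp y)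
    rw [altForm_add, altForm_add, altForm_smul, altForm_wedge, altForm_wedge, altForm_wedge,
      hγ, hγ, hδ, hδ]
    simp only [← altForm_eq_form]
    simp only [altForm_sub_left, altForm_sub_right, altForm_smul_left, altForm_smul_right,
      altForm_self, altForm_swap s a₂ a₁, altForm_swap s x] at h1
    rw [altForm_swap s x y]
    linear_combination h1
  rw [e, ← pairing_wedge, pairing_add, pairing_add, pairing_smul]
  simp only [pairing_wedge, form_wedge, hxα, hxβ, hyα, hyβ]
  ring

theorem dotProduct_map (φ : k →+* K) (α a : Fin 5 → k) :
    (fun i ↦ φ (α i)) ⬝ᵥ (fun i ↦ φ (a i)) = φ (α ⬝ᵥ a) := by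
  simp [dotProduct]

/-- Otherwise `(α ∧ β)(·, v)` equals `ω(·, v)` for some `ω` in the `K`-span of `L`. The hyperplane
`(α ∧ β)(·, v) = 0` consists of the vectors of `V₃ ⊗ K` plus multiples of `v`, so `ω` vanishes on
it. A form vanishing on a hyperplane has rank at most two, contrary to smoothness. -/
theorem exists_direction_off_hyperplane (hsmooth : Smooth (linearSection L).hom)
    {s₁ s₂ : Pairs → k} (h₁ : s₁ ∈ L) (h₂ : s₂ ∈ L)
    (hL : ∀ s ∈ L, ∃ l m : k, s = l • s₁ + m • s₂) (hLV : L ≤ formsVanishingOn V₃)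
    (hf : IsCoframe V₃ α β a₁ a₂) (φ : k →+* K) {v : Fin 5 → K}
    (hv : ¬ ((fun i ↦ φ (α i)) ⬝ᵥ v = 0 ∧ (fun i ↦ φ (β i)) ⬝ᵥ v = 0)) :
    ∃ x, (∀ s ∈ L, form φ s x v = 0) ∧ form φ (wedge α β) x v ≠ 0 := by
  by_contra! hcon
  let h := (form φ (wedge α β)).flip v
  have hmem : h ∈ Submodule.span K (Set.range ![(form φ s₁).flip v, (form φ s₂).flip v]) := by
    -- A functional vanishing on the common kernel of finitely many functionals is in their span.
    refine mem_span_of_iInf_ker_le_ker fun x hx ↦ hcon x fun s hs ↦ ?_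
    rw [Submodule.mem_iInf] at hx
    have e₁ : form φ s₁ x v = 0 := hx 0
    have e₂ : form φ s₂ x v = 0 := hx 1
    obtain ⟨l, m, rfl⟩ := hL s hs
    rw [← pairing_wedge, pairing_add, pairing_smul, pairing_smul, pairing_wedge, pairing_wedge,
      e₁, e₂, mul_zero, mul_zero, add_zero]
  rw [Matrix.range_cons_cons_empty, Submodule.mem_span_pair] at hmem
  obtain ⟨l, m, hlm⟩ := hmem
  set ω := l • (fun p ↦ φ (s₁ p)) + m • fun p ↦ φ (s₂ p) with hω
  have hωform : ∀ x y, altForm ω x y = l * form φ s₁ x y + m * form φ s₂ x y := fun x y ↦ by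
    rw [hω, altForm_add, altForm_smul, altForm_smul]
    rfl
  have hωv : ∀ x, altForm ω x v = form φ (wedge α β) x v := fun x ↦ by
    rw [hωform]
    exact LinearMap.congr_fun hlm x
  have hiso : ∀ x y, (fun i ↦ φ (α i)) ⬝ᵥ x = 0 → (fun i ↦ φ (β i)) ⬝ᵥ x = 0 →
      (fun i ↦ φ (α i)) ⬝ᵥ y = 0 → (fun i ↦ φ (β i)) ⬝ᵥ y = 0 → altForm ω x y = 0 :=
    fun x y h1 h2 h3 h4 ↦ by
      rw [hωform, hf.form_eq_zero φ (hLV h₁) h1 h2 h3 h4, hf.form_eq_zero φ (hLV h₂) h1 h2 h3 h4,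
        mul_zero, mul_zero, add_zero]
  have hdec : ∀ x, form φ (wedge α β) x v = 0 → ∃ c : K,
      (fun i ↦ φ (α i)) ⬝ᵥ (x - c • v) = 0 ∧ (fun i ↦ φ (β i)) ⬝ᵥ (x - c • v) = 0 := by
    intro x hx
    rw [form_wedge] at hx
    simp only [dotProduct_sub, dotProduct_smul, smul_eq_mul]
    by_cases hα : (fun i ↦ φ (α i)) ⬝ᵥ v = 0
    · have hβ : (fun i ↦ φ (β i)) ⬝ᵥ v ≠ 0 := fun h ↦ hv ⟨hα, h⟩
      refine ⟨((fun i ↦ φ (β i)) ⬝ᵥ x) / ((fun i ↦ φ (β i)) ⬝ᵥ v), ?_, ?_⟩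
      · rw [hα, zero_mul, sub_zero] at hx
        rw [hα, mul_zero, sub_zero]
        exact (mul_eq_zero.mp hx).resolve_right hβ
      · rw [div_mul_cancel₀ _ hβ, sub_self]
    · refine ⟨((fun i ↦ φ (α i)) ⬝ᵥ x) / ((fun i ↦ φ (α i)) ⬝ᵥ v), ?_, ?_⟩
      · rw [div_mul_cancel₀ _ hα, sub_self]
      · field_simp
        linear_combination -hx
  have hiso' : ∀ x y, form φ (wedge α β) x v = 0 → form φ (wedge α β) y v = 0 →
      altForm ω x y = 0 := by
    intro x y hx hy
    obtain ⟨c, hc1, hc2⟩ := hdec x hx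
    obtain ⟨d, hd1, hd2⟩ := hdec y hy
    have := hiso _ _ hc1 hc2 hd1 hd2
    simp only [altForm_sub_left, altForm_sub_right, altForm_smul_left, altForm_smul_right,
      altForm_self, altForm_swap ω v y] at this
    simp only [hωv, hx, hy] at this
    linear_combination this
  obtain ⟨x₀, hx₀⟩ : ∃ x₀, form φ (wedge α β) x₀ v ≠ 0 := by
    by_contra! hall
    refine hv ⟨?_, ?_⟩
    · have := hall fun i ↦ φ (a₂ i)
      simpa [form_wedge, dotProduct_map, hf.left_snd, hf.right_snd] using this
    · have := hall fun i ↦ φ (a₁ i)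
      simpa [form_wedge, dotProduct_map, hf.left_fst, hf.right_fst] using this
  -- The vectors of the isotropic hyperplane that are orthogonal to `x₀`, a vector outside it, lie
  -- in the kernel of `ω`; two conditions leave dimension at least 3.
  let f : (Fin 5 → K) →ₗ[K] (Fin 2 → K) := LinearMap.pi ![h, form (RingHom.id K) ω x₀]
  have hfin : 3 ≤ Module.finrank K (LinearMap.ker f) := by
    have h1 := f.finrank_range_add_finrank_ker
    have h2 := (LinearMap.range f).finrank_le
    rw [Module.finrank_fin_fun] at h1 h2
    omega
  have hker : ω ∈ formsWithKernel (LinearMap.ker f) := by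
    intro y hy z
    have hy1 : form φ (wedge α β) y v = 0 := congrFun (show f y = 0 from hy) 0
    have hy2 : altForm ω x₀ y = 0 := congrFun (show f y = 0 from hy) 1
    have := hiso' y (z - (form φ (wedge α β) z v / form φ (wedge α β) x₀ v) • x₀) hy1 (by
      rw [map_sub, map_smul, LinearMap.sub_apply, LinearMap.smul_apply, smul_eq_mul,
        div_mul_cancel₀ _ hx₀, sub_self])
    rw [altForm_sub_right, altForm_smul_right, altForm_swap ω y x₀, hy2] at this
    linear_combination this
  have h0 := eq_zero_of_mem_formsWithKernel hsmooth φ h₁ h₂ hL hfin l m hker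
  refine hx₀ ?_
  rw [← hωv, hω, h0]
  simp [altForm]

/-- The vanishing determinant gives a nonzero `x` in the span of `a₁, a₂` with `s₁(x, v) = s₂(x, v)
= 0`. As `x` is not in `V₃ ⊗ K` and `v ≠ 0`, some form `α ∧ e_j^∨` or `β ∧ e_j^∨` does not vanish at
`x ∧ v`. -/
theorem exists_direction_off_plane {s₁ s₂ : Pairs → k}
    (hL : ∀ s ∈ L, ∃ l m : k, s = l • s₁ + m • s₂)
    (hf : IsCoframe V₃ α β a₁ a₂) (φ : k →+* K) {v : Fin 5 → K} (hv0 : v ≠ 0)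
    (hvα : (fun i ↦ φ (α i)) ⬝ᵥ v = 0) (hvβ : (fun i ↦ φ (β i)) ⬝ᵥ v = 0)
    (hdet : form φ s₁ (fun i ↦ φ (a₁ i)) v * form φ s₂ (fun i ↦ φ (a₂ i)) v -
      form φ s₁ (fun i ↦ φ (a₂ i)) v * form φ s₂ (fun i ↦ φ (a₁ i)) v = 0) :
    ∃ x, (∀ s ∈ L, form φ s x v = 0) ∧ ∃ s ∈ formsVanishingOn V₃, form φ s x v ≠ 0 := by
  obtain ⟨c, hc0, hc⟩ := Matrix.exists_mulVec_eq_zero_iff.mpr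
    ((Matrix.det_fin_two_of _ _ _ _).trans hdet)
  have e₁ := congrFun hc 0
  have e₂ := congrFun hc 1
  simp only [Matrix.mulVec, dotProduct, Fin.sum_univ_two, Matrix.of_apply, Matrix.cons_val_zero,
    Matrix.cons_val_one, Pi.zero_apply] at e₁ e₂
  let x : Fin 5 → K := c 0 • (fun i ↦ φ (a₁ i)) + c 1 • fun i ↦ φ (a₂ i)
  have hxα : (fun i ↦ φ (α i)) ⬝ᵥ x = c 0 := by
    simp [x, dotProduct_add, dotProduct_smul, dotProduct_map, hf.left_fst, hf.left_snd]
  have hxβ : (fun i ↦ φ (β i)) ⬝ᵥ x = c 1 := by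
    simp [x, dotProduct_add, dotProduct_smul, dotProduct_map, hf.right_fst, hf.right_snd]
  refine ⟨x, fun s hs ↦ ?_, ?_⟩
  · obtain ⟨l, m, rfl⟩ := hL s hs
    rw [← pairing_wedge, pairing_add, pairing_smul, pairing_smul, pairing_wedge, pairing_wedge]
    simp only [x, map_add, map_smul, LinearMap.add_apply, LinearMap.smul_apply, smul_eq_mul]
    linear_combination φ l * e₁ + φ m * e₂
  · obtain ⟨j, hj⟩ := Function.ne_iff.mp hv0
    have hsingle : (fun i ↦ φ ((Pi.single j 1 : Fin 5 → k) i)) ⬝ᵥ v = v j := by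
      simp [dotProduct, Pi.single_apply, apply_ite φ]
    by_contra! hall
    refine hc0 (funext fun i ↦ ?_)
    have h1 := hall _ (hf.wedge_left_mem (Pi.single j 1))
    have h2 := hall _ (hf.wedge_right_mem (Pi.single j 1))
    rw [form_wedge, hxα, hvα, hsingle, zero_mul, sub_zero] at h1
    rw [form_wedge, hxβ, hvβ, hsingle, zero_mul, sub_zero] at h2
    fin_cases i
    · exact (mul_eq_zero.mp h1).resolve_right hj
    · exact (mul_eq_zero.mp h2).resolve_right hj

/-- A line in `G(2,5)` through a point of the plane `σ_{2,2}(V₃)` that leaves the plane. -/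
theorem exists_line_off_plane [IsAlgClosed K] [CharZero K] (s₁ s₂ : Pairs → k)
    (φ : k →+* K) (α β a₁ a₂ : Fin 5 → k) {u v : Fin 5 → K} (huv : wedge u v ≠ 0)
    (huα : (fun i ↦ φ (α i)) ⬝ᵥ u = 0) (huβ : (fun i ↦ φ (β i)) ⬝ᵥ u = 0)
    (hvα : (fun i ↦ φ (α i)) ⬝ᵥ v = 0) (hvβ : (fun i ↦ φ (β i)) ⬝ᵥ v = 0) :
    ∃ u' v', wedge u' v' = wedge u v ∧ v' ≠ 0 ∧ (fun i ↦ φ (α i)) ⬝ᵥ v' = 0 ∧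
      (fun i ↦ φ (β i)) ⬝ᵥ v' = 0 ∧
      form φ s₁ (fun i ↦ φ (a₁ i)) v' * form φ s₂ (fun i ↦ φ (a₂ i)) v' -
        form φ s₁ (fun i ↦ φ (a₂ i)) v' * form φ s₂ (fun i ↦ φ (a₁ i)) v' = 0 := by
  set b₁ : Fin 5 → K := fun i ↦ φ (a₁ i)
  set b₂ : Fin 5 → K := fun i ↦ φ (a₂ i)
  -- The determinant is a quadratic form on the span of `u` and `v`. Either `u` is a zero of it, or
  -- its value at `v + r u` is a genuine quadratic polynomial in `r`, which has a root over `K`.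
  by_cases hu : form φ s₁ b₁ u * form φ s₂ b₂ u - form φ s₁ b₂ u * form φ s₂ b₁ u = 0
  · refine ⟨-v, u, ?_, ?_, huα, huβ, hu⟩
    · funext p
      simp only [wedge, Pi.neg_apply]
      ring
    · rintro rfl
      exact huv (funext fun p ↦ by simp [wedge])
  · obtain ⟨r, hr⟩ := exists_quadratic_eq_zero hu
      (b := form φ s₁ b₁ v * form φ s₂ b₂ u + form φ s₁ b₁ u * form φ s₂ b₂ v -
        form φ s₁ b₂ v * form φ s₂ b₁ u - form φ s₁ b₂ u * form φ s₂ b₁ v)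
      (c := form φ s₁ b₁ v * form φ s₂ b₂ v - form φ s₁ b₂ v * form φ s₂ b₁ v)
      (IsAlgClosed.exists_eq_mul_self _)
    refine ⟨u, v + r • u, ?_, fun h ↦ ?_, ?_, ?_, ?_⟩
    · funext p
      simp only [wedge, Pi.add_apply, Pi.smul_apply, smul_eq_mul]
      ring
    · refine huv (funext fun p ↦ ?_)
      have h1 := congrFun h p.1.1
      have h2 := congrFun h p.1.2
      simp only [wedge, Pi.add_apply, Pi.smul_apply, smul_eq_mul, Pi.zero_apply] at h1 h2 ⊢
      linear_combination u p.1.1 * h2 - u p.1.2 * h1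
    · rw [dotProduct_add, dotProduct_smul, huα, hvα, smul_zero, add_zero]
    · rw [dotProduct_add, dotProduct_smul, huβ, hvβ, smul_zero, add_zero]
    · simp only [map_add, map_smul, smul_eq_mul]
      linear_combination hr

theorem wedge_neg_swap (u v : Fin 5 → K) : wedge (-v) u = wedge u v := by
  funext p
  simp only [wedge, Pi.neg_apply]
  ring

theorem exists_decomposable_geometricPoint (x : (linearSection L).left) :
    ∃ (K : Type u) (_ : Field K) (_ : IsAlgClosed K) (φ : k →+* K) (u v : Fin 5 → K)
      (y : specOver φ ⟶ linearSection L) (t : (specOver φ).left), wedge u v ≠ 0 ∧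
      HasCoords _ (y.left ≫ linearSectionEmb L) (fun p ↦ toΓ φ (wedge u v p)) ∧ y.left t = x := by
  obtain ⟨K, hK, hKc, φ, w, p, y, t, hp, hw, ht⟩ := exists_geometricPoint x
  have hsec := (isSectionPoint_toΓ_iff φ _).mp hw.isSectionPoint
  have hdec : w = wedge (skew w p.1.1) (skew w p.1.2) := by
    simpa only [hp, one_mul] using hsec.1.mul_eq_wedge p
  refine ⟨K, hK, hKc, φ, skew w p.1.1, skew w p.1.2, y, t, fun h ↦ ?_, ?_, ht⟩
  · rw [h] at hdec
    simp [hdec] at hp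
  · rw [← hdec]
    exact hw

theorem notMem_nonvanishing {φ : k →+* K} {y : specOver φ ⟶ linearSection L} {u v : Fin 5 → K}
    (hw : HasCoords _ (y.left ≫ linearSectionEmb L) fun p ↦ toΓ φ (wedge u v p))
    (t : (specOver φ).left) {s : Pairs → k} (hs : form φ s u v = 0) :
    y.left t ∉ nonvanishing L s := by
  intro h
  have h1 : t ∈ y.left ⁻¹ᵁ nonvanishing L s := h
  have h2 := map_pairing φ (toΓ φ : K →+* Γ((specOver φ).left, ⊤)) s (wedge u v)
  rw [toΓ_comp, pairing_wedge, hs, map_zero] at h2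
  rw [hw.preimage_nonvanishing s] at h1
  have h3 : (specOver φ).left.basicOpen
      (pairing (scalars (specOver φ)) s fun p ↦ toΓ φ (wedge u v p)) = ⊥ := by
    refine (congrArg _ h2.symm).trans (Scheme.basicOpen_zero _ _)
  rw [h3] at h1
  exact h1

/-- The argument has two stages: points of the plane are limits of points of `X_L` outside it, and
points outside it are limits of points with `α ∧ β ≠ 0`. -/
theorem dense_nonvanishing [CharZero k] (hsmooth : Smooth (linearSection L).hom)
    (hL : Module.finrank k L ≤ 2) (hLV : L ≤ formsVanishingOn V₃)
    (hf : IsCoframe V₃ α β a₁ a₂) :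
    Dense (nonvanishing L (wedge α β) : Set (linearSection L).left) := by
  obtain ⟨s₁, h₁, s₂, h₂, hs⟩ := exists_span_pair L hL
  -- The second alternative describes the points of the plane; the first clause there rules it out
  -- for points of the set approximating them.
  have hoff : ∀ x : (linearSection L).left,
      x ∈ closure (nonvanishing L (wedge α β) : Set (linearSection L).left) ∨
      ((∀ s ∈ formsVanishingOn V₃, x ∉ nonvanishing L s) ∧ ∃ s ∈ formsVanishingOn V₃,
        x ∈ closure (nonvanishing L s : Set (linearSection L).left)) := by
    intro x
    obtain ⟨K, _, _, φ, u, v, y, t, huv, hw, rfl⟩ := exists_decomposable_geometricPoint x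
    have : CharZero K := charZero_of_injective_ringHom φ.injective
    by_cases hv : (fun i ↦ φ (α i)) ⬝ᵥ v = 0 ∧ (fun i ↦ φ (β i)) ⬝ᵥ v = 0
    · by_cases hu : (fun i ↦ φ (α i)) ⬝ᵥ u = 0 ∧ (fun i ↦ φ (β i)) ⬝ᵥ u = 0
      · refine Or.inr ⟨fun s hs ↦ notMem_nonvanishing hw t
          (hf.form_eq_zero φ hs hu.1 hu.2 hv.1 hv.2), ?_⟩
        obtain ⟨u', v', huv', hv0, hvα, hvβ, hdet⟩ :=
          exists_line_off_plane s₁ s₂ φ α β a₁ a₂ huv hu.1 hu.2 hv.1 hv.2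
        obtain ⟨x, hx, s, hsV, hsx⟩ := exists_direction_off_plane hs hf φ hv0 hvα hvβ hdet
        exact ⟨s, hsV, mem_closure_nonvanishing_of_line (huv' ▸ hw) t hx hsx⟩
      · obtain ⟨x, hx, hx'⟩ := exists_direction_off_hyperplane hsmooth h₁ h₂ hs hLV hf φ hu
        exact Or.inl (mem_closure_nonvanishing_of_line ((wedge_neg_swap u v).symm ▸ hw) t hx hx')
    · obtain ⟨x, hx, hx'⟩ := exists_direction_off_hyperplane hsmooth h₁ h₂ hs hLV hf φ hv
      exact Or.inl (mem_closure_nonvanishing_of_line hw t hx hx')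
  intro x
  obtain h | ⟨-, s, hsV, hx⟩ := hoff x
  · exact h
  · refine closure_minimal (fun y hy ↦ ?_) isClosed_closure hx
    exact (hoff y).resolve_right fun h ↦ h.1 s hsV hy

end Density

/-! ### Smooth linear sections are integral -/

section Integral

-- By flatness `B` embeds into its base change to the fraction field of `A`, which is unramified
-- over a field and hence reduced.
open TensorProduct in
theorem isReduced_of_etale {A B : Type u} [CommRing A] [IsDomain A] [CommRing B] [Algebra A B]
    [Algebra.Etale A B] : _root_.IsReduced B := by
  let F := FractionRing A
  have : _root_.IsReduced (F ⊗[A] B) := Algebra.FormallyUnramified.isReduced_of_field F (F ⊗[A] B)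
  have hflat : Module.Flat A B := inferInstance
  exact isReduced_of_injective (Algebra.TensorProduct.includeRight : B →ₐ[A] F ⊗[A] B)
    (Algebra.TensorProduct.includeRight_injective (IsFractionRing.injective A F))

/-- A standard smooth algebra is étale over a polynomial ring, which is again a domain. -/
theorem isReduced_of_isStandardSmooth {A B : Type u} [CommRing A] [IsDomain A] [CommRing B]
    {f : A →+* B} (hf : f.IsStandardSmooth) : _root_.IsReduced B := by
  obtain ⟨n, g, -, hg⟩ := hf.exists_etale_mvPolynomial
  algebraize [g]
  exact isReduced_of_etale (A := MvPolynomial (Fin n) A)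

theorem isReduced_of_smooth {X Y : Scheme.{u}} (f : X ⟶ Y) [Smooth f] [IsIntegral Y] :
    IsReduced X := by
  have : ∀ x : X, _root_.IsReduced (X.presheaf.stalk x) := by
    intro x
    obtain ⟨U, -, V, hV, hx, e, h⟩ := Smooth.exists_isStandardSmooth f x
    have : Nonempty U := ⟨⟨f x, e hx⟩⟩
    have h1 : _root_.IsReduced Γ(X, V) := isReduced_of_isStandardSmooth h
    let _ := X.presheaf.algebra_section_stalk (U := V) ⟨x, hx⟩
    have := hV.isLocalization_stalk ⟨x, hx⟩
    exact isReduced_localizationPreserves (hV.primeIdealOf ⟨x, hx⟩).asIdeal.primeCompl _ h1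
  exact isReduced_of_isReduced_stalk X

variable {k : Type u} [Field k] {n : ℕ} {L : Submodule k (Pairs → k)}
  {V₃ : Submodule k (Fin 5 → k)} {ζ : Fin (n + 1) → Pairs → k} {α β a₁ a₂ : Fin 5 → k}
  {c d : Fin n → Fin 5 → k}

theorem IsAdaptedFrame.exists_orbitMap (hf : IsAdaptedFrame L V₃ ζ α β a₁ a₂ c d)
    (hp : IsProjectionCoordinates L V₃ ζ) :
    ∃ f : vectorGroup k n ⟶ linearSection L,
      (nonvanishing L (ζ 0) : Set (linearSection L).left) ⊆ Set.range f.left := by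
  let _ := hf.modObj hp
  obtain ⟨o, ho⟩ := hf.exists_basePoint (vectorGroup k n)
  -- The orbit map is the universal point of the group acting on the base point.
  refine ⟨𝟙 (vectorGroup k n) • o, fun x hx ↦ ?_⟩
  obtain ⟨K, _, _, φ, w, p, y, t, -, hw, rfl⟩ := exists_geometricPoint x
  have hsub : Subsingleton (specOver φ).left :=
    inferInstanceAs (Subsingleton (PrimeSpectrum K))
  obtain ⟨w, hw, hw0⟩ := IsAdaptedFrame.normalize hw (s := ζ 0) fun t' ↦ by
    rw [hsub.elim t' t]
    exact hx
  obtain ⟨g, hg⟩ := exists_coords_eq (k := k) (T := specOver φ)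
    fun j ↦ pairing (scalars (specOver φ)) (ζ j.succ) w
  refine ⟨g.left t, ?_⟩
  have h1 : g ≫ (𝟙 (vectorGroup k n) • o) = y := by
    rw [ModObj.comp_smul, Category.comp_id]
    ext1
    rw [← cancel_mono (linearSectionEmb L)]
    have h2 : HasCoords _ ((g ≫ o).left ≫ linearSectionEmb L)
        (baseBivector (scalars (specOver φ)) a₁ a₂) := by
      have h3 := ho.comp g
      rw [map_baseBivector, pull_comp_scalars] at h3
      rwa [Over.comp_left, Category.assoc]
    refine (hf.smul_coords hp g _ h2).hom_ext ?_
    rw [hg, ← hf.eq_wedgeAct_baseBivector hp hw.isSectionPoint hw0]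
    exact hw
  rw [← h1]
  rfl

/-- The orbit map has dense image and an irreducible source, so the section is irreducible; it is
reduced because it is smooth over a field. -/
theorem isIntegral_linearSection (hsmooth : Smooth (linearSection L).hom)
    (hf : IsAdaptedFrame L V₃ ζ α β a₁ a₂ c d) (hp : IsProjectionCoordinates L V₃ ζ)
    (hd : Dense (nonvanishing L (ζ 0) : Set (linearSection L).left)) :
    IsIntegral (linearSection L).left := by
  obtain ⟨f, hU⟩ := hf.exists_orbitMap hp
  have hirr : IrreducibleSpace (vectorGroup k n).left :=
    inferInstanceAs (IrreducibleSpace 𝔸(ULift.{u} (Fin n); Spec (.of k)))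
  have h1 : IsIrreducible (Set.univ : Set (linearSection L).left) := by
    have h2 := ((IrreducibleSpace.isIrreducible_univ (vectorGroup k n).left).image f.left
      f.left.continuous.continuousOn).closure
    rw [Set.image_univ] at h2
    rwa [(hd.mono hU).closure_eq] at h2
  have : IrreducibleSpace (linearSection L).left :=
    { isPreirreducible_univ := h1.2, toNonempty := ⟨h1.1.some⟩ }
  have : IsReduced (linearSection L).left := isReduced_of_smooth (linearSection L).hom
  exact isIntegral_of_irreducibleSpace_of_isReduced _

theorem quasiCompact_linearSection (L : Submodule k (Pairs → k)) :
    QuasiCompact (linearSection L).hom := by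
  have : QuasiSeparatedSpace ((Functor.fromPUnit (Spec (.of k))).obj (linearSection L).right) :=
    inferInstanceAs (QuasiSeparatedSpace (Spec (.of k)))
  have : CompactSpace ((Functor.fromPUnit (Spec (.of k))).obj (linearSection L).right) :=
    inferInstanceAs (CompactSpace (Spec (.of k)))
  refine (quasiCompact_iff_compactSpace (linearSection L).hom).mpr ⟨?_⟩
  have h : (Set.univ : Set (linearSection L).left) =
      ⋃ p, Set.range (chartι (sectionIdeal L) p) := by
    refine (Set.eq_univ_of_forall fun x ↦ ?_).symm
    obtain ⟨p, hp⟩ := exists_mem_pspace_basicOpen (linearSectionEmb L x)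
    exact Set.mem_iUnion.mpr ⟨p, (opensRange_chartι (sectionIdeal L) p).ge hp⟩
  rw [h]
  exact isCompact_iUnion fun p ↦ isCompact_range (chartι (sectionIdeal L) p).continuous

theorem IsAdaptedFrame.isVectorGroupStructure [CharZero k]
    (hsmooth : Smooth (linearSection L).hom) (hL : Module.finrank k L ≤ 2)
    (hf : IsAdaptedFrame L V₃ ζ α β a₁ a₂ c d) (hp : IsProjectionCoordinates L V₃ ζ) :
    letI := hf.modObj hp
    IsVectorGroupStructure n (linearSection L) (nonvanishing L (ζ 0)) := by
  let _ := hf.modObj hp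
  have hd : Dense (nonvanishing L (ζ 0) : Set (linearSection L).left) := by
    rw [hf.zero_eq]
    exact dense_nonvanishing hsmooth hL (hp.sup_eq ▸ le_sup_right) hf.isCoframe
  exact
    { isIntegral := isIntegral_linearSection hsmooth hf hp hd
      locallyOfFiniteType := inferInstance
      quasiCompact := quasiCompact_linearSection L
      effective := hf.isEffectiveAction hp
      orbit := hf.isOpenOrbit hp
      dense := hd }

end Integral

end LinearSectionG25

theorem mainTheorem6 {k : Type u} [Field k] [CharZero k] (L : Submodule k (Pairs → k))
    (hL : Module.finrank k L ≤ 2) (hsmooth : Smooth (linearSection L).hom) :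
    AdmitsVectorGroupStructure (linearSection L) ∧
    (∃ V₃ : Submodule k (Fin 5 → k), Module.finrank k V₃ = 3 ∧ L ≤ formsVanishingOn V₃) ∧
    ∀ V₃ : Submodule k (Fin 5 → k), Module.finrank k V₃ = 3 → L ≤ formsVanishingOn V₃ →
      ∀ n : ℕ, Module.finrank k L + n = 6 →
        (∃ ζ : Fin (n + 1) → Pairs → k, IsProjectionCoordinates L V₃ ζ) ∧
        ∀ ζ : Fin (n + 1) → Pairs → k, IsProjectionCoordinates L V₃ ζ →
          ∃ π : (projectionDomain L ζ).toScheme ⟶ PSpace (Fin (n + 1)) k,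
            IsLinearProjection L ζ π ∧ IsIsoOverComplement L ζ π ∧
            ∃ (_ : ModObj (vectorGroup k n) (linearSection L)) (ρ : VectorGroupRep k n 5),
              IsVectorGroupStructure n (linearSection L) (nonvanishing L (ζ 0)) ∧
              LiftsToricAction L ζ π ∧ ρ.IsUnipotent ∧ IsInducedByWedge L ρ := by
  obtain ⟨V₃, hV, hLV⟩ : ∃ V₃ : Submodule k (Fin 5 → k), Module.finrank k V₃ = 3 ∧
      L ≤ formsVanishingOn V₃ := by
    obtain ⟨s₁, -, s₂, -, hs⟩ := exists_span_pair L hL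
    obtain ⟨V₃, hV, h₁, h₂⟩ := exists_isotropic s₁ s₂
    refine ⟨V₃, hV, fun s hsL ↦ ?_⟩
    obtain ⟨l, m, rfl⟩ := hs s hsL
    exact add_mem (Submodule.smul_mem _ l h₁) (Submodule.smul_mem _ m h₂)
  refine ⟨?_, ⟨V₃, hV, hLV⟩, fun V₃ hV hLV n hn ↦ ⟨?_, fun ζ hζ ↦ ?_⟩⟩
  -- The subtraction in `ℕ` does not truncate, since `dim L ≤ 2`.
  · obtain ⟨ζ, hζ⟩ := exists_isProjectionCoordinates (n := 6 - Module.finrank k L) L V₃ hV hLV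
      (by omega) (disjoint_formsWithKernel hsmooth hL hV)
    obtain ⟨α, β, a₁, a₂, c, d, hf⟩ := hζ.exists_isAdaptedFrame hV
    exact ⟨_, hf.modObj hζ, _, hf.isVectorGroupStructure hsmooth hL hζ⟩
  · exact exists_isProjectionCoordinates L V₃ hV hLV hn (disjoint_formsWithKernel hsmooth hL hV)
  · obtain ⟨α, β, a₁, a₂, c, d, hf⟩ := hζ.exists_isAdaptedFrame hV
    exact ⟨(projection L ζ).left, isLinearProjection_projection, hf.isIsoOverComplement hζ,
      hf.modObj hζ, hf.rep hζ, hf.isVectorGroupStructure hsmooth hL hζ, hf.liftsToricAction hζ,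
      squareZeroRep_isUnipotent _ _, hf.isInducedByWedge hζ⟩
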